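/- Let $N\ge 1$, $m,d\ge 0$ be integers, $L>0$, $c_i^{(j)}\in\mathbb R$, and let $f^{(1)},\dots,f^{(N)}:\mathbb R^d\to\mathbb R^d$ be continuous with $\langle x_1-x_2,f^{(j)}(x_1)-f^{(j)}(x_2)\rangle\le -L\|x_1-x_2\|^2$ for all $x_1,x_2$ and $j$. Let $\Omega=C_0(\mathbb R,\mathbb R^m)$ be the space of continuous paths $\omega:\mathbb R\to\mathbb R^m$ with $\omega(0)=0$, with the compact-open topology, its Borel $\sigma$-algebra, Wiener measure $\mathbb P$ (under which the coordinates $W^{(1)},\dots,W^{(m)}$ are independent two-sided Wiener processes) and the shift $\theta_t\omega(\cdot)=\omega(\cdot+t)-\omega(t)$. Put $O_t^{(j)}=\sum_{i=1}^m c_i^{(j)}e^{-t}\int_{-\infty}^t e^{\tau}\,dW^{(i)}_\tau$ and consider, with cyclic indices ($x^{(0)}=x^{(N)}$, $x^{(N+1)}=x^{(1)}$) and $\nu>0$, the coupled random equations $$\frac{dx^{(j)}}{dt}=e^{-O_t^{(j)}}f^{(j)}(e^{O_t^{(j)}}x^{(j)})+O_t^{(j)}x^{(j)}+\nu\,(x^{(j-1)}-2x^{(j)}+x^{(j+1)}),\qquad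 j=1,\dots,N,$$ and the averaged random equation $$\frac{dz}{dt}=\frac1N\sum_{j=1}^N e^{-O_t^{(j)}}f^{(j)}(e^{O_t^{(j)}}z)+\frac1N\sum_{j=1}^N O_t^{(j)}z .$$ A random attractor of a random dynamical system is a random compact set that is invariant and pullback attracts every tempered random bounded set. Then there is a measurable $\theta$-invariant set $\overline\Omega\subset\Omega$ of full measure over which all these equations generate random dynamical systems (for times $t\ge 0$), and a (non-random) $\nu_0>0$ such that for every $\nu\ge\nu_0$ (for every $\nu>0$ if the noise coefficients are the same in every equation) the coupled system has a singleton random attractor $\{(\bar x_\nu^{(1)}(\omega),\dots,\bar x_\nu^{(N)}(\omega))\}$ over $\overline\Omega$, and the averaged equation has a singleton random attractor $\{\bar z(\omega)\}$ over $\overline\Omega$. For any such attractors, with $\bar x_\nu^{(j)}(t,\omega)=\bar x_\nu^{(j)}(\theta_t\omega)$ and $\bar z(t,\omega)=\bar z(\theta_t\omega)$: 1. for every $\omega\in\overline\Omega$ and every bounded interval $[T_1,T_2]$, $$\big(\bar x_\nu^{(1)}(t,\omega),\dots,\bar x_\nu^{(N)}(t,\omega)\big)\to\big(\bar z(t,\omega),\dots,\bar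 z(t,\omega)\big)\quad\text{uniformly for }t\in[T_1,T_2]$$ as $\nu\to\infty$ along the full continuum; 2. if $c_i^{(1)}=\dots=c_i^{(N)}=c_i$ for all $i$, so that $O^{(1)}_t=\dots=O^{(N)}_t=O_t$, then for $\nu\ge\nu_0$ the process $\bar X^{(j)}_{\nu,t}(\omega)=e^{O_t(\omega)}\bar x_\nu^{(j)}(t,\omega)$, $j=1,\dots,N$, is a stationary solution of the coupled Stratonovich equations $$dX_t^{(j)}=\Big(f^{(j)}(X_t^{(j)})+\nu\,(X_t^{(j-1)}-2X_t^{(j)}+X_t^{(j+1)})\Big)dt+\sum_{i=1}^m c_i X_t^{(j)}\circ dW_t^{(i)},\qquad j=1,\dots,N,$$ and these are exactly synchronized in the limit: for every $\omega\in\overline\Omega$, all components $\bar X^{(j)}_{\nu,t}(\omega)$ converge to the same limit $e^{O_t(\omega)}\bar z(t,\omega)$, uniformly for $t\in[T_1,T_2]$, as $\nu\to\infty$. -/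

import Mathlib

open MeasureTheory ProbabilityTheory Filter Topology Set
open scoped ENNReal NNReal

noncomputable section

namespace StochSync

/-! ### Wiener space, the shift and Wiener measure -/

/-- The path space `C₀(ℝ, ℝ^m)` of continuous `ω : ℝ → ℝ^m` with `ω 0 = 0`. -/
def WienerSpace (m : ℕ) : Type := {ω : C(ℝ, Fin m → ℝ) // ω 0 = 0}

variable {m d N : ℕ}

/-- The compact-open topology. -/
instance : TopologicalSpace (WienerSpace m) :=
  inferInstanceAs (TopologicalSpace {ω : C(ℝ, Fin m → ℝ) // ω 0 = 0})

/-- The Borel σ-algebra of the compact-open topology. -/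
instance : MeasurableSpace (WienerSpace m) := borel _

instance : BorelSpace (WienerSpace m) := ⟨rfl⟩

/-- The value `ω t` of a path; `ω.path t i` is the value at time `t` of the `i`-th
coordinate process `W⁽ⁱ⁾`. -/
def WienerSpace.path (ω : WienerSpace m) (t : ℝ) : Fin m → ℝ := ω.1 t

theorem WienerSpace.continuous_path (ω : WienerSpace m) : Continuous ω.path := ω.1.continuous

/-- The Wiener shift `(θ_t ω)(s) = ω (s + t) - ω t`. -/
def shift (t : ℝ) (ω : WienerSpace m) : WienerSpace m :=
  ⟨⟨fun s => ω.path (s + t) - ω.path t,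
      (ω.continuous_path.comp (continuous_id.add continuous_const)).sub continuous_const⟩,
    by simp⟩

/-- A two-sided scalar Wiener process indexed by `ℝ`: it starts in `0`, has continuous paths and
independent increments, and `W_t - W_s` is `N(0, t - s)`-distributed for `s ≤ t`. -/
structure IsTwoSidedWiener {Ω : Type*} [MeasurableSpace Ω] (W : ℝ → Ω → ℝ) (P : Measure Ω) :
    Prop where
  zero : ∀ᵐ ω ∂P, W 0 ω = 0
  continuous_paths : ∀ᵐ ω ∂P, Continuous fun t => W t ω
  indep_increments : HasIndepIncrements W P
  gaussian : ∀ s t : ℝ, s ≤ t →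
    HasLaw (fun ω => W t ω - W s ω) (gaussianReal 0 (t - s).toNNReal) P

/-- Wiener measure on `C₀(ℝ, ℝ^m)`: the law under which the coordinate processes are independent
two-sided scalar Wiener processes. -/
structure IsWienerMeasure (P : Measure (WienerSpace m)) : Prop where
  isProbabilityMeasure : IsProbabilityMeasure P
  wiener : ∀ i : Fin m, IsTwoSidedWiener (fun t ω => ω.path t i) P
  indep : iIndepFun (fun (i : Fin m) (ω : WienerSpace m) (t : ℝ) => ω.path t i) P

/-- The σ-algebra generated by the increments of the path up to time `t`. -/
abbrev past (m : ℕ) (t : ℝ) : MeasurableSpace (WienerSpace m) :=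
  MeasurableSpace.comap (fun ω (u : Iic t) => ω.path u - ω.path t) inferInstance

/-! ### The Ornstein-Uhlenbeck processes -/

/-- The (Paley-Wiener-Zygmund) Wiener integral `∫_a^b g(τ) dw(τ)` of a deterministic `C¹` integrand
`g` along a continuous path `w`, which is pathwise defined through integration by parts. -/
def wienerIntegral (g w : ℝ → ℝ) (a b : ℝ) : ℝ :=
  g b * w b - g a * w a - ∫ τ in a..b, deriv g τ * w τ

/-- `∫_{-∞}^b g(τ) dw(τ)`, as the limit of `∫_a^b g(τ) dw(τ)` for `a → -∞`. -/
def wienerIntegralIic (g w : ℝ → ℝ) (b : ℝ) : ℝ :=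
  limUnder atBot fun a => wienerIntegral g w a b

/-- The stationary Ornstein-Uhlenbeck process
`O_t⁽ʲ⁾ = ∑ i, c_i⁽ʲ⁾ e^{-t} ∫_{-∞}^t e^τ dW_τ⁽ⁱ⁾`. -/
def ouProcess (c : Fin N → Fin m → ℝ) (j : Fin N) (t : ℝ) (ω : WienerSpace m) : ℝ :=
  ∑ i, c j i * (Real.exp (-t) * wienerIntegralIic Real.exp (fun τ => ω.path τ i) t)

/-! ### The random differential equations -/

/-- The space `ℝ^d`. -/
abbrev Vec (d : ℕ) : Type := EuclideanSpace ℝ (Fin d)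

/-- The function `F⁽ʲ⁾(x, o) = e^{-o} f⁽ʲ⁾(e^o x) + o x`. -/
def conjugateField (f : Fin N → Vec d → Vec d) (j : Fin N) (x : Vec d) (o : ℝ) : Vec d :=
  Real.exp (-o) • f j (Real.exp o • x) + o • x

/-- Right-hand side of the coupled equations
`dx⁽ʲ⁾/dt = F⁽ʲ⁾(x⁽ʲ⁾, O_t⁽ʲ⁾(ω)) + ν (x⁽ʲ⁻¹⁾ - 2 x⁽ʲ⁾ + x⁽ʲ⁺¹⁾)`; the index `j` is cyclic. -/
def coupledField [NeZero N] (f : Fin N → Vec d → Vec d) (c : Fin N → Fin m → ℝ) (ν : ℝ)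
    (ω : WienerSpace m) (t : ℝ) (x : Fin N → Vec d) : Fin N → Vec d :=
  fun j => conjugateField f j (x j) (ouProcess c j t ω) +
    ν • (x (j - 1) - (2 : ℝ) • x j + x (j + 1))

/-- Right-hand side of the averaged equation
`dz/dt = (1/N) ∑ j, e^{-O_t⁽ʲ⁾} f⁽ʲ⁾(e^{O_t⁽ʲ⁾} z) + (1/N) ∑ j, O_t⁽ʲ⁾ z`. -/
def averagedField (f : Fin N → Vec d → Vec d) (c : Fin N → Fin m → ℝ)
    (ω : WienerSpace m) (t : ℝ) (z : Vec d) : Vec d :=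
  (1 / (N : ℝ)) • ∑ j, conjugateField f j z (ouProcess c j t ω)

section RDS

variable {S : Type*} [NormedAddCommGroup S] [NormedSpace ℝ S]

/-- `x` solves `x' = g(t, x)` on `[0, ∞)` with `x 0 = x₀`. -/
structure IsForwardSolution (g : ℝ → S → S) (x₀ : S) (x : ℝ → S) : Prop where
  init : x 0 = x₀
  deriv : ∀ t, 0 ≤ t → HasDerivWithinAt x (g t (x t)) (Ici 0) t

open Classical in
/-- The solution operator `φ(t, ω) x₀` for `t ≥ 0` of the random differential equation
`x' = g(ω, t, x)`. -/
def solutionFlow (g : WienerSpace m → ℝ → S → S) (t : ℝ) (ω : WienerSpace m) (x₀ : S) : S :=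
  if h : ∃ x, IsForwardSolution (g ω) x₀ x then h.choose t else x₀

/-- For `ω ∈ Ω'` the equation `x' = g(ω, t, x)` is uniquely solvable on `[0, ∞)` for every initial
value, and its solution operator `φ` is a (continuous) random dynamical system over the shift on
the invariant set `Ω'` with the trace σ-algebra. -/
structure GeneratesRDS [MeasurableSpace S] (Ω' : Set (WienerSpace m))
    (g : WienerSpace m → ℝ → S → S) : Prop where
  solves : ∀ ω ∈ Ω', ∀ x₀, IsForwardSolution (g ω) x₀ fun t => solutionFlow g t ω x₀
  unique : ∀ ω ∈ Ω', ∀ x₀ x, IsForwardSolution (g ω) x₀ x →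
    ∀ t, 0 ≤ t → x t = solutionFlow g t ω x₀
  cocycle : ∀ ω ∈ Ω', ∀ s t, 0 ≤ s → 0 ≤ t → ∀ x₀,
    solutionFlow g (t + s) ω x₀ = solutionFlow g t (shift s ω) (solutionFlow g s ω x₀)
  continuous : ∀ ω ∈ Ω', ∀ t, 0 ≤ t → Continuous (solutionFlow g t ω)
  measurable : Measurable fun p : ℝ≥0 × Ω' × S => solutionFlow g (p.1 : ℝ) p.2.1.1 p.2.2

/-- Random sets: `ω ↦ dist(x, D ω)` is measurable on `Ω'` for every `x`. -/
def IsRandomSet (Ω' : Set (WienerSpace m)) (D : WienerSpace m → Set S) : Prop :=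
  ∀ x, Measurable fun ω : Ω' => Metric.infEDist x (D ω)

/-- Tempered random bounded sets:
`e^{-kt} sup_{u ∈ D(θ_{-t}ω)} ‖u‖ → 0` as `t → ∞`, for every `k > 0`. -/
structure IsTempered (Ω' : Set (WienerSpace m)) (D : WienerSpace m → Set S) : Prop where
  random : IsRandomSet Ω' D
  bounded : ∀ ω ∈ Ω', Bornology.IsBounded (D ω)
  tempered : ∀ ω ∈ Ω', ∀ k : ℝ, 0 < k →
    Tendsto (fun t => Real.exp (-k * t) * sSup (norm '' D (shift (-t) ω))) atTop (𝓝 0)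

/-- The Hausdorff semi-distance `H*(A, B) = sup_{a ∈ A} inf_{b ∈ B} dist(a, b)`. -/
def hausdorffSemidist (A B : Set S) : ℝ≥0∞ := ⨆ a ∈ A, Metric.infEDist a B

/-- `A` is a random attractor of `φ` over the invariant set `Ω'`: a random compact set which is
invariant and pullback attracts every tempered random bounded set. -/
structure IsRandomAttractor (Ω' : Set (WienerSpace m)) (φ : ℝ → WienerSpace m → S → S)
    (A : WienerSpace m → Set S) : Prop where
  random : IsRandomSet Ω' A
  compact : ∀ ω ∈ Ω', IsCompact (A ω)
  invariant : ∀ ω ∈ Ω', ∀ t, 0 ≤ t → φ t ω '' A ω = A (shift t ω)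
  attracts : ∀ D, IsTempered Ω' D → ∀ ω ∈ Ω',
    Tendsto (fun t => hausdorffSemidist (φ t (shift (-t) ω) '' D (shift (-t) ω)) (A ω))
      atTop (𝓝 0)

/-- `a` is the singleton sets random attractor `{a(ω)}` of the random dynamical system generated
by `x' = g(ω, t, x)`. -/
def IsSingletonAttractor (Ω' : Set (WienerSpace m)) (g : WienerSpace m → ℝ → S → S)
    (a : WienerSpace m → S) : Prop :=
  IsRandomAttractor Ω' (solutionFlow g) fun ω => {a ω}

/-! ### Stratonovich equations -/

/-- `I = ∫_s^t Y_r ∘ dB_r`: along every sequence of partitions `s = π₀ ≤ … ≤ π_n = t` with mesh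
tending to zero, the sums `∑ l, ½ (Y_{π_l} + Y_{π_{l+1}}) (B_{π_{l+1}} - B_{π_l})` converge to `I`
in probability. -/
def IsStratonovichIntegral (P : Measure (WienerSpace m)) (Y : ℝ → WienerSpace m → S)
    (B : ℝ → WienerSpace m → ℝ) (s t : ℝ) (I : WienerSpace m → S) : Prop :=
  ∀ (n : ℕ → ℕ) (π : ℕ → ℕ → ℝ),
    (∀ k, Monotone (π k)) → (∀ k, π k 0 = s) → (∀ k, π k (n k) = t) →
    (∀ ε > 0, ∀ᶠ k in atTop, ∀ l < n k, π k (l + 1) - π k l < ε) →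
    TendstoInMeasure P
      (fun k ω => ∑ l ∈ Finset.range (n k),
        (B (π k (l + 1)) ω - B (π k l) ω) •
          ((1 / 2 : ℝ) • (Y (π k l) ω + Y (π k (l + 1)) ω)))
      atTop I

/-- The process `X` is stationary: all its time shifts have the same law on path space. -/
def IsStationary [MeasurableSpace S] (P : Measure (WienerSpace m))
    (X : ℝ → WienerSpace m → S) : Prop :=
  ∀ h : ℝ, IdentDistrib (fun ω t => X (t + h) ω) (fun ω t => X t ω) P P

end RDS

/-- `X = (X⁽¹⁾, …, X⁽ᴺ⁾)` is a solution on the whole time axis `ℝ` of the Stratonovich system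
`dX⁽ʲ⁾ = b⁽ʲ⁾(X) dt + ∑ i, c_i⁽ʲ⁾ X⁽ʲ⁾ ∘ dW⁽ⁱ⁾`: it is nonanticipating, has continuous paths
and satisfies the integrated equation on every interval `[s, t]`. The noise of the `j`-th equation
is `X⁽ʲ⁾ ∘ dB⁽ʲ⁾` with `B⁽ʲ⁾ = ∑ i, c_i⁽ʲ⁾ W⁽ⁱ⁾`. -/
structure IsStratonovichSolution (P : Measure (WienerSpace m))
    (b : (Fin N → Vec d) → Fin N → Vec d) (c : Fin N → Fin m → ℝ)
    (X : ℝ → WienerSpace m → Fin N → Vec d) : Prop where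
  adapted : ∀ t, AEStronglyMeasurable[past m t] (X t) P
  continuous_paths : ∀ᵐ ω ∂P, Continuous fun t => X t ω
  integral_eq : ∀ s t, s ≤ t → ∀ j,
    IsStratonovichIntegral P (fun r ω => X r ω j) (fun r ω => ∑ i, c j i * ω.path r i) s t
      fun ω => X t ω j - X s ω j - ∫ r in s..t, b (X r ω) j

/-- The drift `f⁽ʲ⁾(X⁽ʲ⁾) + ν (X⁽ʲ⁻¹⁾ - 2 X⁽ʲ⁾ + X⁽ʲ⁺¹⁾)` of the coupled stochastic equations
when the noise is the same in each of them. -/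
def coupledDrift [NeZero N] (f : Fin N → Vec d → Vec d) (ν : ℝ) (X : Fin N → Vec d) :
    Fin N → Vec d :=
  fun j => f j (X j) + ν • (X (j - 1) - (2 : ℝ) • X j + X (j + 1))

/-- The noise coefficients are the same in every equation. -/
def SameNoise (c : Fin N → Fin m → ℝ) : Prop := ∀ j k i, c j i = c k i

/-- The process `X_t⁽ʲ⁾(ω) = e^{O_t⁽ʲ⁾(ω)} a⁽ʲ⁾(θ_t ω)`. -/
def backTransform (c : Fin N → Fin m → ℝ) (a : WienerSpace m → Fin N → Vec d) (t : ℝ)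
    (ω : WienerSpace m) : Fin N → Vec d :=
  fun j => Real.exp (ouProcess c j t ω) • a (shift t ω) j

end StochSync

end

noncomputable section

namespace StochSync

section

/-! ### A linear Gronwall inequality -/

/-! Everything rests on one energy estimate. Let `u` be the difference of two solutions of the
coupled system, `E` the sum of the `‖u j‖ ^ 2` and `Q` the sum of the `‖u j - u (j + 1)‖ ^ 2`.
Conjugation by `e^O` preserves the dissipativity of `f`, so that `E' ≤ -2 L E + 2 ∑ O_j ‖u j‖ ^ 2 -
2 ν Q`. The noise term has no sign and weighs the components differently. Replacing every `O_j` by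
the mean `Ō` costs differences between components; the coupling pays for them through Young's
inequality, and what remains is `κ (∑ O_j ^ 2) E` with `κ = 2 N ^ 2 / ν` (`sum_mul_norm_sq_le`). If
the noise is the same in every equation there is nothing to replace and `κ = 0` will do.

The resulting rate is `-L + 2 Ō + κ ∑ O_j ^ 2`; the other `L` is kept for absorbing inhomogeneities.
Over the past, `Ō` averages to zero, because `O - B` is a primitive of `-O` and both `O` and the
noise `B` grow sublinearly. The averages of `O_j ^ 2` are almost surely bounded by a deterministic
constant. Hence a small `κ`, that is `ν ≥ ν₀` with a non-random `ν₀`, makes the rate negative on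
average (`exists_decay`). The paths with these two properties form the shift-invariant set
`goodSet`. It has full measure: sublinear growth follows from Kolmogorov's inequality and
Borel-Cantelli, and the mean squares are dominated, through a contracting recursion, by functionals
of the increments over disjoint unit intervals, to which the strong law of large numbers applies.

The fields are merely continuous in space, so solvability is drawn from the one-sided Lipschitz
bound: approximations with a delayed argument form a Cauchy sequence. They also give the
measurability of the flow. On good paths the pullback trajectories contract exponentially, so they
converge to a point, which is the attractor (`IsDissipative.isSingletonAttractor`). Any singleton
attractor must attract `{0}` and therefore coincides with it (`IsDissipative.eq_pullbackLimit`).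

For `ν → ∞` the discrete Poincaré inequality damps the deviations from the mean at a rate of order
`ν / N ^ 2`, and the mean then almost solves the averaged equation. Its distance to `z̄` at an early
time is forgotten, because the bounds on the attractor trajectories are uniform in `ν`
(`exists_pullbackLimit_sub_le`).

For the Stratonovich equation, `O - B` is continuously differentiable, so `X = e^B y` with `y` of
class `C¹`. The trapezoidal sums then differ from the integrated equation by a small multiple of the
sum of squared noise increments plus the length of the interval, and those sums of squares are
bounded in `L¹`. -/

theorem gronwall_linear {U U' k β A : ℝ → ℝ} {a b : ℝ} (hab : a ≤ b)
    (hU : ContinuousOn U (Icc a b))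
    (hU' : ∀ t ∈ Ico a b, HasDerivWithinAt U (U' t) (Ici t) t)
    (hle : ∀ t ∈ Ico a b, U' t ≤ k t * U t + β t)
    (hA : ∀ t, HasDerivAt A (k t) t) (hβ : Continuous β) :
    U b ≤ Real.exp (A b - A a) * U a + ∫ r in a..b, Real.exp (A b - A r) * β r := by
  have hAc : Continuous A := continuous_iff_continuousAt.2 fun t => (hA t).continuousAt
  have hint : Continuous fun r => Real.exp (-A r) * β r := by fun_prop
  have hI : ∀ t, HasDerivAt (fun t => ∫ r in a..t, Real.exp (-A r) * β r)
      (Real.exp (-A t) * β t) t := fun t => hint.integral_hasStrictDerivAt a t |>.hasDerivAt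
  -- Integrating factor: `U e^{-A}` minus the integral of `e^{-A} β` has nonpositive right
  -- derivative, so it stays below its initial value.
  have key := image_le_of_deriv_right_le_deriv_boundary
    (f := fun t => U t * Real.exp (-A t) - ∫ r in a..t, Real.exp (-A r) * β r)
    (f' := fun t => (U' t * Real.exp (-A t) + U t * (Real.exp (-A t) * -(k t)))
      - Real.exp (-A t) * β t)
    (B := fun _ => U a * Real.exp (-A a)) (B' := fun _ => 0) (a := a) (b := b)
    ((hU.mul (by fun_prop)).sub
      (continuous_iff_continuousAt.2 fun t => (hI t).continuousAt).continuousOn)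
    (fun t ht => ((hU' t ht).mul ((hA t).neg.exp.hasDerivWithinAt)).sub
      (hI t).hasDerivWithinAt)
    (by simp) continuousOn_const (fun t _ => hasDerivWithinAt_const _ _ _)
    (fun t ht => by
      have h1 := mul_le_mul_of_nonneg_left (hle t ht) (Real.exp_pos (-A t)).le
      linarith) (right_mem_Icc.2 hab)
  simp only [tsub_le_iff_right] at key
  have h2 := mul_le_mul_of_nonneg_left key (Real.exp_pos (A b)).le
  have h3 : Real.exp (A b) * (U b * Real.exp (-A b)) = U b := by
    rw [mul_left_comm, ← Real.exp_add]; simp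
  rw [h3, mul_add, mul_left_comm, ← Real.exp_add, ← intervalIntegral.integral_const_mul] at h2
  simpa only [← mul_assoc, ← Real.exp_add, ← sub_eq_add_neg, mul_comm (U a)] using h2

/-! ### Energy estimates for squared norms -/

section Energy

variable {S H : Type*} [NormedAddCommGroup S] [NormedSpace ℝ S]
  [NormedAddCommGroup H] [InnerProductSpace ℝ H]

/-- The phase space of the coupled system carries the sup norm of a product, which comes from no
inner product; `e` supplies the Euclidean one. Since `e` need not be injective, it can also measure
only part of the state, such as the deviation from the mean. -/
theorem energy_le (e : S →L[ℝ] H) {x x' : ℝ → S} {k β A : ℝ → ℝ} {a b : ℝ} (hab : a ≤ b)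
    (hx : ContinuousOn x (Icc a b))
    (hx' : ∀ t ∈ Ico a b, HasDerivWithinAt x (x' t) (Ici t) t)
    (hle : ∀ t ∈ Ico a b, 2 * inner ℝ (e (x t)) (e (x' t)) ≤ k t * ‖e (x t)‖ ^ 2 + β t)
    (hA : ∀ t, HasDerivAt A (k t) t) (hβ : Continuous β) :
    ‖e (x b)‖ ^ 2 ≤ Real.exp (A b - A a) * ‖e (x a)‖ ^ 2 +
      ∫ r in a..b, Real.exp (A b - A r) * β r :=
  gronwall_linear (U := fun t => ‖e (x t)‖ ^ 2) hab
    ((e.continuous.comp_continuousOn hx).norm.pow 2)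
    (fun t ht => ((e.hasFDerivAt.comp_hasDerivWithinAt t (hx' t ht)).norm_sq)) hle hA hβ

theorem energy_le_const (e : S →L[ℝ] H) {x x' : ℝ → S} {k β : ℝ} {a b : ℝ} (hab : a ≤ b)
    (hk : 0 ≤ k) (hβ : 0 ≤ β)
    (hx : ContinuousOn x (Icc a b))
    (hx' : ∀ t ∈ Ico a b, HasDerivWithinAt x (x' t) (Ici t) t)
    (hle : ∀ t ∈ Ico a b, 2 * inner ℝ (e (x t)) (e (x' t)) ≤ k * ‖e (x t)‖ ^ 2 + β) :
    ‖e (x b)‖ ^ 2 ≤ Real.exp (k * (b - a)) * (‖e (x a)‖ ^ 2 + β * (b - a)) := by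
  have h := energy_le e (k := fun _ => k) (β := fun _ => β) (A := fun t => k * t) hab hx hx' hle
    (fun t => by simpa using (hasDerivAt_id t).const_mul k) continuous_const
  refine h.trans ?_
  rw [mul_add, ← mul_sub]
  gcongr
  have : ∫ r in a..b, Real.exp (k * b - k * r) * β ≤
      ∫ r in a..b, Real.exp (k * (b - a)) * β := by
    refine intervalIntegral.integral_mono_on hab (Continuous.intervalIntegrable (by fun_prop) _ _)
      (Continuous.intervalIntegrable (by fun_prop) _ _) fun r hr => ?_
    rw [← mul_sub]
    gcongr
    exact hr.1
  refine this.trans (le_of_eq ?_)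
  rw [intervalIntegral.integral_const, smul_eq_mul]; ring

theorem two_mul_le_of_le {p q ε : ℝ} (hq : q ≤ ε) (hp : 0 ≤ p) :
    2 * (p * q) ≤ p ^ 2 + ε ^ 2 := by nlinarith [sq_nonneg (p - ε)]

end Energy

/-! ### Delayed approximations of solutions -/

section Tonelli

variable {S H : Type*} [NormedAddCommGroup S] [NormedSpace ℝ S]
  [NormedAddCommGroup H] [InnerProductSpace ℝ H]

theorem exists_norm_le (e : S ≃L[ℝ] H) : ∃ c > 0, ∀ x : S, ‖x‖ ≤ c * ‖e x‖ := by
  refine ⟨‖(e.symm : H →L[ℝ] S)‖ + 1, by positivity, fun x => ?_⟩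
  have := (e.symm : H →L[ℝ] S).le_opNorm (e x)
  simp only [ContinuousLinearEquiv.coe_coe, ContinuousLinearEquiv.symm_apply_apply] at this
  nlinarith [norm_nonneg (e x)]

/-- Picard iterates of the delay equation `x'(t) = G(t, x((t - h)⁺))`, `x(0) = x₀`. -/
def tonelli (G : ℝ → S → S) (h : ℝ) (x₀ : S) : ℕ → ℝ → S
  | 0 => fun _ => x₀
  | k + 1 => fun t => x₀ + ∫ s in (0 : ℝ)..t, G s (tonelli G h x₀ k (max (s - h) 0))

theorem tonelli_zero_right (G : ℝ → S → S) (h : ℝ) (x₀ : S) (k : ℕ) : tonelli G h x₀ k 0 = x₀ := by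
  cases k <;> simp [tonelli]

variable [CompleteSpace S]

theorem hasDerivAt_tonelli {G : ℝ → S → S} (hG : Continuous ↿G) (h : ℝ) (x₀ : S) (k : ℕ) (t : ℝ)
    (hk : Continuous (tonelli G h x₀ k)) :
    HasDerivAt (tonelli G h x₀ (k + 1)) (G t (tonelli G h x₀ k (max (t - h) 0))) t := by
  have hc : Continuous fun s => G s (tonelli G h x₀ k (max (s - h) 0)) :=
    hG.comp (continuous_id.prodMk (hk.comp (by fun_prop)))
  exact ((hc.integral_hasStrictDerivAt 0 t).hasDerivAt).const_add x₀

theorem continuous_tonelli {G : ℝ → S → S} (hG : Continuous ↿G) (h : ℝ) (x₀ : S) (k : ℕ) :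
    Continuous (tonelli G h x₀ k) := by
  induction k with
  | zero => exact continuous_const
  | succ k ih =>
    exact continuous_iff_continuousAt.2 fun t => (hasDerivAt_tonelli hG h x₀ k t ih).continuousAt

omit [CompleteSpace S] in
-- Owing to the delay, the integral up to time `(k + 1) h` sees the previous iterate only up to time
-- `k h`. Every iteration therefore settles one more interval of length `h`, without any Lipschitz
-- condition.
theorem tonelli_succ_eq {G : ℝ → S → S} {h : ℝ} (hh : 0 < h) (x₀ : S) (k : ℕ) :
    ∀ t, 0 ≤ t → t ≤ k * h → tonelli G h x₀ (k + 1) t = tonelli G h x₀ k t := by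
  induction k with
  | zero =>
    intro t h0 h1
    obtain rfl : t = 0 := le_antisymm (by simpa using h1) h0
    rw [tonelli_zero_right, tonelli_zero_right]
  | succ k ih =>
    intro t h0 h1
    change x₀ + ∫ s in (0 : ℝ)..t, G s (tonelli G h x₀ (k + 1) (max (s - h) 0)) =
      x₀ + ∫ s in (0 : ℝ)..t, G s (tonelli G h x₀ k (max (s - h) 0))
    congr 1
    refine intervalIntegral.integral_congr fun s hs => ?_
    rw [uIcc_of_le h0] at hs
    rw [ih _ (le_max_right _ _)]
    refine max_le ?_ (by positivity)
    push_cast at h1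
    linarith [hs.2]

/-- The `n`-th approximation of the solution of `x' = G(t, x)`, `x(0) = x₀`. -/
def approx (G : ℝ → S → S) (x₀ : S) (n : ℕ) : ℝ → S :=
  -- With step `1 / (n + 1)`, the iterate number `(n + 1) ^ 2` is final on `[0, n + 1]`; one more
  -- iteration turns this into an exact delay equation on `[0, n]`.
  tonelli G (1 / ((n : ℝ) + 1)) x₀ ((n + 1) ^ 2 + 1)

/-- The delayed argument of the field. -/
def delay (n : ℕ) (t : ℝ) : ℝ := max (t - 1 / ((n : ℝ) + 1)) 0

theorem delay_nonneg (n : ℕ) (t : ℝ) : 0 ≤ delay n t := le_max_right _ _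

theorem delay_le (n : ℕ) {t : ℝ} (ht : 0 ≤ t) : delay n t ≤ t :=
  max_le (by have : (0 : ℝ) < 1 / ((n : ℝ) + 1) := by positivity
             linarith) ht

theorem abs_sub_delay_le (n : ℕ) {t : ℝ} (ht : 0 ≤ t) : |t - delay n t| ≤ 1 / ((n : ℝ) + 1) := by
  rw [abs_of_nonneg (by linarith [delay_le n ht])]
  have := le_max_left (t - 1 / ((n : ℝ) + 1)) 0
  unfold delay; linarith

theorem hasDerivAt_approx {G : ℝ → S → S} (hG : Continuous ↿G) (x₀ : S) (n : ℕ) {t : ℝ}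
    (ht : t ≤ n) : HasDerivAt (approx G x₀ n) (G t (approx G x₀ n (delay n t))) t := by
  have h := hasDerivAt_tonelli hG (1 / ((n : ℝ) + 1)) x₀ ((n + 1) ^ 2) t (continuous_tonelli hG _ _ _)
  have h2 := tonelli_succ_eq (G := G) (h := 1 / ((n : ℝ) + 1)) (by positivity) x₀ ((n + 1) ^ 2)
    (delay n t) (delay_nonneg _ _) (by
      have : (((n + 1) ^ 2 : ℕ) : ℝ) * (1 / ((n : ℝ) + 1)) = n + 1 := by
        push_cast; field_simp
      rw [this]
      have : (0 : ℝ) < 1 / ((n : ℝ) + 1) := by positivity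
      exact max_le (by linarith) (by positivity))
  rw [approx, h2]
  exact h

omit [CompleteSpace S] in
theorem approx_zero (G : ℝ → S → S) (x₀ : S) (n : ℕ) : approx G x₀ n 0 = x₀ :=
  tonelli_zero_right _ _ _ _

theorem continuous_approx {G : ℝ → S → S} (hG : Continuous ↿G) (x₀ : S) (n : ℕ) :
    Continuous (approx G x₀ n) := continuous_tonelli hG _ _ _

theorem norm_approx_sub_le {G : ℝ → S → S} (hG : Continuous ↿G) {M : ℝ}
    (hM : ∀ t x, ‖G t x‖ ≤ M) (x₀ : S) (n : ℕ) {t : ℝ} (h0 : 0 ≤ t) (ht : t ≤ n) :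
    ‖approx G x₀ n t - approx G x₀ n (delay n t)‖ ≤ M * (1 / ((n : ℝ) + 1)) := by
  have := (convex_Icc (0 : ℝ) n).norm_image_sub_le_of_norm_hasDerivWithin_le (C := M)
    (f := approx G x₀ n) (f' := fun t => G t (approx G x₀ n (delay n t)))
    (fun s hs => (hasDerivAt_approx hG x₀ n hs.2).hasDerivWithinAt) (fun s _ => hM _ _)
    (x := delay n t) (y := t)
    ⟨delay_nonneg _ _, (delay_le n h0).trans ht⟩ ⟨h0, ht⟩
  refine this.trans ?_
  have hM0 : 0 ≤ M := (norm_nonneg _).trans (hM 0 0)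
  gcongr
  exact abs_sub_delay_le n h0

variable (e : S ≃L[ℝ] H)

/-- The delay moves the argument of the field by at most `M / (n + 1)`, so by uniform continuity
each approximation solves the undelayed equation up to a uniformly small error. Gronwall's
inequality then compares two approximations as it would compare two solutions. -/
theorem cauchy_approx {G : ℝ → S → S} (hG : UniformContinuous ↿G) {M ℓ : ℝ}
    (hM : ∀ t x, ‖G t x‖ ≤ M) (hℓ : 0 ≤ ℓ)
    (hone : ∀ t x y, inner ℝ (e x - e y) (e (G t x) - e (G t y)) ≤ ℓ * ‖e x - e y‖ ^ 2)
    (x₀ : S) (T : ℝ) :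
    UniformCauchySeqOn (approx G x₀) atTop (Icc 0 T) := by
  rcases lt_or_ge T 0 with hT | hT
  · rw [Icc_eq_empty (by linarith)]
    exact fun u _ => Eventually.of_forall fun _ x hx => absurd hx (notMem_empty x)
  have hGc := hG.continuous
  have hM0 : 0 ≤ M := (norm_nonneg _).trans (hM 0 0)
  rw [Metric.uniformCauchySeqOn_iff]
  intro ε hε
  obtain ⟨c, hc0, hc⟩ := exists_norm_le e
  set D := Real.exp ((2 * ℓ + 1) * T) * T + 1
  have hD : 0 < D := by positivity
  -- choose the accuracy of the field
  obtain ⟨η, hη0, hη⟩ : ∃ η > 0, c ^ 2 * (D * η ^ 2) < ε ^ 2 := by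
    refine ⟨ε / (2 * c * D.sqrt), by positivity, ?_⟩
    rw [div_pow, mul_pow, Real.sq_sqrt hD.le, mul_pow]
    field_simp
    norm_num
  have huc : UniformContinuous fun p : ℝ × S => e (G p.1 p.2) :=
    (e : S →L[ℝ] H).uniformContinuous.comp hG
  obtain ⟨δ, hδ0, hδ⟩ := Metric.uniformContinuous_iff.1 huc (η / 2) (by positivity)
  have hlim : Tendsto (fun n : ℕ => M * (1 / ((n : ℝ) + 1))) atTop (𝓝 0) := by
    simpa using tendsto_one_div_add_atTop_nhds_zero_nat.const_mul M
  obtain ⟨n₀, hn₀⟩ := eventually_atTop.1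
    ((hlim.eventually (gt_mem_nhds hδ0)).and (eventually_ge_atTop ⌈T⌉₊))
  have hclose : ∀ n ≥ n₀, ∀ t ∈ Icc 0 T,
      ‖e (G t (approx G x₀ n (delay n t))) - e (G t (approx G x₀ n t))‖ ≤ η / 2 := by
    intro n hn t ht
    have hTn : T ≤ n := Nat.ceil_le.1 (hn₀ n hn).2
    rw [← dist_eq_norm]
    refine (hδ (a := (t, _)) (b := (t, _)) ?_).le
    rw [Prod.dist_eq, dist_self, max_lt_iff]
    refine ⟨hδ0, ?_⟩
    rw [dist_comm, dist_eq_norm]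
    exact (norm_approx_sub_le hGc hM x₀ n ht.1 (ht.2.trans hTn)).trans_lt (hn₀ n hn).1
  refine ⟨n₀, fun n hn k hk t ht => ?_⟩
  have hTn : T ≤ n := Nat.ceil_le.1 (hn₀ n hn).2
  have hTk : T ≤ k := Nat.ceil_le.1 (hn₀ k hk).2
  have h := energy_le_const (e : S →L[ℝ] H) (x := fun t => approx G x₀ n t - approx G x₀ k t)
    (x' := fun t => G t (approx G x₀ n (delay n t)) - G t (approx G x₀ k (delay k t)))
    (k := 2 * ℓ + 1) (β := η ^ 2) (a := 0) (b := t) ht.1 (by positivity) (by positivity)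
    ((continuous_approx hGc _ _).sub (continuous_approx hGc _ _)).continuousOn
    (fun s hs => ((hasDerivAt_approx hGc x₀ n (by linarith [hs.2, ht.2])).sub
      (hasDerivAt_approx hGc x₀ k (by linarith [hs.2, ht.2]))).hasDerivWithinAt) (by
      intro s hs
      have hsT : s ∈ Icc 0 T := ⟨hs.1, by linarith [hs.2, ht.2]⟩
      have h1 := hclose n hn s hsT
      have h2 := hclose k hk s hsT
      have h3 := hone s (approx G x₀ n s) (approx G x₀ k s)
      simp only [ContinuousLinearEquiv.coe_coe, map_sub]
      set X := e (approx G x₀ n s) - e (approx G x₀ k s)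
      set a := e (G s (approx G x₀ n (delay n s)))
      set b := e (G s (approx G x₀ k (delay k s)))
      set a' := e (G s (approx G x₀ n s))
      set b' := e (G s (approx G x₀ k s))
      have h4 : a - b = (a' - b') + ((a - a') - (b - b')) := by abel
      have h5 : ‖(a - a') - (b - b')‖ ≤ η := (norm_sub_le _ _).trans (by linarith)
      have h6 := real_inner_le_norm X ((a - a') - (b - b'))
      have h7 := two_mul_le_of_le h5 (norm_nonneg X)
      rw [h4, inner_add_right]
      linarith)
  rw [dist_eq_norm]
  refine (sq_lt_sq₀ (norm_nonneg _) hε.le).1 (lt_of_le_of_lt ?_ hη)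
  refine (pow_le_pow_left₀ (norm_nonneg _) (hc _) 2).trans ?_
  rw [mul_pow]
  gcongr
  refine h.trans ?_
  simp only [approx_zero, sub_self, map_zero, norm_zero, sub_zero, ne_eq, OfNat.ofNat_ne_zero,
    not_false_eq_true, zero_pow, zero_add]
  rw [show Real.exp ((2 * ℓ + 1) * t) * (η ^ 2 * t) = Real.exp ((2 * ℓ + 1) * t) * t * η ^ 2 by ring]
  have : Real.exp ((2 * ℓ + 1) * t) * t ≤ Real.exp ((2 * ℓ + 1) * T) * T := by
    have := ht.1
    have := ht.2
    gcongr
  gcongr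
  linarith

/-- A bounded, uniformly continuous, one-sided Lipschitz field is solvable on `[0, ∞)`, and the
delayed approximations converge to the solution. -/
theorem exists_solution_of_bounded {G : ℝ → S → S} (hG : UniformContinuous ↿G) {M ℓ : ℝ}
    (hM : ∀ t x, ‖G t x‖ ≤ M) (hℓ : 0 ≤ ℓ)
    (hone : ∀ t x y, inner ℝ (e x - e y) (e (G t x) - e (G t y)) ≤ ℓ * ‖e x - e y‖ ^ 2)
    (x₀ : S) : ∃ x : ℝ → S, IsForwardSolution G x₀ x ∧
      ∀ t, 0 ≤ t → Tendsto (fun n => approx G x₀ n t) atTop (𝓝 (x t)) := by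
  have hGc := hG.continuous
  have hM0 : 0 ≤ M := (norm_nonneg _).trans (hM 0 0)
  have hcau := cauchy_approx e hG hM hℓ hone x₀
  have hpt : ∀ t : ℝ, 0 ≤ t → ∃ y, Tendsto (fun n => approx G x₀ n t) atTop (𝓝 y) := fun t ht =>
    cauchySeq_tendsto_of_complete ((hcau t).cauchySeq ⟨ht, le_rfl⟩)
  choose! y hy using hpt
  have hunif : ∀ T, TendstoUniformlyOn (approx G x₀) y atTop (Icc 0 T) := fun T =>
    (hcau T).tendstoUniformlyOn_of_tendsto fun t ht => hy t ht.1
  -- the approximations also converge for negative times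
  let y' : ℝ → S := fun t => if 0 ≤ t then y t else x₀ + ∫ s in (0 : ℝ)..t, G s x₀
  have hy' : ∀ t : ℝ, Tendsto (fun n => approx G x₀ n t) atTop (𝓝 (y' t)) := by
    intro t
    by_cases ht : 0 ≤ t
    · simpa [y', ht] using hy t ht
    · simp only [y', ht, if_false]
      refine tendsto_const_nhds.congr fun n => ?_
      rw [approx, tonelli]
      congr 1
      refine intervalIntegral.integral_congr fun s hs => ?_
      rw [uIcc_of_ge (by linarith)] at hs
      have : max (s - 1 / ((n : ℝ) + 1)) 0 = 0 := by
        refine max_eq_right ?_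
        have : (0 : ℝ) < 1 / ((n : ℝ) + 1) := by positivity
        linarith [hs.2]
      simp only [this, tonelli_zero_right]
  -- The theorem on limits of derivatives needs an open set. The extension to negative times, where
  -- the delayed argument is clamped to `0`, makes the initial time an interior point.
  have hder : ∀ T : ℝ, 0 ≤ T → ∀ t ∈ Iio T, HasDerivAt y' (G t (y (max t 0))) t := by
    intro T hT t ht
    refine hasDerivAt_of_tendstoUniformlyOn (l := atTop) (f := approx G x₀)
      (f' := fun n t => G t (approx G x₀ n (delay n t))) (g' := fun t => G t (y (max t 0)))
      isOpen_Iio ?_ ?_ (fun t _ => hy' t) ht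
    · rw [Metric.tendstoUniformlyOn_iff]
      intro ε hε
      obtain ⟨δ, hδ0, hδ⟩ := Metric.uniformContinuous_iff.1 hG ε hε
      have hlim : Tendsto (fun n : ℕ => M * (1 / ((n : ℝ) + 1))) atTop (𝓝 0) := by
        simpa using tendsto_one_div_add_atTop_nhds_zero_nat.const_mul M
      filter_upwards [hlim.eventually (gt_mem_nhds (half_pos hδ0)), eventually_ge_atTop ⌈T⌉₊,
        Metric.tendstoUniformlyOn_iff.1 (hunif T) (δ / 2) (half_pos hδ0)] with n h1 h2 h3 s hs
      have hTn : T ≤ n := Nat.ceil_le.1 h2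
      refine hδ (a := (s, _)) (b := (s, _)) ?_
      rw [Prod.dist_eq, dist_self, max_lt_iff]
      refine ⟨hδ0, ?_⟩
      have hmem : max s 0 ∈ Icc (0 : ℝ) T := ⟨le_max_right _ _, max_le (le_of_lt hs) hT⟩
      have h4 := h3 _ hmem
      have h5 := norm_approx_sub_le hGc hM x₀ n hmem.1 (hmem.2.trans hTn)
      have h6 : delay n (max s 0) = delay n s := by
        have : (0 : ℝ) < 1 / ((n : ℝ) + 1) := by positivity
        unfold delay
        rcases le_total 0 s with h | h
        · rw [max_eq_left h]
        · rw [max_eq_right h, max_eq_right (by linarith), max_eq_right (by linarith)]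
      rw [h6, ← dist_eq_norm] at h5
      have h7 := dist_triangle (y (max s 0)) (approx G x₀ n (max s 0)) (approx G x₀ n (delay n s))
      change dist (y (max s 0)) (approx G x₀ n (delay n s)) < δ
      linarith
    · filter_upwards [eventually_ge_atTop ⌈T⌉₊] with n hn s hs
      exact hasDerivAt_approx hGc x₀ n ((le_of_lt hs).trans (Nat.ceil_le.1 hn))
  refine ⟨y', ⟨?_, fun t ht => ?_⟩, fun t _ => hy' t⟩
  · refine tendsto_nhds_unique (hy' 0) ?_
    simp only [approx_zero]
    exact tendsto_const_nhds
  · have := hder (t + 1) (by linarith) t (by simp)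
    rw [max_eq_left ht] at this
    have h8 : y' t = y t := by simp [y', ht]
    rw [h8]
    exact this.hasDerivWithinAt

end Tonelli

end

section

/-! ### Solvability of one-sided Lipschitz equations by cutting off the field -/

section Existence

variable {S H : Type*} [NormedAddCommGroup S] [NormedSpace ℝ S]
  [NormedAddCommGroup H] [InnerProductSpace ℝ H]

/-- `g` is jointly continuous and one-sided Lipschitz in the energy norm `‖e x‖`, with rate `γ`. -/
structure IsOneSidedLipschitz (e : S ≃L[ℝ] H) (g : ℝ → S → S) (γ : ℝ → ℝ) : Prop where
  continuous : Continuous ↿g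
  rate : Continuous γ
  le : ∀ t x y, 2 * inner ℝ (e (x - y)) (e (g t x - g t y)) ≤ γ t * ‖e (x - y)‖ ^ 2

/-- `x` solves `x' = g(t, x)` on `[a, b)` (with one-sided derivatives). -/
structure IsSolutionOn (g : ℝ → S → S) (x : ℝ → S) (a b : ℝ) : Prop where
  cont : ContinuousOn x (Icc a b)
  deriv : ∀ t ∈ Ico a b, HasDerivWithinAt x (g t (x t)) (Ici t) t

theorem IsForwardSolution.isSolutionOn {g : ℝ → S → S} {x₀ : S} {x : ℝ → S}
    (h : IsForwardSolution g x₀ x) {a b : ℝ} (ha : 0 ≤ a) : IsSolutionOn g x a b where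
  cont t ht := ((h.deriv t (ha.trans ht.1)).continuousWithinAt).mono
    fun _ hs => ha.trans hs.1
  deriv t ht := (h.deriv t (ha.trans ht.1)).mono (Ici_subset_Ici.2 (ha.trans ht.1))

/-- Gronwall's estimate for the distance of two solutions. -/
theorem IsOneSidedLipschitz.dist_le {e : S ≃L[ℝ] H} {g : ℝ → S → S} {γ : ℝ → ℝ}
    (h : IsOneSidedLipschitz e g γ) {x y : ℝ → S} {a b : ℝ} (hab : a ≤ b)
    (hx : IsSolutionOn g x a b) (hy : IsSolutionOn g y a b) :
    ‖e (x b - y b)‖ ^ 2 ≤ Real.exp (∫ r in a..b, γ r) * ‖e (x a - y a)‖ ^ 2 := by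
  have := energy_le (e : S →L[ℝ] H) (x := fun t => x t - y t) (k := γ) (β := fun _ => 0)
    (A := fun t => ∫ r in a..t, γ r) hab (hx.cont.sub hy.cont)
    (fun t ht => (hx.deriv t ht).sub (hy.deriv t ht))
    (fun t _ => by simpa using h.le t (x t) (y t))
    (fun t => (h.rate.integral_hasStrictDerivAt a t).hasDerivAt) continuous_const
  simpa using this

theorem IsOneSidedLipschitz.eqOn {e : S ≃L[ℝ] H} {g : ℝ → S → S} {γ : ℝ → ℝ}
    (h : IsOneSidedLipschitz e g γ) {x y : ℝ → S} {a b : ℝ}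
    (hx : IsSolutionOn g x a b) (hy : IsSolutionOn g y a b) (hxy : x a = y a) :
    EqOn x y (Icc a b) := by
  intro t ht
  have := h.dist_le ht.1 (x := x) (y := y) (b := t)
    ⟨hx.cont.mono (Icc_subset_Icc_right ht.2), fun s hs => hx.deriv s ⟨hs.1, hs.2.trans_le ht.2⟩⟩
    ⟨hy.cont.mono (Icc_subset_Icc_right ht.2), fun s hs => hy.deriv s ⟨hs.1, hs.2.trans_le ht.2⟩⟩
  rw [hxy, sub_self, map_zero, norm_zero] at this
  simp only [ne_eq, OfNat.ofNat_ne_zero, not_false_eq_true, zero_pow, mul_zero] at this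
  have h2 : ‖e (x t - y t)‖ = 0 := by
    have := le_antisymm this (sq_nonneg _)
    exact pow_eq_zero_iff (two_ne_zero) |>.1 this
  rw [norm_eq_zero, map_eq_zero_iff e e.injective, sub_eq_zero] at h2
  exact h2

theorem IsOneSidedLipschitz.unique {e : S ≃L[ℝ] H} {g : ℝ → S → S} {γ : ℝ → ℝ}
    (h : IsOneSidedLipschitz e g γ) {x₀ : S} {x y : ℝ → S} (hx : IsForwardSolution g x₀ x)
    (hy : IsForwardSolution g x₀ y) {t : ℝ} (ht : 0 ≤ t) : x t = y t :=
  h.eqOn (hx.isSolutionOn le_rfl) (hy.isSolutionOn le_rfl) (hx.init.trans hy.init.symm)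
    (right_mem_Icc.2 ht)

/-- A cut-off function: `1` on `[-R, R]` and `0` outside of `[-(R + 1), R + 1]`. -/
def cutoff (R r : ℝ) : ℝ := max 0 (min 1 (R + 1 - |r|))

theorem cutoff_nonneg (R r : ℝ) : 0 ≤ cutoff R r := le_max_left _ _

theorem cutoff_le_one (R r : ℝ) : cutoff R r ≤ 1 := max_le zero_le_one (min_le_left _ _)

theorem cutoff_eq_one {R r : ℝ} (h : |r| ≤ R) : cutoff R r = 1 := by
  rw [cutoff, min_eq_left (by linarith), max_eq_right zero_le_one]

theorem cutoff_eq_zero {R r : ℝ} (h : R + 1 ≤ |r|) : cutoff R r = 0 := by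
  rw [cutoff, max_eq_left]
  exact (min_le_right _ _).trans (by linarith)

theorem continuous_cutoff (R : ℝ) : Continuous (cutoff R) := by unfold cutoff; fun_prop

theorem abs_cutoff_sub_le (R a b : ℝ) : |cutoff R a - cutoff R b| ≤ |a - b| := by
  have h1 : |cutoff R a - cutoff R b| ≤ |(min 1 (R + 1 - |a|)) - (min 1 (R + 1 - |b|))| := by
    have := abs_max_sub_max_le_abs (min 1 (R + 1 - |a|)) (min 1 (R + 1 - |b|)) 0
    rwa [max_comm _ (0 : ℝ), max_comm _ (0 : ℝ)] at this
  have h2 := abs_min_sub_min_le_max 1 (R + 1 - |a|) 1 (R + 1 - |b|)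
  have h3 := abs_abs_sub_abs_le a b
  refine h1.trans (h2.trans (max_le (by simp) ?_))
  rw [show R + 1 - |a| - (R + 1 - |b|) = -(|a| - |b|) by ring, abs_neg]
  exact h3

/-- The field `g`, cut off outside of a bounded set. -/
def cutField (R : ℝ) (g : ℝ → S → S) (t : ℝ) (x : S) : S :=
  (cutoff R t * cutoff R ‖x‖) • g t x

theorem continuous_cutField (R : ℝ) {g : ℝ → S → S} (hg : Continuous ↿g) :
    Continuous ↿(cutField R g) := by
  have h1 := continuous_cutoff R
  exact ((h1.comp continuous_fst).mul (h1.comp (continuous_norm.comp continuous_snd))).smul hg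

theorem cutField_eq {R : ℝ} {g : ℝ → S → S} {t : ℝ} {x : S} (ht : |t| ≤ R) (hx : ‖x‖ ≤ R) :
    cutField R g t x = g t x := by
  rw [cutField, cutoff_eq_one ht, cutoff_eq_one (by simpa using hx), mul_one, one_smul]

variable [ProperSpace S]

theorem uniformContinuous_cutField (R : ℝ) {g : ℝ → S → S} (hg : Continuous ↿g) :
    UniformContinuous ↿(cutField R g) := by
  refine HasCompactSupport.uniformContinuous_of_continuous ?_ (continuous_cutField R hg)
  refine HasCompactSupport.intro ((isCompact_closedBall (0 : ℝ) (R + 1)).prod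
    (isCompact_closedBall (0 : S) (R + 1))) fun p hp => ?_
  change (cutoff R p.1 * cutoff R ‖p.2‖) • g p.1 p.2 = 0
  rw [mem_prod, not_and_or, mem_closedBall_zero_iff, mem_closedBall_zero_iff, not_le, not_le] at hp
  rcases hp with hp | hp
  · rw [cutoff_eq_zero hp.le, zero_mul, zero_smul]
  · rw [cutoff_eq_zero (r := ‖p.2‖) (by simpa using hp.le), mul_zero, zero_smul]

omit [NormedSpace ℝ S] in
theorem exists_bound_cutField {g : ℝ → S → S} (hg : Continuous ↿g) (R : ℝ) :
    ∃ M, 0 ≤ M ∧ ∀ t x, |t| ≤ R → ‖x‖ ≤ R → ‖g t x‖ ≤ M := by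
  obtain ⟨M, hM⟩ := ((isCompact_closedBall (0 : ℝ) R).prod
    (isCompact_closedBall (0 : S) R)).exists_bound_of_continuousOn hg.continuousOn
  refine ⟨max M 0, le_max_right _ _, fun t x ht hx => (hM (t, x) ⟨?_, ?_⟩).trans (le_max_left _ _)⟩
  · simpa using ht
  · simpa using hx

theorem exists_abs_le {γ : ℝ → ℝ} (hγ : Continuous γ) (R : ℝ) :
    ∃ M, 0 ≤ M ∧ ∀ t, |t| ≤ R → |γ t| ≤ M := by
  obtain ⟨M, hM⟩ := (isCompact_closedBall (0 : ℝ) R).exists_bound_of_continuousOn hγ.continuousOn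
  exact ⟨max M 0, le_max_right _ _, fun t ht => (hM t (by simpa using ht)).trans (le_max_left _ _)⟩

/-- Split the difference of the cut-off fields so that the increment of the cut-off multiplies the
field at a point of the ball of radius `R + 1`, where the field is bounded. The cut-off is
1-Lipschitz, so this part is Lipschitz; the other part is a factor in `[0, 1]` times the original
difference. By symmetry it is enough that one point lies in the ball, and if neither does both
fields vanish. -/
theorem IsOneSidedLipschitz.exists_cutField {e : S ≃L[ℝ] H} {g : ℝ → S → S} {γ : ℝ → ℝ}
    (h : IsOneSidedLipschitz e g γ) (R : ℝ) :
    ∃ ℓ, 0 ≤ ℓ ∧ ∀ t x y, inner ℝ (e x - e y) (e (cutField R g t x) - e (cutField R g t y)) ≤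
      ℓ * ‖e x - e y‖ ^ 2 := by
  obtain ⟨c, hc0, hc⟩ := exists_norm_le e
  obtain ⟨K, hK0, hK⟩ := exists_abs_le h.rate (R + 1)
  obtain ⟨M, hM0, hM⟩ := exists_bound_cutField h.continuous (R + 1)
  set n := ‖(e : S →L[ℝ] H)‖
  have hn : ∀ x, ‖e x‖ ≤ n * ‖x‖ := (e : S →L[ℝ] H).le_opNorm
  have hn0 : 0 ≤ n := norm_nonneg _
  refine ⟨K + c * (n * M), by positivity, fun t x y => ?_⟩
  simp only [cutField, map_smul]
  rcases le_or_gt (R + 1) |t| with ht | ht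
  · rw [cutoff_eq_zero ht]
    simp only [zero_mul, zero_smul, sub_self, inner_zero_right]
    positivity
  have hτ0 := cutoff_nonneg R t
  have hτ1 := cutoff_le_one R t
  set τ := cutoff R t
  have key : ∀ u v : S, ‖u‖ ≤ R + 1 → inner ℝ (e u - e v)
      ((τ * cutoff R ‖u‖) • e (g t u) - (τ * cutoff R ‖v‖) • e (g t v)) ≤
      (K + c * (n * M)) * ‖e u - e v‖ ^ 2 := by
    intro u v hu
    have h1 : (τ * cutoff R ‖u‖) • e (g t u) - (τ * cutoff R ‖v‖) • e (g t v) =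
        (τ * cutoff R ‖v‖) • (e (g t u) - e (g t v)) +
        (τ * (cutoff R ‖u‖ - cutoff R ‖v‖)) • e (g t u) := by module
    rw [h1, inner_add_right, inner_smul_right, inner_smul_right]
    have h2 : inner ℝ (e u - e v) (e (g t u) - e (g t v)) ≤ K * ‖e u - e v‖ ^ 2 := by
      have := h.le t u v
      simp only [map_sub] at this
      have h3 := (le_abs_self _).trans (hK t ht.le)
      nlinarith [sq_nonneg ‖e u - e v‖]
    have hq0 := cutoff_nonneg R ‖v‖
    have hq1 := cutoff_le_one R ‖v‖
    have hτq : 0 ≤ τ * cutoff R ‖v‖ := by positivity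
    have hτq1 : τ * cutoff R ‖v‖ ≤ 1 := mul_le_one₀ hτ1 hq0 hq1
    have h4 : τ * cutoff R ‖v‖ * inner ℝ (e u - e v) (e (g t u) - e (g t v)) ≤
        K * ‖e u - e v‖ ^ 2 := by
      have h5 : 0 ≤ K * ‖e u - e v‖ ^ 2 := by positivity
      calc _ ≤ τ * cutoff R ‖v‖ * (K * ‖e u - e v‖ ^ 2) := by gcongr
        _ ≤ 1 * (K * ‖e u - e v‖ ^ 2) := by gcongr
        _ = _ := one_mul _
    have h6 : |cutoff R ‖u‖ - cutoff R ‖v‖| ≤ c * ‖e u - e v‖ := by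
      refine (abs_cutoff_sub_le _ _ _).trans ((abs_norm_sub_norm_le u v).trans ?_)
      simpa using hc (u - v)
    have h7 : τ * (cutoff R ‖u‖ - cutoff R ‖v‖) * inner ℝ (e u - e v) (e (g t u)) ≤
        c * (n * M) * ‖e u - e v‖ ^ 2 := by
      refine (le_abs_self _).trans ?_
      rw [abs_mul, abs_mul, abs_of_nonneg hτ0]
      have h8 := abs_real_inner_le_norm (e u - e v) (e (g t u))
      have h9 : ‖e (g t u)‖ ≤ n * M := (hn _).trans (by gcongr; exact hM t u ht.le hu)
      calc _ ≤ 1 * (c * ‖e u - e v‖) * (‖e u - e v‖ * (n * M)) := by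
            gcongr
            exact h8.trans (by gcongr)
        _ = _ := by ring
    linarith
  rcases le_or_gt ‖x‖ (R + 1) with hx | hx
  · exact key x y hx
  rcases le_or_gt ‖y‖ (R + 1) with hy | hy
  · have := key y x hy
    rw [← neg_sub (e x) (e y), ← neg_sub ((τ * cutoff R ‖x‖) • e (g t x)), inner_neg_neg,
      norm_neg] at this
    exact this
  · rw [cutoff_eq_zero (r := ‖x‖) (by simpa using hx.le),
      cutoff_eq_zero (r := ‖y‖) (by simpa using hy.le)]
    simp only [mul_zero, zero_smul, sub_self, inner_zero_right]
    positivity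

/-- A continuous one-sided Lipschitz field is solvable on `[0, ∞)`; the solution is a repeated
limit of approximations. -/
theorem IsOneSidedLipschitz.exists_solution {e : S ≃L[ℝ] H} {g : ℝ → S → S} {γ : ℝ → ℝ}
    (h : IsOneSidedLipschitz e g γ) (x₀ : S) :
    ∃ (x : ℝ → S) (y : ℕ → ℝ → S), IsForwardSolution g x₀ x ∧
      (∀ (R : ℕ) t, 0 ≤ t → Tendsto (fun n => approx (cutField R g) x₀ n t) atTop (𝓝 (y R t))) ∧
      ∀ t, 0 ≤ t → Tendsto (fun R => y R t) atTop (𝓝 (x t)) := by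
  have hex : ∀ R : ℕ, ∃ y : ℝ → S, IsForwardSolution (cutField R g) x₀ y ∧
      ∀ t, 0 ≤ t → Tendsto (fun n => approx (cutField R g) x₀ n t) atTop (𝓝 (y t)) := by
    intro R
    obtain ⟨ℓ, hℓ0, hℓ⟩ := h.exists_cutField R
    obtain ⟨M, hM0, hM⟩ := exists_bound_cutField h.continuous ((R : ℝ) + 1)
    refine exists_solution_of_bounded e (uniformContinuous_cutField R h.continuous) (M := M)
      (fun t x => ?_) hℓ0 hℓ x₀
    rw [cutField, norm_smul, Real.norm_eq_abs,
      abs_of_nonneg (mul_nonneg (cutoff_nonneg _ _) (cutoff_nonneg _ _))]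
    by_cases ht : |t| ≤ R + 1
    · by_cases hx : ‖x‖ ≤ R + 1
      · calc _ ≤ 1 * M := by
              gcongr
              · exact mul_le_one₀ (cutoff_le_one _ _) (cutoff_nonneg _ _) (cutoff_le_one _ _)
              · exact hM t x ht hx
          _ = M := one_mul _
      · rw [cutoff_eq_zero (r := ‖x‖) (by simpa using (not_le.1 hx).le)]
        simpa using hM0
    · rw [cutoff_eq_zero (r := t) (not_le.1 ht).le]
      simpa using hM0
  choose y hy hlim using hex
  -- a bound for all cut-off solutions
  have hbound : ∀ T : ℝ, 0 ≤ T → ∃ R₀ : ℕ, ∀ R : ℕ, R₀ ≤ R → IsSolutionOn g (y R) 0 T := by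
    intro T hT
    obtain ⟨c, hc0, hc⟩ := exists_norm_le e
    obtain ⟨K, hK0, hK⟩ := exists_abs_le h.rate T
    obtain ⟨M, hM0, hM⟩ := exists_abs_le (γ := fun t => ‖e (g t 0)‖)
      (e.continuous.comp (h.continuous.comp (continuous_id.prodMk continuous_const))).norm T
    -- This energy bound does not depend on `R`: multiplying the field by a factor in `[0, 1]`
    -- preserves a growth inequality whose right-hand side is nonnegative. For `R ≥ R₀` the cut-off
    -- is thus never felt on `[0, T]`.
    set B := Real.exp ((K + 1) * T) * (‖e x₀‖ ^ 2 + M ^ 2 * T)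
    obtain ⟨R₀, hR₀⟩ := exists_nat_ge (max T (c * B.sqrt))
    refine ⟨R₀, fun R hR => ?_⟩
    have hRT : T ≤ R := (le_max_left _ _).trans (hR₀.trans (by exact_mod_cast hR))
    have hRB : c * B.sqrt ≤ R := (le_max_right _ _).trans (hR₀.trans (by exact_mod_cast hR))
    have hnorm : ∀ t ∈ Icc 0 T, ‖y R t‖ ≤ R := by
      intro t ht
      have hsol := (hy R).isSolutionOn (a := 0) (b := t) le_rfl
      have := energy_le_const (e : S →L[ℝ] H) (k := K + 1) (β := M ^ 2) ht.1 (by positivity)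
        (by positivity) hsol.cont hsol.deriv (by
          intro s hs
          have hsT : |s| ≤ T := by rw [abs_of_nonneg hs.1]; linarith [hs.2, ht.2]
          simp only [ContinuousLinearEquiv.coe_coe, cutField, map_smul, inner_smul_right]
          have h1 := h.le s (y R s) 0
          rw [sub_zero, map_sub, inner_sub_right] at h1
          have h2 := (le_abs_self _).trans (hK s hsT)
          have h3 := (le_abs_self _).trans (hM s hsT)
          have h4 := real_inner_le_norm (e (y R s)) (e (g s 0))
          have h5 := two_mul_le_of_le h3 (norm_nonneg (e (y R s)))
          have h6 : 2 * inner ℝ (e (y R s)) (e (g s (y R s))) ≤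
              (K + 1) * ‖e (y R s)‖ ^ 2 + M ^ 2 := by
            nlinarith [sq_nonneg ‖e (y R s)‖]
          have h7 : 0 ≤ cutoff (R : ℝ) s * cutoff R ‖y R s‖ :=
            mul_nonneg (cutoff_nonneg _ _) (cutoff_nonneg _ _)
          have h8 : cutoff (R : ℝ) s * cutoff R ‖y R s‖ ≤ 1 :=
            mul_le_one₀ (cutoff_le_one _ _) (cutoff_nonneg _ _) (cutoff_le_one _ _)
          have h9 : 0 ≤ (K + 1) * ‖e (y R s)‖ ^ 2 + M ^ 2 := by positivity
          calc _ = cutoff (R : ℝ) s * cutoff R ‖y R s‖ *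
                (2 * inner ℝ (e (y R s)) (e (g s (y R s)))) := by ring
            _ ≤ cutoff (R : ℝ) s * cutoff R ‖y R s‖ *
                ((K + 1) * ‖e (y R s)‖ ^ 2 + M ^ 2) := by gcongr
            _ ≤ 1 * ((K + 1) * ‖e (y R s)‖ ^ 2 + M ^ 2) := by gcongr
            _ = _ := one_mul _)
      refine (hc _).trans (le_trans ?_ hRB)
      gcongr
      refine Real.le_sqrt_of_sq_le (this.trans ?_)
      have h0 := ht.1
      have hT2 := ht.2
      simp only [(hy R).init, sub_zero, ContinuousLinearEquiv.coe_coe, B]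
      gcongr
    have hsol := (hy R).isSolutionOn (a := 0) (b := T) le_rfl
    refine ⟨hsol.cont, fun t ht => ?_⟩
    have := hsol.deriv t ht
    rwa [cutField_eq (by rw [abs_of_nonneg ht.1]; linarith [ht.2])
      (hnorm t ⟨ht.1, ht.2.le⟩)] at this
  choose! R₀ hR₀ using hbound
  have hev : ∀ T : ℝ, 0 ≤ T → ∀ R ≥ R₀ T, EqOn (y R) (y (R₀ T)) (Icc 0 T) := fun T hT R hR =>
    h.eqOn (hR₀ T hT R hR) (hR₀ T hT _ le_rfl) ((hy R).init.trans (hy _).init.symm)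
  let x : ℝ → S := fun t => y (R₀ (t + 1)) t
  have hx : ∀ T : ℝ, 0 ≤ T → EqOn x (y (R₀ T)) (Icc 0 T) := by
    intro T hT t ht
    have h1 := hev T hT (max (R₀ T) (R₀ (t + 1))) (le_max_left _ _) ht
    have h2 := hev (t + 1) (by linarith [ht.1]) (max (R₀ T) (R₀ (t + 1))) (le_max_right _ _)
      (show t ∈ Icc 0 (t + 1) from ⟨ht.1, by linarith⟩)
    exact h2.symm.trans h1
  refine ⟨x, y, ⟨(hy _).init, fun t ht => ?_⟩, fun R t ht => hlim R t ht, fun t ht => ?_⟩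
  · have hT : 0 ≤ t + 1 := by linarith
    -- The first entry of the maximum makes `y R` agree with `x` up to time `t + 1`, the second
    -- makes the cut-off equal to `1` at the point `(t, x t)`.
    have h1 : HasDerivWithinAt (y (max (R₀ (t + 1)) ⌈max (t + 1) ‖x t‖⌉₊)) _ (Ici 0) t :=
      (hy (max (R₀ (t + 1)) ⌈max (t + 1) ‖x t‖⌉₊)).deriv t ht
    set R := max (R₀ (t + 1)) ⌈max (t + 1) ‖x t‖⌉₊ with hR
    have h2 : EqOn x (y R) (Icc 0 (t + 1)) := fun s hs =>
      (hx (t + 1) hT hs).trans (hev (t + 1) hT R (le_max_left _ _) hs).symm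
    have h3 : y R t = x t := (h2 ⟨ht, by linarith⟩).symm
    have h4 : max (t + 1) ‖x t‖ ≤ R := (Nat.le_ceil _).trans (by exact_mod_cast le_max_right _ _)
    rw [h3, cutField_eq (by rw [abs_of_nonneg ht]; linarith [(le_max_left (t + 1) ‖x t‖).trans h4])
      ((le_max_right _ _).trans h4)] at h1
    refine h1.congr_of_eventuallyEq ?_ h3.symm
    have : Iio (t + 1) ∈ 𝓝[Ici 0] t := mem_nhdsWithin_of_mem_nhds (Iio_mem_nhds (by linarith))
    filter_upwards [this, self_mem_nhdsWithin] with s hs hs0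
    exact h2 ⟨hs0, le_of_lt hs⟩
  · refine tendsto_const_nhds.congr' ?_
    filter_upwards [eventually_ge_atTop (R₀ (t + 1))] with R hR
    exact (hev (t + 1) (by linarith) R hR ⟨ht, by linarith⟩).symm

end Existence

end

section

variable {m d N : ℕ}

/-! ### Measurable dependence of the approximations on path, initial value and time -/

section Measurability

variable {S : Type*} [NormedAddCommGroup S] [NormedSpace ℝ S] [ProperSpace S]
  [MeasurableSpace S] [BorelSpace S] {Ξ : Type*} [MeasurableSpace Ξ]

theorem measurable_intervalIntegral {F : Ξ → ℝ → S} (hF : Measurable ↿F) {a b : Ξ → ℝ}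
    (ha : Measurable a) (hb : Measurable b) :
    Measurable fun p => ∫ s in (a p)..(b p), F p s := by
  have key : ∀ u v : Ξ → ℝ, Measurable u → Measurable v →
      Measurable fun p => ∫ s in Ioc (u p) (v p), F p s := by
    intro u v hu hv
    have h1 : ∀ p, ∫ s in Ioc (u p) (v p), F p s = ∫ s, (Ioc (u p) (v p)).indicator (F p) s :=
      fun p => (integral_indicator measurableSet_Ioc).symm
    simp_rw [h1]
    have hset : MeasurableSet {q : Ξ × ℝ | q.2 ∈ Ioc (u q.1) (v q.1)} :=
      (measurableSet_lt (hu.comp measurable_fst) measurable_snd).inter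
        (measurableSet_le measurable_snd (hv.comp measurable_fst))
    have h2 : StronglyMeasurable (Function.uncurry fun p s => (Ioc (u p) (v p)).indicator (F p) s) :=
      (hF.indicator hset).stronglyMeasurable
    exact h2.integral_prod_right.measurable
  exact (key a b ha hb).sub (key b a hb ha)

theorem measurable_tonelli {G : Ξ → ℝ → S → S} (hG : Measurable ↿G) (h : ℝ) (k : ℕ) :
    Measurable fun p : (Ξ × S) × ℝ => tonelli (G p.1.1) h p.1.2 k p.2 := by
  induction k with
  | zero => exact measurable_fst.snd
  | succ k ih =>
    change Measurable fun p : (Ξ × S) × ℝ => p.1.2 + ∫ s in (0 : ℝ)..p.2,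
      G p.1.1 s (tonelli (G p.1.1) h p.1.2 k (max (s - h) 0))
    refine measurable_fst.snd.add (measurable_intervalIntegral
      (F := fun (p : (Ξ × S) × ℝ) s => G p.1.1 s (tonelli (G p.1.1) h p.1.2 k (max (s - h) 0)))
      ?_ measurable_const measurable_snd)
    have h1 : Measurable fun q : ((Ξ × S) × ℝ) × ℝ =>
        tonelli (G q.1.1.1) h q.1.1.2 k (max (q.2 - h) 0) :=
      ih.comp ((measurable_fst.comp measurable_fst).prodMk
        ((measurable_snd.sub_const h).max measurable_const))
    exact hG.comp ((measurable_fst.comp (measurable_fst.comp measurable_fst)).prodMk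
      (measurable_snd.prodMk h1))

theorem measurable_approx_cutField {G : Ξ → ℝ → S → S} (hG : Measurable ↿G) (R : ℝ) (n : ℕ) :
    Measurable fun p : (Ξ × S) × ℝ => approx (cutField R (G p.1.1)) p.1.2 n p.2 := by
  refine measurable_tonelli (G := fun ξ => cutField R (G ξ)) ?_ _ _
  have h1 := (continuous_cutoff R).measurable
  exact ((h1.comp measurable_snd.fst).mul (h1.comp measurable_snd.snd.norm)).smul hG

end Measurability

theorem shift_zero (ω : WienerSpace m) : shift 0 ω = ω :=
  Subtype.ext (ContinuousMap.ext fun s => by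
    change ω.1 (s + 0) - ω.1 0 = ω.1 s
    rw [add_zero, ω.2, sub_zero])

theorem shift_shift (s t : ℝ) (ω : WienerSpace m) : shift t (shift s ω) = shift (t + s) ω :=
  Subtype.ext (ContinuousMap.ext fun u => by
    change (ω.1 (u + t + s) - ω.1 s) - (ω.1 (t + s) - ω.1 s) = ω.1 (u + (t + s)) - ω.1 (t + s)
    rw [add_assoc]; abel)

/-! ### Random fields, their flows and their pullback attractors -/

section RDS

variable {S H : Type*} [NormedAddCommGroup S] [NormedSpace ℝ S] [ProperSpace S]
  [NormedAddCommGroup H] [InnerProductSpace ℝ H]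

/-- A random field over the shift on the invariant set `Ω'` that is one-sided Lipschitz with
random rate `γ`. -/
structure IsRandomField [MeasurableSpace S] (Ω' : Set (WienerSpace m)) (e : S ≃L[ℝ] H)
    (g : WienerSpace m → ℝ → S → S) (γ : WienerSpace m → ℝ → ℝ) : Prop where
  measurable_shift : ∀ t, Measurable (shift t : WienerSpace m → WienerSpace m)
  shift_mem : ∀ t, ∀ ω ∈ Ω', shift t ω ∈ Ω'
  covariant : ∀ ω ∈ Ω', ∀ s t, g (shift s ω) t = g ω (t + s)
  rate_covariant : ∀ ω ∈ Ω', ∀ s t, γ (shift s ω) t = γ ω (t + s)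
  lipschitz : ∀ ω ∈ Ω', IsOneSidedLipschitz e (g ω) (γ ω)
  measurable : Measurable fun p : Ω' × ℝ × S => g p.1.1 p.2.1 p.2.2

variable [MeasurableSpace S] {Ω' : Set (WienerSpace m)} {e : S ≃L[ℝ] H}
  {g : WienerSpace m → ℝ → S → S} {γ : WienerSpace m → ℝ → ℝ}

theorem IsRandomField.isForwardSolution (h : IsRandomField Ω' e g γ) {ω : WienerSpace m}
    (hω : ω ∈ Ω') (x₀ : S) : IsForwardSolution (g ω) x₀ fun t => solutionFlow g t ω x₀ := by
  obtain ⟨x, -, hx, -⟩ := (h.lipschitz ω hω).exists_solution x₀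
  have hex : ∃ x, IsForwardSolution (g ω) x₀ x := ⟨x, hx⟩
  have : (fun t => solutionFlow g t ω x₀) = hex.choose := by
    funext t
    rw [solutionFlow, dif_pos hex]
  rw [this]
  exact hex.choose_spec

theorem IsRandomField.eq_solutionFlow (h : IsRandomField Ω' e g γ) {ω : WienerSpace m}
    (hω : ω ∈ Ω') {x₀ : S} {x : ℝ → S} (hx : IsForwardSolution (g ω) x₀ x) {t : ℝ} (ht : 0 ≤ t) :
    x t = solutionFlow g t ω x₀ :=
  (h.lipschitz ω hω).unique hx (h.isForwardSolution hω x₀) ht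

theorem IsRandomField.cocycle (h : IsRandomField Ω' e g γ) {ω : WienerSpace m}
    (hω : ω ∈ Ω') {s t : ℝ} (hs : 0 ≤ s) (ht : 0 ≤ t) (x₀ : S) :
    solutionFlow g (t + s) ω x₀ = solutionFlow g t (shift s ω) (solutionFlow g s ω x₀) := by
  refine h.eq_solutionFlow (h.shift_mem s ω hω) (x := fun t => solutionFlow g (t + s) ω x₀)
    ⟨by simp, fun u hu => ?_⟩ ht
  have h1 := (h.isForwardSolution hω x₀).deriv (u + s) (by linarith)
  rw [h.covariant ω hω]
  have h2 : HasDerivWithinAt (fun u => u + s) (1 : ℝ) (Ici 0) u :=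
    ((hasDerivAt_id u).add_const s).hasDerivWithinAt
  have h3 := HasDerivWithinAt.scomp (t' := Ici 0) u h1 h2 fun v (hv : 0 ≤ v) => by
    simp only [mem_Ici]; linarith
  simpa [Function.comp_def] using h3

theorem IsRandomField.flow_dist_le (h : IsRandomField Ω' e g γ) {ω : WienerSpace m}
    (hω : ω ∈ Ω') {t : ℝ} (ht : 0 ≤ t) (x y : S) :
    ‖e (solutionFlow g t ω x - solutionFlow g t ω y)‖ ^ 2 ≤
      Real.exp (∫ r in (0 : ℝ)..t, γ ω r) * ‖e (x - y)‖ ^ 2 := by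
  have hx := h.isForwardSolution hω x
  have hy := h.isForwardSolution hω y
  have := (h.lipschitz ω hω).dist_le ht (hx.isSolutionOn le_rfl) (hy.isSolutionOn le_rfl)
  rwa [hx.init, hy.init] at this

theorem IsRandomField.pullback_dist_le (h : IsRandomField Ω' e g γ) {ω : WienerSpace m}
    (hω : ω ∈ Ω') {t : ℝ} (ht : 0 ≤ t) (x y : S) :
    ‖e (solutionFlow g t (shift (-t) ω) x - solutionFlow g t (shift (-t) ω) y)‖ ^ 2 ≤
      Real.exp (∫ r in (-t)..0, γ ω r) * ‖e (x - y)‖ ^ 2 := by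
  have := h.flow_dist_le (h.shift_mem (-t) ω hω) ht x y
  simp_rw [h.rate_covariant ω hω] at this
  rwa [intervalIntegral.integral_comp_add_right (fun r => γ ω r), zero_add, add_neg_cancel] at this

theorem IsRandomField.continuous_flow (h : IsRandomField Ω' e g γ) {ω : WienerSpace m}
    (hω : ω ∈ Ω') {t : ℝ} (ht : 0 ≤ t) : Continuous (solutionFlow g t ω) := by
  obtain ⟨c, hc0, hc⟩ := exists_norm_le e
  set E := Real.exp (∫ r in (0 : ℝ)..t, γ ω r)
  refine (LipschitzWith.of_dist_le_mul (K := (c * E.sqrt * ‖(e : S →L[ℝ] H)‖).toNNReal)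
    fun x y => ?_).continuous
  rw [Real.coe_toNNReal _ (by positivity), dist_eq_norm, dist_eq_norm]
  calc _ ≤ c * ‖e (solutionFlow g t ω x - solutionFlow g t ω y)‖ := hc _
    _ ≤ c * (E.sqrt * ‖e (x - y)‖) := by
        gcongr
        refine (sq_le_sq₀ (by positivity) (by positivity)).1 ?_
        rw [mul_pow, Real.sq_sqrt (Real.exp_pos _).le]
        exact h.flow_dist_le hω ht x y
    _ ≤ c * (E.sqrt * (‖(e : S →L[ℝ] H)‖ * ‖x - y‖)) := by
        gcongr; exact (e : S →L[ℝ] H).le_opNorm _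
    _ = _ := by ring

/-- Joint measurability comes from the construction: the solution is a repeated limit, first of
vanishing delay and then of growing cut-off radius, of iterated integrals that are jointly
measurable. `solutionFlow` is defined by choice, but uniqueness identifies it with this limit. -/
theorem IsRandomField.generatesRDS [BorelSpace S] (h : IsRandomField Ω' e g γ) : GeneratesRDS Ω' g where
  solves ω hω x₀ := h.isForwardSolution hω x₀
  unique ω hω x₀ x hx t ht := h.eq_solutionFlow hω hx ht
  cocycle ω hω s t hs ht x₀ := h.cocycle hω hs ht x₀
  continuous ω hω t ht := h.continuous_flow hω ht
  measurable := by
    have hex : ∀ p : ℝ≥0 × Ω' × S, ∃ y : ℕ → S,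
        (∀ R : ℕ, Tendsto (fun n => approx (cutField R (g p.2.1.1)) p.2.2 n p.1) atTop (𝓝 (y R))) ∧
        Tendsto y atTop (𝓝 (solutionFlow g p.1 p.2.1.1 p.2.2)) := by
      intro p
      obtain ⟨x, y, hx, hy, hxy⟩ := (h.lipschitz p.2.1.1 p.2.1.2).exists_solution p.2.2
      refine ⟨fun R => y R p.1, fun R => hy R _ p.1.2, ?_⟩
      have := hxy _ p.1.2
      rwa [h.eq_solutionFlow p.2.1.2 hx p.1.2] at this
    choose y hy hlim using hex
    refine measurable_of_tendsto_metrizable (f := fun R p => y p R) (fun R => ?_)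
      (tendsto_pi_nhds.2 hlim)
    refine measurable_of_tendsto_metrizable
      (f := fun n (p : ℝ≥0 × Ω' × S) => approx (cutField R (g p.2.1.1)) p.2.2 n p.1) (fun n => ?_)
      (tendsto_pi_nhds.2 fun p => hy p R)
    exact (measurable_approx_cutField (G := fun ω : Ω' => g ω.1) h.measurable R n).comp
      (measurable_snd.prodMk measurable_fst.coe_nnreal_real)

/-! ### Pullback limits and singleton attractors -/

/-- A random field whose pullback trajectories contract exponentially. -/
structure IsDissipative (Ω' : Set (WienerSpace m)) (e : S ≃L[ℝ] H)
    (g : WienerSpace m → ℝ → S → S) (γ β : WienerSpace m → ℝ → ℝ) : Prop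
    extends IsRandomField Ω' e g γ where
  source_continuous : ∀ ω ∈ Ω', Continuous (β ω)
  source_nonneg : ∀ ω ∈ Ω', ∀ t, 0 ≤ β ω t
  source_covariant : ∀ ω ∈ Ω', ∀ s t, β (shift s ω) t = β ω (t + s)
  bound : ∀ ω ∈ Ω', ∀ t x, 2 * inner ℝ (e x) (e (g ω t x)) ≤ γ ω t * ‖e x‖ ^ 2 + β ω t
  decay : ∀ ω ∈ Ω', ∃ C lam : ℝ, 0 < C ∧ 0 < lam ∧ ∀ r ≤ 0,
    Real.exp (∫ s in r..0, γ ω s) * (1 + β ω r) ≤ C * Real.exp (lam * r)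

/-- The state at time `0` of the solution that starts in `0` at time `-T`. -/
def pullback (g : WienerSpace m → ℝ → S → S) (T : ℝ) (ω : WienerSpace m) : S :=
  solutionFlow g T (shift (-T) ω) 0

/-- The limit of the pullback trajectories. -/
def pullbackLimit (g : WienerSpace m → ℝ → S → S) (ω : WienerSpace m) : S :=
  limUnder atTop fun T : ℝ => pullback g T ω

variable {β : WienerSpace m → ℝ → ℝ}

/-- After weighting with the contraction factor from `s` to `0`, the source at absolute time `r`
enters with the factor `exp (∫_r^0 γ)`. The decay condition bounds the integrand by `C e^{lam r}`,
whose integral up to `s` gives the right-hand side. The field enters only through `C` and `lam`,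
which later makes the bound uniform in the coupling constant. -/
theorem IsDissipative.pullback_bound (h : IsDissipative Ω' e g γ β) {ω : WienerSpace m}
    (hω : ω ∈ Ω') {C lam : ℝ} (hC : 0 < C) (hlam : 0 < lam) (hdec : ∀ r ≤ 0,
      Real.exp (∫ s in r..0, γ ω s) * (1 + β ω r) ≤ C * Real.exp (lam * r))
    {s T : ℝ} (hs : s ≤ 0) (hT : 0 ≤ T) :
    Real.exp (∫ r in s..0, γ ω r) * ‖e (pullback g T (shift s ω))‖ ^ 2 ≤
      C / lam * Real.exp (lam * s) := by
  have hγ := (h.lipschitz ω hω).rate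
  have hβ := h.source_continuous ω hω
  have hmem := h.shift_mem (-T + s) ω hω
  have hsol := h.isForwardSolution hmem 0
  have hA : ∀ t, HasDerivAt (fun t => ∫ r in (0 : ℝ)..(t + (-T + s)), γ ω r)
      (γ (shift (-T + s) ω) t) t := by
    intro t
    rw [h.rate_covariant ω hω]
    have := (hγ.integral_hasStrictDerivAt 0 (t + (-T + s))).hasDerivAt.comp_add_const t (-T + s)
    exact this
  have key := energy_le (e : S →L[ℝ] H) (a := 0) (b := T) hT
    (hsol.isSolutionOn le_rfl).cont (hsol.isSolutionOn le_rfl).deriv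
    (fun t _ => h.bound _ hmem t _) hA (h.source_continuous _ hmem)
  simp only [hsol.init, map_zero, norm_zero, ne_eq, OfNat.ofNat_ne_zero, not_false_eq_true,
    zero_pow, mul_zero, zero_add] at key
  rw [pullback, shift_shift]
  refine (mul_le_mul_of_nonneg_left key (Real.exp_pos _).le).trans ?_
  rw [← intervalIntegral.integral_const_mul]
  have hint : ∫ r in (0 : ℝ)..T, Real.exp (∫ r in s..0, γ ω r) *
      (Real.exp ((∫ r in (0 : ℝ)..(T + (-T + s)), γ ω r) - ∫ u in (0 : ℝ)..(r + (-T + s)), γ ω u) *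
        β (shift (-T + s) ω) r) ≤
      ∫ r in (0 : ℝ)..T, C * Real.exp (lam * (r + (-T + s))) := by
    refine intervalIntegral.integral_mono_on hT ?_ (Continuous.intervalIntegrable (by fun_prop) _ _)
      fun r hr => ?_
    · refine Continuous.intervalIntegrable ?_ _ _
      have h1 : Continuous fun t => ∫ r in (0 : ℝ)..(t + (-T + s)), γ ω r :=
        continuous_iff_continuousAt.2 fun t => (hA t).continuousAt
      have h2 := h.source_continuous _ hmem
      fun_prop
    · have h1 := hdec (r + (-T + s)) (by linarith [hr.2])
      refine le_trans ?_ h1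
      rw [← mul_assoc, ← Real.exp_add, h.source_covariant ω hω,
        intervalIntegral.integral_symm (r + (-T + s)) 0, show T + (-T + s) = s by ring,
        intervalIntegral.integral_symm s 0]
      have := h.source_nonneg ω hω (r + (-T + s))
      gcongr <;> linarith
  refine hint.trans ?_
  have hprim : ∀ t : ℝ, HasDerivAt (fun t => C / lam * Real.exp (lam * (t + (-T + s))))
      (C * Real.exp (lam * (t + (-T + s)))) t := by
    intro t
    have := (((hasDerivAt_id t).add_const (-T + s)).const_mul lam).exp.const_mul (C / lam)
    refine this.congr_deriv ?_
    simp only [id, mul_one]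
    field_simp
  rw [intervalIntegral.integral_eq_sub_of_hasDerivAt (fun t _ => hprim t)
    (Continuous.intervalIntegrable (by fun_prop) _ _), show T + (-T + s) = s by ring]
  have : 0 < C / lam * Real.exp (lam * (0 + (-T + s))) := by positivity
  linarith

/-- By the cocycle property the two pullbacks are solutions over the same interval `[-T, 0]`,
started in `pullback g (T' - T) (shift (-T) ω)` and in `0`. Contraction and `pullback_bound` at time
`-T` give the estimate. -/
theorem IsDissipative.pullback_dist (h : IsDissipative Ω' e g γ β) {ω : WienerSpace m}
    (hω : ω ∈ Ω') {C lam : ℝ} (hC : 0 < C) (hlam : 0 < lam) (hdec : ∀ r ≤ 0,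
      Real.exp (∫ s in r..0, γ ω s) * (1 + β ω r) ≤ C * Real.exp (lam * r))
    {T T' : ℝ} (hT : 0 ≤ T) (hTT' : T ≤ T') :
    ‖e (pullback g T' ω - pullback g T ω)‖ ^ 2 ≤ C / lam * Real.exp (lam * (-T)) := by
  have h1 : pullback g T' ω = solutionFlow g T (shift (-T) ω)
      (pullback g (T' - T) (shift (-T) ω)) := by
    rw [pullback, pullback, shift_shift, show -(T' - T) + -T = -T' by ring]
    have := h.cocycle (h.shift_mem (-T') ω hω) (s := T' - T) (t := T) (by linarith) hT 0
    rwa [shift_shift, add_sub_cancel, show T' - T + -T' = -T by ring] at this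
  rw [h1, pullback]
  refine (h.pullback_dist_le hω hT _ _).trans ?_
  rw [sub_zero]
  exact h.pullback_bound hω hC hlam hdec (by linarith) (by linarith)

theorem IsDissipative.tendsto_pullback (h : IsDissipative Ω' e g γ β) {ω : WienerSpace m}
    (hω : ω ∈ Ω') : Tendsto (fun T : ℝ => pullback g T ω) atTop (𝓝 (pullbackLimit g ω)) := by
  obtain ⟨C, lam, hC, hlam, hdec⟩ := h.decay ω hω
  obtain ⟨c, hc0, hc⟩ := exists_norm_le e
  have hcau : CauchySeq fun T : ℝ => pullback g T ω := by
    rw [Metric.cauchySeq_iff']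
    intro ε hε
    have hlim : Tendsto (fun T : ℝ => c * (C / lam * Real.exp (lam * (-T))).sqrt) atTop (𝓝 0) := by
      have h1 : Tendsto (fun T : ℝ => Real.exp (lam * (-T))) atTop (𝓝 0) :=
        Real.tendsto_exp_atBot.comp (tendsto_neg_atTop_atBot.const_mul_atBot hlam)
      have h2 := (((h1.const_mul (C / lam)).sqrt).const_mul c)
      simpa using h2
    obtain ⟨T, hT1, hT2⟩ := ((hlim.eventually (gt_mem_nhds hε)).and (eventually_ge_atTop 0)).exists
    refine ⟨T, fun T' hT' => lt_of_le_of_lt ?_ hT1⟩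
    rw [dist_eq_norm]
    refine (hc _).trans ?_
    gcongr
    exact Real.le_sqrt_of_sq_le (h.pullback_dist hω hC hlam hdec hT2 hT')
  exact tendsto_nhds_limUnder (cauchySeq_tendsto_of_complete hcau)

theorem IsDissipative.pullbackLimit_bound (h : IsDissipative Ω' e g γ β) {ω : WienerSpace m}
    (hω : ω ∈ Ω') {C lam : ℝ} (hC : 0 < C) (hlam : 0 < lam) (hdec : ∀ r ≤ 0,
      Real.exp (∫ s in r..0, γ ω s) * (1 + β ω r) ≤ C * Real.exp (lam * r))
    {s : ℝ} (hs : s ≤ 0) :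
    Real.exp (∫ r in s..0, γ ω r) * ‖e (pullbackLimit g (shift s ω))‖ ^ 2 ≤
      C / lam * Real.exp (lam * s) := by
  have h1 := h.tendsto_pullback (h.shift_mem s ω hω)
  have h2 := ((((e.continuous.tendsto _).comp h1).norm).pow 2).const_mul
    (Real.exp (∫ r in s..0, γ ω r))
  refine le_of_tendsto h2 ?_
  filter_upwards [eventually_ge_atTop 0] with T hT
  exact h.pullback_bound hω hC hlam hdec hs hT

theorem IsDissipative.flow_pullbackLimit (h : IsDissipative Ω' e g γ β) {ω : WienerSpace m}
    (hω : ω ∈ Ω') {t : ℝ} (ht : 0 ≤ t) :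
    solutionFlow g t ω (pullbackLimit g ω) = pullbackLimit g (shift t ω) := by
  have h1 := ((h.continuous_flow hω ht).tendsto _).comp (h.tendsto_pullback hω)
  have h2 := (h.tendsto_pullback (h.shift_mem t ω hω)).comp (tendsto_atTop_add_const_left _ t
    tendsto_id)
  refine tendsto_nhds_unique h1 (h2.congr' ?_)
  filter_upwards [eventually_ge_atTop 0] with T hT
  simp only [Function.comp, id, pullback]
  rw [shift_shift, show -(t + T) + t = -T by ring, h.cocycle (h.shift_mem _ ω hω) hT ht, shift_shift,
    add_neg_cancel, shift_zero]

theorem measurable_pullbackLimit [BorelSpace S] (h : IsDissipative Ω' e g γ β) :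
    Measurable fun ω : Ω' => pullbackLimit g ω.1 := by
  refine measurable_of_tendsto_metrizable (f := fun (n : ℕ) (ω : Ω') => pullback g n ω.1)
    (fun n => ?_)
    (tendsto_pi_nhds.2 fun ω => (h.tendsto_pullback ω.2).comp tendsto_natCast_atTop_atTop)
  have h1 : Measurable fun ω : Ω' => ((n : ℝ≥0), (⟨shift (-n) ω.1, h.shift_mem _ _ ω.2⟩ : Ω'),
      (0 : S)) :=
    measurable_const.prodMk ((((h.measurable_shift _).comp measurable_subtype_coe).subtype_mk).prodMk
      measurable_const)
  exact h.generatesRDS.measurable.comp h1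

theorem IsDissipative.isSingletonAttractor [BorelSpace S] (h : IsDissipative Ω' e g γ β) :
    IsSingletonAttractor Ω' g (pullbackLimit g) where
  random x := by
    simp only [Metric.infEDist_singleton]
    exact measurable_const.edist (measurable_pullbackLimit h)
  compact _ _ := isCompact_singleton
  invariant ω hω t ht := by rw [image_singleton, h.flow_pullbackLimit hω ht]
  attracts D hD ω hω := by
    obtain ⟨C, lam, hC, hlam, hdec⟩ := h.decay ω hω
    obtain ⟨c, hc0, hc⟩ := exists_norm_le e
    set n := ‖(e : S →L[ℝ] H)‖
    have hn : ∀ x, ‖e x‖ ≤ n * ‖x‖ := (e : S →L[ℝ] H).le_opNorm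
    have hn0 : 0 ≤ n := norm_nonneg _
    -- The squared norm contracts at rate `lam`, hence the norm at rate `lam / 2`.
    have htemp := hD.tempered ω hω (lam / 2) (by positivity)
    have hpb : Tendsto (fun T : ℝ => ‖pullback g T ω - pullbackLimit g ω‖) atTop (𝓝 0) := by
      have := (h.tendsto_pullback hω).sub_const (pullbackLimit g ω)
      rw [sub_self] at this
      simpa using this.norm
    have hbd : Tendsto (fun t : ℝ => c * (C.sqrt * n * (Real.exp (-(lam / 2) * t) *
        sSup (norm '' D (shift (-t) ω)))) + ‖pullback g t ω - pullbackLimit g ω‖) atTop (𝓝 0) := by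
      have := ((htemp.const_mul (C.sqrt * n)).const_mul c).add hpb
      simpa using this
    have hbd' := ENNReal.tendsto_ofReal hbd
    rw [ENNReal.ofReal_zero] at hbd'
    refine tendsto_of_tendsto_of_tendsto_of_le_of_le' tendsto_const_nhds hbd'
      (Eventually.of_forall fun _ => zero_le) ?_
    filter_upwards [eventually_ge_atTop 0] with t ht
    refine iSup₂_le fun y hy => ?_
    obtain ⟨u, hu, rfl⟩ := hy
    rw [Metric.infEDist_singleton, edist_dist]
    refine ENNReal.ofReal_le_ofReal ?_
    rw [dist_eq_norm]
    have hbdd : BddAbove (norm '' D (shift (-t) ω)) := by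
      obtain ⟨M, hM⟩ := (hD.bounded _ (h.shift_mem (-t) ω hω)).exists_norm_le
      exact ⟨M, by rintro _ ⟨v, hv, rfl⟩; exact hM v hv⟩
    have hule : ‖u‖ ≤ sSup (norm '' D (shift (-t) ω)) := le_csSup hbdd ⟨u, hu, rfl⟩
    have h1 := h.pullback_dist_le hω ht u 0
    have h2 : ‖e (solutionFlow g t (shift (-t) ω) u - pullback g t ω)‖ ≤
        C.sqrt * Real.exp (-(lam / 2) * t) * (n * ‖u‖) := by
      refine (sq_le_sq₀ (by positivity) (by positivity)).1 (h1.trans ?_)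
      rw [sub_zero, mul_pow, mul_pow, Real.sq_sqrt hC.le, ← Real.exp_nat_mul]
      gcongr
      · have h3 := hdec (-t) (by linarith)
        have h4 := h.source_nonneg ω hω (-t)
        have h5 := Real.exp_pos (∫ r in (-t)..0, γ ω r)
        have h6 : ((2 : ℕ) : ℝ) * (-(lam / 2) * t) = lam * -t := by push_cast; ring
        rw [h6]
        nlinarith
      · exact hn u
    calc ‖solutionFlow g t (shift (-t) ω) u - pullbackLimit g ω‖
        = ‖(solutionFlow g t (shift (-t) ω) u - pullback g t ω) +
            (pullback g t ω - pullbackLimit g ω)‖ := by congr 1; abel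
      _ ≤ ‖solutionFlow g t (shift (-t) ω) u - pullback g t ω‖ +
            ‖pullback g t ω - pullbackLimit g ω‖ := norm_add_le _ _
      _ ≤ c * (C.sqrt * Real.exp (-(lam / 2) * t) * (n * ‖u‖)) +
            ‖pullback g t ω - pullbackLimit g ω‖ := by
          gcongr
          exact (hc _).trans (by gcongr)
      _ ≤ c * (C.sqrt * Real.exp (-(lam / 2) * t) * (n * sSup (norm '' D (shift (-t) ω)))) +
            ‖pullback g t ω - pullbackLimit g ω‖ := by gcongr
      _ = _ := by ring

/-- The constant set `{0}` is tempered, so a singleton attractor has to attract the trajectories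
started in `0`, and these converge to the pullback limit. -/
theorem IsDissipative.eq_pullbackLimit (h : IsDissipative Ω' e g γ β) {a : WienerSpace m → S}
    (ha : IsSingletonAttractor Ω' g a) {ω : WienerSpace m} (hω : ω ∈ Ω') :
    a ω = pullbackLimit g ω := by
  have hD : IsTempered Ω' (fun _ : WienerSpace m => ({0} : Set S)) :=
    ⟨fun x => measurable_const, fun _ _ => Bornology.isBounded_singleton, fun ω _ k _ => by simp⟩
  have h1 := ha.attracts _ hD ω hω
  simp only [image_singleton, hausdorffSemidist, mem_singleton_iff, iSup_iSup_eq_left,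
    Metric.infEDist_singleton] at h1
  exact tendsto_nhds_unique (tendsto_iff_edist_tendsto_0.2 h1) (h.tendsto_pullback hω)

/-- Near time `t` the trajectory is the forward solution started at time `t - 1`, for which `t` is
an interior time; this yields a two-sided derivative. -/
theorem IsDissipative.hasDerivAt_pullbackLimit (h : IsDissipative Ω' e g γ β) {ω : WienerSpace m}
    (hω : ω ∈ Ω') (t : ℝ) :
    HasDerivAt (fun t => pullbackLimit g (shift t ω)) (g ω t (pullbackLimit g (shift t ω))) t := by
  have hmem := h.shift_mem (t - 1) ω hω
  have hsol := (h.isForwardSolution hmem (pullbackLimit g (shift (t - 1) ω))).deriv 1 zero_le_one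
  have h1 := hsol.hasDerivAt (Ici_mem_nhds one_pos)
  rw [h.flow_pullbackLimit hmem zero_le_one, shift_shift, h.covariant ω hω,
    add_sub_cancel] at h1
  have h2 := HasDerivAt.comp_sub_const (x := t) (a := t - 1)
    (f := fun s => solutionFlow g s (shift (t - 1) ω) (pullbackLimit g (shift (t - 1) ω)))
    (f' := g ω t (pullbackLimit g (shift t ω))) (by rwa [sub_sub_cancel])
  refine h2.congr_of_eventuallyEq ?_
  filter_upwards [Ici_mem_nhds (show t - 1 < t by linarith)] with s hs
  rw [h.flow_pullbackLimit hmem (by simpa using hs), shift_shift, sub_add_cancel]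

end RDS

end

section

/-! ### The Ornstein-Uhlenbeck process along a path -/

/-- The path `w` grows slower than linearly at `-∞`. -/
def IsSublinear (w : ℝ → ℝ) : Prop := ∀ ε > 0, ∃ C, ∀ t ≤ 0, |w t| ≤ C + ε * |t|

/-- The stationary Ornstein-Uhlenbeck process driven by `w`, after integration by parts. -/
def ou (w : ℝ → ℝ) (t : ℝ) : ℝ := ∫ τ in Iic (0 : ℝ), Real.exp τ * (w t - w (t + τ))

theorem IsSublinear.exists_bound {w : ℝ → ℝ} (hw : Continuous w) (hs : IsSublinear w) {ε : ℝ}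
    (hε : 0 < ε) (b : ℝ) : ∃ C, 0 ≤ C ∧ ∀ t ≤ b, |w t| ≤ C + ε * |t| := by
  obtain ⟨C, hC⟩ := hs ε hε
  obtain ⟨M, hM0, hM⟩ := exists_abs_le hw |b|
  have hC0 : 0 ≤ C := by simpa using (abs_nonneg _).trans (hC 0 le_rfl)
  refine ⟨C + M, by positivity, fun t ht => ?_⟩
  rcases le_or_gt t 0 with h | h
  · linarith [hC t h]
  · have := hM t (abs_le_abs ht (by linarith))
    have h2 : 0 ≤ ε * |t| := by positivity
    linarith

theorem abs_mul_exp_le (τ : ℝ) : Real.exp τ * |τ| ≤ 2 * Real.exp (τ / 2) + 2 * Real.exp (3 * τ / 2) := by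
  have h1 := Real.add_one_le_exp (|τ| / 2)
  have h2 : |τ| ≤ 2 * Real.exp (|τ| / 2) := by linarith [abs_nonneg τ]
  have h3 : Real.exp (|τ| / 2) ≤ Real.exp (-τ / 2) + Real.exp (τ / 2) := by
    rcases abs_cases τ with ⟨h, -⟩ | ⟨h, -⟩
    · rw [h]; linarith [Real.exp_pos (-τ / 2)]
    · rw [h]; linarith [Real.exp_pos (τ / 2)]
  have h4 : Real.exp τ * Real.exp (-τ / 2) = Real.exp (τ / 2) := by
    rw [← Real.exp_add]; congr 1; ring
  have h5 : Real.exp τ * Real.exp (τ / 2) = Real.exp (3 * τ / 2) := by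
    rw [← Real.exp_add]; congr 1; ring
  nlinarith [Real.exp_pos τ]

theorem integrableOn_exp_mul_abs : IntegrableOn (fun τ => Real.exp τ * |τ|) (Iic (0 : ℝ)) := by
  have h1 : IntegrableOn (fun τ : ℝ => 2 * Real.exp (τ / 2) + 2 * Real.exp (3 * τ / 2)) (Iic 0) := by
    have a1 := (integrableOn_exp_mul_Iic (show (0 : ℝ) < 1 / 2 by norm_num) 0).const_mul 2
    have a2 := (integrableOn_exp_mul_Iic (show (0 : ℝ) < 3 / 2 by norm_num) 0).const_mul 2
    refine (a1.add a2).congr (ae_of_all _ fun τ => ?_)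
    simp only [Pi.add_apply]
    congr 3 <;> ring
  refine Integrable.mono' h1 (by fun_prop) (ae_of_all _ fun τ => ?_)
  rw [Real.norm_eq_abs, abs_of_nonneg (by positivity)]
  exact abs_mul_exp_le τ

section Path

variable {w : ℝ → ℝ}

theorem IsSublinear.integrableOn_comp (hs : IsSublinear w) (hw : Continuous w) (t : ℝ) :
    IntegrableOn (fun τ => Real.exp τ * w (t + τ)) (Iic (0 : ℝ)) := by
  obtain ⟨C, hC0, hC⟩ := hs.exists_bound hw one_pos t
  have h1 : IntegrableOn (fun τ : ℝ => (C + |t|) * Real.exp τ + Real.exp τ * |τ|) (Iic 0) :=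
    ((integrableOn_exp_Iic 0).const_mul _).add integrableOn_exp_mul_abs
  refine Integrable.mono' h1 (by fun_prop) ?_
  refine (ae_restrict_iff' measurableSet_Iic).2 (ae_of_all _ fun τ hτ => ?_)
  rw [Real.norm_eq_abs, abs_mul, Real.abs_exp]
  have h2 := hC (t + τ) (by linarith [mem_Iic.1 hτ])
  have h3 := abs_add_le t τ
  nlinarith [Real.exp_pos τ]

theorem IsSublinear.ou_eq (hs : IsSublinear w) (hw : Continuous w) (t : ℝ) :
    ou w t = w t - ∫ τ in Iic (0 : ℝ), Real.exp τ * w (t + τ) := by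
  rw [ou]
  simp_rw [mul_sub]
  rw [integral_sub ((integrableOn_exp_Iic 0).mul_const _) (hs.integrableOn_comp hw t),
    integral_mul_const, integral_exp_Iic_zero, one_mul]

theorem setIntegral_Iic_comp_add (f : ℝ → ℝ) (t : ℝ) :
    ∫ τ in Iic (0 : ℝ), f (t + τ) = ∫ τ in Iic t, f τ := by
  rw [← integral_indicator measurableSet_Iic, ← integral_indicator measurableSet_Iic,
    ← integral_add_left_eq_self ((Iic t).indicator f) t]
  congr 1
  funext τ
  simp only [indicator, mem_Iic, add_le_iff_nonpos_right]

theorem IsSublinear.integrableOn (hs : IsSublinear w) (hw : Continuous w) (t : ℝ) :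
    IntegrableOn (fun τ => Real.exp τ * w τ) (Iic t) := by
  have h0 : IntegrableOn (fun τ => Real.exp τ * w τ) (Iic 0) := by
    simpa using hs.integrableOn_comp hw 0
  refine (h0.union (t := Icc 0 t) ?_).mono_set fun τ hτ => ?_
  · exact (Continuous.continuousOn (by fun_prop)).integrableOn_Icc
  · rcases le_total τ 0 with h | h
    · exact Or.inl h
    · exact Or.inr ⟨h, hτ⟩

theorem IsSublinear.ou_eq' (hs : IsSublinear w) (hw : Continuous w) (t : ℝ) :
    ou w t = w t - Real.exp (-t) * ∫ τ in Iic t, Real.exp τ * w τ := by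
  rw [hs.ou_eq hw, ← setIntegral_Iic_comp_add (fun τ => Real.exp τ * w τ) t, ← integral_const_mul]
  congr 2
  funext τ
  rw [← mul_assoc, ← Real.exp_add]
  congr 2
  ring

/-- The pathwise Langevin equation `dO = -O dt + dw`. The difference `O - w` is differentiable
although `w` is only continuous; both the vanishing time average of `O` and the removal of the noise
from the Stratonovich equation rest on this. -/
theorem IsSublinear.hasDerivAt_ou_sub (hs : IsSublinear w) (hw : Continuous w) (t : ℝ) :
    HasDerivAt (fun t => ou w t - w t) (-(ou w t)) t := by
  have h1 : ∀ t, ou w t - w t = -(Real.exp (-t) * ((∫ τ in Iic (0 : ℝ), Real.exp τ * w τ) +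
      ∫ τ in (0 : ℝ)..t, Real.exp τ * w τ)) := by
    intro t
    rw [hs.ou_eq' hw, ← intervalIntegral.integral_Iic_sub_Iic (hs.integrableOn hw 0)
      (hs.integrableOn hw t)]
    ring
  have hc : Continuous fun τ => Real.exp τ * w τ := by fun_prop
  have h2 := ((((hasDerivAt_id t).neg).exp.mul ((hc.integral_hasStrictDerivAt 0 t).hasDerivAt.const_add
    (∫ τ in Iic (0 : ℝ), Real.exp τ * w τ))).neg)
  refine (h2.congr_of_eventuallyEq (Eventually.of_forall fun s => h1 s)).congr_deriv ?_
  have h3 := h1 t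
  have h4 : Real.exp (-t) * (Real.exp t * w t) = w t := by
    rw [← mul_assoc, ← Real.exp_add]; simp
  simp only [id, Pi.neg_apply]
  rw [h4]
  linarith

theorem IsSublinear.continuous_ou (hs : IsSublinear w) (hw : Continuous w) : Continuous (ou w) := by
  have h1 : Continuous fun t => ou w t - w t :=
    continuous_iff_continuousAt.2 fun t => (hs.hasDerivAt_ou_sub hw t).continuousAt
  exact (h1.add hw).congr fun t => sub_add_cancel _ _

/-- Sublinear growth makes the boundary term `e^a w(a)` vanish for `a → -∞`, so the limit in the
definition exists and equals the integrated-by-parts expression. -/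
theorem IsSublinear.wienerIntegralIic_eq (hs : IsSublinear w) (hw : Continuous w) (t : ℝ) :
    wienerIntegralIic Real.exp w t = Real.exp t * ou w t := by
  refine Tendsto.limUnder_eq ?_
  have h1 : Tendsto (fun a => Real.exp a * w a) atBot (𝓝 0) := by
    obtain ⟨C, hC0, hC⟩ := hs.exists_bound hw one_pos 0
    have h2 : Tendsto (fun a : ℝ => C * Real.exp a + (2 * Real.exp (a / 2) + 2 * Real.exp (3 * a / 2)))
        atBot (𝓝 0) := by
      have e1 := Real.tendsto_exp_atBot
      have e2 := Real.tendsto_exp_atBot.comp (tendsto_id.atBot_div_const (show (0 : ℝ) < 2 by norm_num))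
      have e3 := Real.tendsto_exp_atBot.comp
        ((tendsto_id.const_mul_atBot (show (0 : ℝ) < 3 by norm_num)).atBot_div_const
          (show (0 : ℝ) < 2 by norm_num))
      simpa using (e1.const_mul C).add ((e2.const_mul 2).add (e3.const_mul 2))
    refine squeeze_zero_norm' ?_ h2
    filter_upwards [eventually_le_atBot 0] with a ha
    rw [Real.norm_eq_abs, abs_mul, Real.abs_exp]
    have h3 := hC a ha
    have h4 := abs_mul_exp_le a
    nlinarith [Real.exp_pos a]
  have h2 := intervalIntegral_tendsto_integral_Iic t (hs.integrableOn hw t) tendsto_id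
  have h3 := (tendsto_const_nhds (x := Real.exp t * w t)).sub h1 |>.sub h2
  rw [hs.ou_eq' hw, mul_sub, ← mul_assoc, ← Real.exp_add, add_neg_cancel, Real.exp_zero, one_mul]
  rw [sub_zero] at h3
  refine h3.congr fun a => ?_
  rw [wienerIntegral, Real.deriv_exp]
  rfl

theorem IsSublinear.ou (hs : IsSublinear w) (hw : Continuous w) : IsSublinear (ou w) := by
  intro ε hε
  obtain ⟨C, hC0, hC⟩ := hs.exists_bound hw (ε := ε / 2) (by positivity) 0
  set J := ∫ τ in Iic (0 : ℝ), Real.exp τ * |τ|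
  refine ⟨2 * C + ε / 2 * J, fun t ht => ?_⟩
  have h1 : |∫ τ in Iic (0 : ℝ), Real.exp τ * w (t + τ)| ≤ C + ε / 2 * |t| + ε / 2 * J := by
    have h2 : IntegrableOn (fun τ : ℝ => (C + ε / 2 * |t|) * Real.exp τ +
        ε / 2 * (Real.exp τ * |τ|)) (Iic 0) :=
      ((integrableOn_exp_Iic 0).const_mul _).add (integrableOn_exp_mul_abs.const_mul _)
    have h3 := norm_integral_le_of_norm_le h2 (f := fun τ => Real.exp τ * w (t + τ)) (by
      refine (ae_restrict_iff' measurableSet_Iic).2 (ae_of_all _ fun τ hτ => ?_)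
      rw [Real.norm_eq_abs, abs_mul, Real.abs_exp]
      have h2 := hC (t + τ) (by linarith [mem_Iic.1 hτ])
      have h3 := abs_add_le t τ
      have h4 : |w (t + τ)| ≤ C + ε / 2 * |t| + ε / 2 * |τ| := by nlinarith
      nlinarith [Real.exp_pos τ])
    rw [integral_add ((integrableOn_exp_Iic 0).const_mul _) (integrableOn_exp_mul_abs.const_mul _),
      integral_const_mul, integral_const_mul, integral_exp_Iic_zero, mul_one] at h3
    exact h3
  rw [hs.ou_eq hw]
  have h2 := hC t ht
  have h3 := abs_sub (w t) (∫ τ in Iic (0 : ℝ), Real.exp τ * w (t + τ))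
  linarith

/-- By the Langevin equation the integral of `O` is an increment of `O - w`, and both terms are
sublinear. The time average of `O` therefore vanishes without any appeal to an ergodic theorem. -/
theorem IsSublinear.integral_ou (hs : IsSublinear w) (hw : Continuous w) {ε : ℝ} (hε : 0 < ε) :
    ∃ C, ∀ s ≤ 0, |∫ r in s..0, StochSync.ou w r| ≤ C + ε * |s| := by
  obtain ⟨C, hC0, hC⟩ := hs.exists_bound hw (ε := ε / 2) (by positivity) 0
  obtain ⟨C', hC0', hC'⟩ := (hs.ou hw).exists_bound (hs.continuous_ou hw) (ε := ε / 2)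
    (by positivity) 0
  refine ⟨C + C' + |StochSync.ou w 0 - w 0|, fun s hs0 => ?_⟩
  have h1 := intervalIntegral.integral_eq_sub_of_hasDerivAt (a := s) (b := 0)
    (fun t _ => hs.hasDerivAt_ou_sub hw t) ((hs.continuous_ou hw).neg.intervalIntegrable _ _)
  rw [intervalIntegral.integral_neg] at h1
  have h2 := hC s hs0
  have h3 := hC' s hs0
  have h4 : ∫ r in s..0, StochSync.ou w r =
    (StochSync.ou w s - w s) - (StochSync.ou w 0 - w 0) := by linarith
  rw [h4]
  refine (abs_sub _ _).trans ?_
  have := abs_sub (StochSync.ou w s) (w s)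
  linarith

/-! ### Energy estimates for the Ornstein-Uhlenbeck process -/

/-- The mean square increment of `w` over `[a, a + 1]`. -/
def meanSq (w : ℝ → ℝ) (a : ℝ) : ℝ := ∫ r in (0 : ℝ)..1, (w (a + r) - w a) ^ 2

theorem meanSq_nonneg (w : ℝ → ℝ) (a : ℝ) : 0 ≤ meanSq w a :=
  intervalIntegral.integral_nonneg zero_le_one fun _ _ => sq_nonneg _

/-- For `y = O - Δw`, with `Δw` the increment of `w` since `a`, one has `y' = -O` and `-2 y O = Δw ^
2 - y ^ 2 - O ^ 2`. Dropping `O ^ 2` leaves a linear inequality with rate `-1` for `y ^ 2`. -/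
theorem IsSublinear.ou_sub_sq_le (hs : IsSublinear w) (hw : Continuous w) (a : ℝ) {s : ℝ}
    (h0 : 0 ≤ s) (h1 : s ≤ 1) :
    (StochSync.ou w (a + s) - (w (a + s) - w a)) ^ 2 ≤
      Real.exp (-s) * StochSync.ou w a ^ 2 + meanSq w a := by
  have hder : ∀ r, HasDerivAt (fun r => StochSync.ou w (a + r) - (w (a + r) - w a))
      (-(StochSync.ou w (a + r))) r := by
    intro r
    have := ((hs.hasDerivAt_ou_sub hw (a + r)).comp_const_add a r).add_const (w a)
    refine this.congr_of_eventuallyEq (Eventually.of_forall fun u => ?_)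
    ring
  have h := gronwall_linear (U := fun r => (StochSync.ou w (a + r) - (w (a + r) - w a)) ^ 2)
    (k := fun _ => -1) (β := fun r => (w (a + r) - w a) ^ 2) (A := fun r => -r) h0
    (continuous_iff_continuousAt.2 fun r => ((hder r).pow 2).continuousAt).continuousOn
    (fun r _ => ((hder r).pow 2).hasDerivWithinAt) (fun r _ => by
      have := sq_nonneg (StochSync.ou w (a + r) )
      simp only [Nat.cast_ofNat]
      norm_num
      nlinarith)
    (fun r => hasDerivAt_neg r) (by fun_prop)
  refine h.trans ?_
  simp only [add_zero, sub_self, sub_zero, neg_zero]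
  gcongr
  have h2 : ∫ r in (0 : ℝ)..s, Real.exp (-s - -r) * (w (a + r) - w a) ^ 2 ≤
      ∫ r in (0 : ℝ)..s, (w (a + r) - w a) ^ 2 := by
    refine intervalIntegral.integral_mono_on h0 (Continuous.intervalIntegrable (by fun_prop) _ _)
      (Continuous.intervalIntegrable (by fun_prop) _ _) fun r hr => ?_
    refine mul_le_of_le_one_left (sq_nonneg _) (Real.exp_le_one_iff.2 ?_)
    linarith [hr.2]
  refine h2.trans ?_
  refine intervalIntegral.integral_mono_interval le_rfl h0 h1 (ae_of_all _ fun r => sq_nonneg _)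
    (Continuous.intervalIntegrable (by fun_prop) _ _)

theorem IsSublinear.integral_ou_sq_le (hs : IsSublinear w) (hw : Continuous w) (a : ℝ) :
    ∫ r in a..(a + 1), StochSync.ou w r ^ 2 ≤ 2 * StochSync.ou w a ^ 2 + 4 * meanSq w a := by
  have hc := hs.continuous_ou hw
  have h1 : ∫ r in a..(a + 1), StochSync.ou w r ^ 2 =
      ∫ r in (0 : ℝ)..1, StochSync.ou w (a + r) ^ 2 := by
    rw [intervalIntegral.integral_comp_add_left (fun r => StochSync.ou w r ^ 2), add_zero]
  have h2 : ∫ r in (0 : ℝ)..1, StochSync.ou w (a + r) ^ 2 ≤ ∫ r in (0 : ℝ)..1,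
      ((2 * StochSync.ou w a ^ 2 + 2 * meanSq w a) + 2 * (w (a + r) - w a) ^ 2) := by
    refine intervalIntegral.integral_mono_on zero_le_one
      (Continuous.intervalIntegrable (by fun_prop) _ _)
      (Continuous.intervalIntegrable (by fun_prop) _ _) fun r hr => ?_
    have h3 := hs.ou_sub_sq_le hw a hr.1 hr.2
    have h4 : Real.exp (-r) ≤ 1 := Real.exp_le_one_iff.2 (by linarith [hr.1])
    have h5 : Real.exp (-r) * StochSync.ou w a ^ 2 ≤ StochSync.ou w a ^ 2 :=
      mul_le_of_le_one_left (sq_nonneg _) h4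
    nlinarith [sq_nonneg (StochSync.ou w (a + r) - 2 * (w (a + r) - w a))]
  rw [h1]
  refine h2.trans (le_of_eq ?_)
  rw [intervalIntegral.integral_add (Continuous.intervalIntegrable (by fun_prop) _ _)
    (Continuous.intervalIntegrable (by fun_prop) _ _), intervalIntegral.integral_const_mul]
  simp only [intervalIntegral.integral_const, sub_zero, one_smul]
  rw [meanSq]; ring

/-- The random forcing of the recursion for the squares of the Ornstein-Uhlenbeck process. -/
def forcing (w : ℝ → ℝ) (a : ℝ) : ℝ := 4 / 3 * meanSq w a + 4 * (w (a + 1) - w a) ^ 2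

theorem forcing_nonneg (w : ℝ → ℝ) (a : ℝ) : 0 ≤ forcing w a := by
  have := meanSq_nonneg w a
  unfold forcing; positivity

theorem IsSublinear.ou_sq_succ_le (hs : IsSublinear w) (hw : Continuous w) (a : ℝ) :
    StochSync.ou w (a + 1) ^ 2 ≤ 1 / 2 * StochSync.ou w a ^ 2 + forcing w a := by
  have h := hs.ou_sub_sq_le hw a zero_le_one le_rfl
  -- Together with `(y + δ) ^ 2 ≤ 4 / 3 * y ^ 2 + 4 * δ ^ 2` this gives the factor `4 / 3 * 3 / 8 =
  -- 1 / 2`; the weights `4 / 3` and `4` are those in `forcing`.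
  have h1 : Real.exp (-1) ≤ 3 / 8 := by
    rw [Real.exp_neg]
    rw [inv_le_comm₀ (Real.exp_pos _) (by norm_num)]
    linarith [Real.exp_one_gt_d9]
  have h2 : Real.exp (-1) * StochSync.ou w a ^ 2 ≤ 3 / 8 * StochSync.ou w a ^ 2 := by gcongr
  unfold forcing
  set y := StochSync.ou w (a + 1) - (w (a + 1) - w a)
  set δ := w (a + 1) - w a
  have h3 : StochSync.ou w (a + 1) = y + δ := by simp [y, δ]
  rw [h3]
  nlinarith [sq_nonneg (y - 3 * δ)]

/-- The index counts backwards in time, so `a k` is bounded by an older value. Summing the recursion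
leaves the boundary term `a n`; iterating `n` further steps back replaces it by `a (n + n)` with the
weight `2 ^ (-n)`, which beats any polynomial growth. -/
theorem sum_le_of_recursion {a b : ℕ → ℝ} (ha : ∀ k, 0 ≤ a k) (hb : ∀ k, 0 ≤ b k)
    (h : ∀ k, a k ≤ 1 / 2 * a (k + 1) + b k) (n : ℕ) :
    ∑ k ∈ Finset.range n, a (k + 1) ≤
      2 * ((1 / 2) ^ n * a (n + n)) + 4 * ∑ k ∈ Finset.range (n + n), b k := by
  have h1 : ∀ i, a n ≤ (1 / 2) ^ i * a (n + i) + ∑ k ∈ Finset.range i, b (n + k) := by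
    intro i
    induction i with
    | zero => simp
    | succ i ih =>
      rw [Finset.sum_range_succ, pow_succ]
      have h2 := h (n + i)
      have h3 : ((1 : ℝ) / 2) ^ i ≤ 1 := pow_le_one₀ (by norm_num) (by norm_num)
      have h4 : ((1 : ℝ) / 2) ^ i * b (n + i) ≤ b (n + i) := mul_le_of_le_one_left (hb _) h3
      have h5 : (0 : ℝ) ≤ (1 / 2) ^ i := by positivity
      have h6 := mul_le_mul_of_nonneg_left h2 h5
      rw [add_assoc n i 1] at h6
      linarith
  have h2 : ∑ k ∈ Finset.range n, a (k + 1) = ∑ k ∈ Finset.range n, a k + a n - a 0 := by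
    rw [← Finset.sum_range_succ, Finset.sum_range_succ']; ring
  have h3 : ∑ k ∈ Finset.range n, a k ≤
      1 / 2 * ∑ k ∈ Finset.range n, a (k + 1) + ∑ k ∈ Finset.range n, b k := by
    rw [Finset.mul_sum, ← Finset.sum_add_distrib]
    exact Finset.sum_le_sum fun k _ => h k
  have h4 := h1 n
  have h5 : ∑ k ∈ Finset.range (n + n), b k =
      ∑ k ∈ Finset.range n, b k + ∑ k ∈ Finset.range n, b (n + k) := Finset.sum_range_add _ _ _
  have h6 : 0 ≤ ∑ k ∈ Finset.range n, b k := Finset.sum_nonneg fun k _ => hb k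
  have h7 : 0 ≤ ∑ k ∈ Finset.range n, b (n + k) := Finset.sum_nonneg fun k _ => hb _
  linarith [ha 0]

/-- If the forcing has averages at most `K`, then so has, up to a factor, the square of the
Ornstein-Uhlenbeck process. -/
theorem IsSublinear.eventually_integral_ou_sq_le (hs : IsSublinear w) (hw : Continuous w) {K : ℝ}
    (hK : ∀ᶠ n : ℕ in atTop, ∑ k ∈ Finset.range n, forcing w (-(k : ℝ) - 1) ≤ K * n) :
    ∀ᶠ n : ℕ in atTop, ∫ r in (-(n : ℝ))..0, StochSync.ou w r ^ 2 ≤ (19 * K + 1) * n := by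
  have hc := hs.continuous_ou hw
  obtain ⟨C, hC0, hC⟩ := (hs.ou hw).exists_bound hc one_pos 0
  have hlim : Tendsto (fun n : ℕ => 4 * ((1 / 2 : ℝ) ^ n * (C + 2 * n) ^ 2)) atTop (𝓝 0) := by
    have e0 : Tendsto (fun n : ℕ => (1 / 2 : ℝ) ^ n) atTop (𝓝 0) :=
      tendsto_pow_atTop_nhds_zero_of_lt_one (by norm_num) (by norm_num)
    have e1 := tendsto_pow_const_mul_const_pow_of_abs_lt_one 1 (r := (1 / 2 : ℝ))
      (by rw [abs_of_pos] <;> norm_num)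
    have e2 := tendsto_pow_const_mul_const_pow_of_abs_lt_one 2 (r := (1 / 2 : ℝ))
      (by rw [abs_of_pos] <;> norm_num)
    have := ((e0.const_mul (4 * C ^ 2)).add (e1.const_mul (16 * C))).add (e2.const_mul 16)
    simp only [mul_zero, add_zero] at this
    refine this.congr fun n => by ring
  filter_upwards [hK, (tendsto_id (x := (atTop : Filter ℕ)) |>.atTop_add_atTop tendsto_id).eventually hK,
    hlim.eventually (gt_mem_nhds one_pos), eventually_ge_atTop 1] with n h1 h2 h3 hn
  simp only [id] at h2
  set a : ℕ → ℝ := fun k => StochSync.ou w (-(k : ℝ)) ^ 2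
  set b : ℕ → ℝ := fun k => forcing w (-(k : ℝ) - 1)
  have hrec : ∀ k, a k ≤ 1 / 2 * a (k + 1) + b k := by
    intro k
    have := hs.ou_sq_succ_le hw (-(k : ℝ) - 1)
    simp only [sub_add_cancel] at this
    simp only [a, b]
    rwa [show -(((k + 1 : ℕ)) : ℝ) = -(k : ℝ) - 1 by push_cast; ring]
  have hsum := sum_le_of_recursion (fun k => sq_nonneg _) (fun k => forcing_nonneg _ _) hrec n
  have hint : ∫ r in (-(n : ℝ))..0, StochSync.ou w r ^ 2 =
      ∑ k ∈ Finset.range n, ∫ r in (-(k : ℝ) - 1)..(-(k : ℝ)), StochSync.ou w r ^ 2 := by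
    have := intervalIntegral.sum_integral_adjacent_intervals (μ := volume)
      (f := fun r => StochSync.ou w r ^ 2) (a := fun k : ℕ => -(k : ℝ)) (n := n)
      fun k _ => (hc.pow 2).intervalIntegrable _ _
    rw [intervalIntegral.integral_symm]
    simp only [Nat.cast_zero, neg_zero] at this
    rw [← this, ← Finset.sum_neg_distrib]
    refine Finset.sum_congr rfl fun k _ => ?_
    rw [← intervalIntegral.integral_symm]
    congr 1
    push_cast; ring
  -- The `3` arises from `4 * meanSq = 3 * (4 / 3 * meanSq)`. The forcing now counts `3 K n` here
  -- and `2 * 4 * K * (2 n) = 16 K n` in the sum of the squares, together `19 K n`; the boundary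
  -- term is below `1 ≤ n`.
  have hle : ∫ r in (-(n : ℝ))..0, StochSync.ou w r ^ 2 ≤
      2 * ∑ k ∈ Finset.range n, a (k + 1) + 3 * ∑ k ∈ Finset.range n, b k := by
    rw [hint, Finset.mul_sum, Finset.mul_sum, ← Finset.sum_add_distrib]
    refine Finset.sum_le_sum fun k _ => ?_
    have h4 := hs.integral_ou_sq_le hw (-(k : ℝ) - 1)
    rw [sub_add_cancel] at h4
    refine h4.trans ?_
    simp only [a, b, forcing]
    rw [show -(((k + 1 : ℕ)) : ℝ) = -(k : ℝ) - 1 by push_cast; ring]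
    nlinarith [sq_nonneg (w (-(k : ℝ) - 1 + 1) - w (-(k : ℝ) - 1))]
  have ha : a (n + n) ≤ (C + 2 * n) ^ 2 := by
    have h5 := hC (-((n + n : ℕ) : ℝ)) (by simp)
    have h6 : |(-((n + n : ℕ) : ℝ))| = 2 * n := by
      rw [abs_neg, abs_of_nonneg (by positivity)]; push_cast; ring
    rw [h6, one_mul] at h5
    simp only [a]
    rw [← sq_abs]
    gcongr
  have hp : (0 : ℝ) ≤ (1 / 2) ^ n := by positivity
  have hn' : (1 : ℝ) ≤ n := by exact_mod_cast hn
  have h7 : (1 / 2 : ℝ) ^ n * a (n + n) ≤ (1 / 2 : ℝ) ^ n * (C + 2 * n) ^ 2 := by gcongr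
  push_cast at h2
  nlinarith

end Path

end

section

variable {m d N : ℕ}

/-! ### The Borel σ-algebra of the path space -/

theorem measurable_path (t : ℝ) : Measurable fun ω : WienerSpace m => ω.path t := by
  have h : Continuous fun ω : WienerSpace m => ω.1 := continuous_subtype_val
  exact ((ContinuousEvalConst.continuous_eval_const t).comp h).measurable

theorem measurable_path_apply (t : ℝ) (i : Fin m) :
    Measurable fun ω : WienerSpace m => ω.path t i :=
  (measurable_pi_apply i).comp (measurable_path t)

theorem continuous_path_apply (ω : WienerSpace m) (i : Fin m) : Continuous fun t => ω.path t i :=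
  (continuous_apply i).comp ω.continuous_path

/-- A continuous path maps the compact `K` into the open `U` if and only if its distance to the
complement of `U` is bounded below on `K`, and by continuity a countable dense subset of `K`
suffices for the test. Subbasic sets of the compact-open topology thus become countable combinations
of coordinate events. -/
theorem measurableSet_mapsTo (K : Set ℝ) (U : Set (Fin m → ℝ)) (hK : IsCompact K)
    (hU : IsOpen U) :
    MeasurableSet[MeasurableSpace.comap (fun (ω : WienerSpace m) t => ω.path t) inferInstance]
      {ω : WienerSpace m | MapsTo ω.path K U} := by
  obtain ⟨D, hDK, hDc, hD⟩ := (TopologicalSpace.IsSeparable.of_separableSpace K).exists_countable_dense_subset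
  have key : {ω : WienerSpace m | MapsTo ω.path K U} =
      ⋃ n : ℕ, ⋂ t ∈ D, {ω : WienerSpace m |
        (1 : ℝ≥0∞) / (n + 1) ≤ Metric.infEDist (ω.path t) Uᶜ} := by
    ext ω
    simp only [mem_ofPred_eq, mem_iUnion, mem_iInter]
    constructor
    · intro hω
      rcases K.eq_empty_or_nonempty with rfl | hne
      · exact ⟨0, fun t ht => absurd (hDK ht) (notMem_empty _)⟩
      obtain ⟨t₀, ht₀, hmin⟩ := hK.exists_isMinOn hne
        ((Metric.continuous_infEDist (s := Uᶜ)).comp ω.continuous_path).continuousOn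
      have hpos : Metric.infEDist (ω.path t₀) Uᶜ ≠ 0 := by
        intro h0
        by_cases hU' : (Uᶜ).Nonempty
        · exact (Metric.mem_iff_infEDist_zero_of_closed hU.isClosed_compl).2 h0 (hω ht₀)
        · rw [not_nonempty_iff_eq_empty.1 hU', Metric.infEDist_empty] at h0
          exact ENNReal.top_ne_zero h0
      obtain ⟨n, hn⟩ := ENNReal.exists_inv_nat_lt hpos
      refine ⟨n, fun t ht => le_trans ?_ (hmin (hDK ht))⟩
      rw [one_div]
      exact (ENNReal.inv_le_inv.2 le_self_add).trans hn.le
    · rintro ⟨n, hn⟩ t ht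
      have hcl : IsClosed {t | (1 : ℝ≥0∞) / (n + 1) ≤ Metric.infEDist (ω.path t) Uᶜ} :=
        isClosed_le continuous_const (Metric.continuous_infEDist.comp ω.continuous_path)
      have h1 : (1 : ℝ≥0∞) / (n + 1) ≤ Metric.infEDist (ω.path t) Uᶜ :=
        hcl.closure_subset_iff.2 (fun s hs => hn s hs) (hD ht)
      by_contra h2
      rw [Metric.infEDist_zero_of_mem (show ω.path t ∈ Uᶜ from h2)] at h1
      exact absurd h1 (not_le.2 (ENNReal.div_pos one_ne_zero (by finiteness)))
  rw [key]
  refine MeasurableSet.iUnion fun n => MeasurableSet.biInter hDc fun t _ => ?_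
  let : MeasurableSpace (WienerSpace m) :=
    MeasurableSpace.comap (fun (ω : WienerSpace m) t => ω.path t) inferInstance
  have h1 : Measurable fun ω : WienerSpace m => ω.path t :=
    (measurable_pi_apply t).comp (comap_measurable fun (ω : WienerSpace m) t => ω.path t)
  exact measurableSet_le measurable_const (measurable_infEDist.comp h1)

/-- The Borel σ-algebra of the path space is generated by the coordinates. -/
theorem wienerSpace_eq_comap : (inferInstance : MeasurableSpace (WienerSpace m)) =
    MeasurableSpace.comap (fun (ω : WienerSpace m) t => ω.path t) inferInstance := by
  refine le_antisymm ?_ ?_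
  · have h1 : borel (WienerSpace m) =
        MeasurableSpace.comap (Subtype.val : WienerSpace m → C(ℝ, Fin m → ℝ)) (borel _) :=
      borel_comap
    change borel (WienerSpace m) ≤ _
    rw [h1, borel_eq_generateFrom_of_subbasis (ContinuousMap.compactOpen_eq),
      MeasurableSpace.comap_generateFrom]
    refine MeasurableSpace.generateFrom_le ?_
    rintro _ ⟨_, ⟨K, hK, U, hU, rfl⟩, rfl⟩
    exact measurableSet_mapsTo K U hK hU
  · rw [← measurable_iff_comap_le]
    exact measurable_pi_lambda _ measurable_path

theorem measurable_of_path {Ξ : Type*} [MeasurableSpace Ξ] {f : Ξ → WienerSpace m}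
    (hf : ∀ t, Measurable fun ξ => (f ξ).path t) : Measurable f := by
  have : Measurable[_, MeasurableSpace.comap (fun (ω : WienerSpace m) t => ω.path t) inferInstance]
      f := measurable_comap_iff.2 (measurable_pi_lambda _ hf)
  rwa [← wienerSpace_eq_comap] at this

theorem shift_path (s t : ℝ) (ω : WienerSpace m) : (shift s ω).path t = ω.path (t + s) - ω.path s :=
  rfl

theorem shift_path_apply (s t : ℝ) (ω : WienerSpace m) (i : Fin m) :
    (shift s ω).path t i = ω.path (t + s) i - ω.path s i := rfl

theorem measurable_shift (s : ℝ) : Measurable (shift s : WienerSpace m → WienerSpace m) :=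
  measurable_of_path fun t => (measurable_path (t + s)).sub (measurable_path s)

/-! ### Increments of Wiener processes and invariance of Wiener measure -/

/-- The increments of the `i`-th coordinate after time `s`. -/
def incr (i : Fin m) (s : ℝ) (t : ℝ≥0) (ω : WienerSpace m) : ℝ := ω.path (s + t) i - ω.path s i

theorem measurable_incr (i : Fin m) (s : ℝ) (t : ℝ≥0) : Measurable (incr i s t) :=
  (measurable_path_apply _ i).sub (measurable_path_apply _ i)

theorem continuous_incr (i : Fin m) (s : ℝ) (ω : WienerSpace m) :
    Continuous fun t => incr i s t ω :=
  ((continuous_path_apply ω i).comp (continuous_const.add NNReal.continuous_coe)).sub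
    continuous_const

variable {P : Measure (WienerSpace m)}

theorem IsWienerMeasure.isPreBrownianReal_incr (hP : IsWienerMeasure P) (i : Fin m) (s : ℝ) :
    IsPreBrownianReal (incr i s) P := by
  refine HasIndepIncrements.isPreBrownianReal_of_hasLaw (fun t => ?_) (fun n t ht => ?_)
  · have := (hP.wiener i).gaussian s (s + t) (by simp)
    rwa [add_sub_cancel_left, Real.toNNReal_coe] at this
  · have := (hP.wiener i).indep_increments n (fun k => s + t k) fun a b hab => by
      simpa using ht hab
    convert this using 3
    simp [incr]

theorem IsWienerMeasure.map_incr (hP : IsWienerMeasure P) (i : Fin m) (s s' : ℝ) :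
    P.map (fun ω t => incr i s t ω) = P.map (fun ω t => incr i s' t ω) := by
  have := hP.isProbabilityMeasure
  rw [map_eq_iff_forall_finset_map_restrict_eq
    (measurable_pi_lambda _ (measurable_incr i s)).aemeasurable
    (measurable_pi_lambda _ (measurable_incr i s')).aemeasurable]
  intro I
  rw [((hP.isPreBrownianReal_incr i s).hasLaw I).map_eq,
    ((hP.isPreBrownianReal_incr i s').hasLaw I).map_eq]

/-- Only finitely many times matter. With `r` at least as large as all their absolute values, the
values of the path are increments of the motion restarted at time `-r`, indexed by nonnegative
times. By `map_incr` the law of a restarted motion does not depend on its starting time. -/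
theorem IsWienerMeasure.map_shift_coord (hP : IsWienerMeasure P) (i : Fin m) (h : ℝ) :
    P.map (fun ω t => (shift h ω).path t i) = P.map (fun ω t => ω.path t i) := by
  have := hP.isProbabilityMeasure
  have hm : Measurable fun ω t => (shift h ω).path t i := measurable_pi_lambda _ fun t =>
    (measurable_path_apply t i).comp (measurable_shift h)
  rw [map_eq_iff_forall_finset_map_restrict_eq hm.aemeasurable
    (measurable_pi_lambda _ fun t => measurable_path_apply t i).aemeasurable]
  intro I
  set r : ℝ := ∑ t ∈ I, |t|
  have hr : 0 ≤ r := Finset.sum_nonneg fun t _ => abs_nonneg t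
  have hI : ∀ t ∈ I, 0 ≤ t + r := by
    intro t ht
    have : |t| ≤ r := Finset.single_le_sum (f := fun t => |t|) (fun t _ => abs_nonneg t) ht
    linarith [neg_abs_le t]
  let Φ : (ℝ≥0 → ℝ) → (I → ℝ) := fun x t => x (t + r).toNNReal - x r.toNNReal
  have hΦ : Measurable Φ := measurable_pi_lambda _ fun t =>
    (measurable_pi_apply _).sub (measurable_pi_apply _)
  have h1 : (fun ω => I.restrict fun t => (shift h ω).path t i) =
      Φ ∘ fun ω t => incr i (h - r) t ω := by
    funext ω t
    simp only [Finset.restrict, Φ, Function.comp, incr, Real.coe_toNNReal _ hr,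
      Real.coe_toNNReal _ (hI t t.2), shift_path_apply]
    rw [show h - r + (t + r) = t + h by ring, show h - r + r = h by ring]
    ring
  have h2 : (fun ω : WienerSpace m => I.restrict fun t => ω.path t i) =
      Φ ∘ fun ω t => incr i (0 - r) t ω := by
    funext ω t
    have h0 : ω.path 0 i = 0 := congrFun ω.2 i
    simp only [Finset.restrict, Φ, Function.comp, incr, Real.coe_toNNReal _ hr,
      Real.coe_toNNReal _ (hI t t.2)]
    rw [show 0 - r + (t + r) = t by ring, show 0 - r + r = 0 by ring, h0]
    ring
  rw [h1, h2, ← Measure.map_map hΦ (measurable_pi_lambda _ (measurable_incr i _)),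
    ← Measure.map_map hΦ (measurable_pi_lambda _ (measurable_incr i _)), hP.map_incr i]

/-- The shift preserves Wiener measure. -/
theorem IsWienerMeasure.measurePreserving_shift (hP : IsWienerMeasure P) (h : ℝ) :
    MeasurePreserving (shift h) P P := by
  have := hP.isProbabilityMeasure
  refine ⟨measurable_shift h, ?_⟩
  let Θ : WienerSpace m → Fin m → ℝ → ℝ := fun ω i t => ω.path t i
  have hΘ : Measurable Θ := measurable_pi_lambda _ fun i => measurable_pi_lambda _ fun t =>
    measurable_path_apply t i
  -- By independence the law of the path is the product of the laws of its coordinates, and the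
  -- shift acts on each coordinate separately.
  have hlaw : (P.map (shift h)).map Θ = P.map Θ := by
    rw [Measure.map_map hΘ (measurable_shift h)]
    have e1 := (iIndepFun_iff_map_fun_eq_pi_map (μ := P) (f := fun (i : Fin m) ω t => ω.path t i)
      fun i => (measurable_pi_lambda _ fun t => measurable_path_apply t i).aemeasurable).1 hP.indep
    let Φ : (ℝ → ℝ) → (ℝ → ℝ) := fun x t => x (t + h) - x h
    have hΦ : Measurable Φ := measurable_pi_lambda _ fun t =>
      (measurable_pi_apply _).sub (measurable_pi_apply _)
    have e2 := (iIndepFun_iff_map_fun_eq_pi_map (μ := P)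
      (f := fun (i : Fin m) ω t => (shift h ω).path t i)
      fun i => (measurable_pi_lambda _ fun t =>
        (measurable_path_apply t i).comp (measurable_shift h)).aemeasurable).1
      (hP.indep.comp (fun _ => Φ) fun _ => hΦ)
    change P.map (fun ω i t => (shift h ω).path t i) = P.map (fun ω i t => ω.path t i)
    rw [e1, e2]
    congr 1
    funext i
    exact hP.map_shift_coord i h
  ext A hA
  obtain ⟨B, hB, rfl⟩ : MeasurableSet[MeasurableSpace.comap
      (fun (ω : WienerSpace m) t => ω.path t) inferInstance] A := by
    rwa [← wienerSpace_eq_comap]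
  have hswap : Measurable fun (x : Fin m → ℝ → ℝ) (t : ℝ) (i : Fin m) => x i t :=
    measurable_pi_lambda _ fun t => measurable_pi_lambda _ fun i =>
      (measurable_pi_apply t).comp (measurable_pi_apply i)
  have h2 : (fun (ω : WienerSpace m) t => ω.path t) ⁻¹' B =
      Θ ⁻¹' ((fun (x : Fin m → ℝ → ℝ) (t : ℝ) (i : Fin m) => x i t) ⁻¹' B) := rfl
  rw [h2, ← Measure.map_apply hΘ (hswap hB), ← Measure.map_apply hΘ (hswap hB), hlaw]

end

section

variable {m d N : ℕ}

/-! ### A maximal inequality for Brownian motion -/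

section Maximal

variable {Ω : Type*} {mΩ : MeasurableSpace Ω} {P : Measure Ω} {B : ℝ≥0 → Ω → ℝ}

theorem memLp_two_of_isPreBrownianReal (hB : IsPreBrownianReal B P) (t : ℝ≥0) :
    MemLp (B t) 2 P := (hB.isGaussianProcess.hasGaussianLaw_eval t).memLp_two

theorem integral_sq_of_isPreBrownianReal (hB : IsPreBrownianReal B P) (t : ℝ≥0) :
    ∫ ω, B t ω ^ 2 ∂P = t := by
  have hP := hB.isGaussianProcess.isProbabilityMeasure
  have h1 := (hB.hasLaw_eval t).variance_eq
  rw [variance_id_gaussianReal, variance_of_integral_eq_zero (hB.aemeasurable t)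
    (hB.integral_eval t)] at h1
  exact h1

/-- The filtration of the past of `B`, sampled at the times `h k`. -/
def gridFiltration (hm : ∀ t, Measurable (B t)) (h : ℝ≥0) : Filtration ℕ mΩ where
  seq k := MeasurableSpace.comap (fun ω (t : Iic (k * h)) => B t ω) inferInstance
  mono' k l hkl := by
    let r : (Iic (l * h) → ℝ) → (Iic (k * h) → ℝ) := fun x t =>
      x ⟨t, t.2.trans (mul_le_mul_left (by exact_mod_cast hkl) h)⟩
    have hr : Measurable r := measurable_pi_lambda _ fun t => measurable_pi_apply _
    have h1 : (fun ω (t : Iic (k * h)) => B t ω) = r ∘ fun ω (t : Iic (l * h)) => B t ω := rfl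
    dsimp only
    rw [h1, ← MeasurableSpace.comap_comp]
    exact MeasurableSpace.comap_mono hr.comap_le
  le' k := (measurable_pi_lambda _ fun t => hm _).comap_le

/-- With `ξ = B_{s+h} - B_s` one has `B_{s+h} ^ 2 ≥ B_s ^ 2 + 2 ξ B_s`. The centred `ξ` is
independent of the past, so the cross term integrates to zero over every past event. -/
theorem submartingale_sq (hB : IsPreBrownianReal B P) (hm : ∀ t, Measurable (B t)) (h : ℝ≥0) :
    Submartingale (fun (k : ℕ) ω => B (k * h) ω ^ 2) (gridFiltration hm h) P := by
  have hP := hB.isGaussianProcess.isProbabilityMeasure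
  have hint : ∀ t, Integrable (fun ω => B t ω ^ 2) P := fun t =>
    (memLp_two_of_isPreBrownianReal hB t).integrable_sq
  refine submartingale_of_setIntegral_le_succ (fun k => ?_) (fun k => hint _) fun k A hA => ?_
  · have h1 : Measurable[gridFiltration hm h k] (B (k * h)) :=
      (measurable_pi_apply (⟨k * h, le_refl (k * h)⟩ : Iic (k * h))).comp
        (comap_measurable fun ω (t : Iic (k * h)) => B t ω)
    exact (h1.pow_const 2).stronglyMeasurable
  set s := (k : ℝ≥0) * h
  have hs : ((k + 1 : ℕ) : ℝ≥0) * h = s + h := by push_cast; simp only [s]; ring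
  rw [hs]
  have hA' : MeasurableSet A := (gridFiltration hm h).le k _ hA
  obtain ⟨A', hA'm, rfl⟩ := hA
  have hind := hB.indepFun_shift s
  set ξ : Ω → ℝ := fun ω => B (s + h) ω - B s ω
  set Z : Ω → ℝ := ((fun ω (t : Iic s) => B t ω) ⁻¹' A').indicator (B s)
  have hZξ : IndepFun ξ Z P := by
    have hφ : Measurable fun x : ℝ≥0 → ℝ => x h := measurable_pi_apply h
    have hψ : Measurable (A'.indicator fun x : Iic s → ℝ => x ⟨s, le_refl s⟩) :=
      (measurable_pi_apply _).indicator hA'm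
    exact hind.comp hφ hψ
  have hBs := memLp_two_of_isPreBrownianReal hB s
  have hξ2 : MemLp ξ 2 P := (memLp_two_of_isPreBrownianReal hB (s + h)).sub hBs
  have hZ2 : MemLp Z 2 P := hBs.indicator hA'
  have hξ0 : ∫ ω, ξ ω ∂P = 0 := by
    simp only [ξ]
    rw [integral_sub (hB.integrable_eval _) (hB.integrable_eval _), hB.integral_eval,
      hB.integral_eval, sub_zero]
  have hprod : ∫ ω, ξ ω * Z ω ∂P = 0 := by
    have := hZξ.integral_fun_mul_eq_mul_integral hξ2.aestronglyMeasurable hZ2.aestronglyMeasurable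
    rw [this, hξ0, zero_mul]
  have hcross : ∫ ω in (fun ω (t : Iic s) => B t ω) ⁻¹' A', ξ ω * B s ω ∂P = 0 := by
    rw [← hprod, ← integral_indicator hA']
    congr 1
    funext ω
    simp only [Z, indicator]
    split_ifs <;> simp
  have hci : Integrable (fun ω => ξ ω * B s ω) P := hξ2.integrable_mul hBs
  have h1 : ∫ ω in (fun ω (t : Iic s) => B t ω) ⁻¹' A', (B s ω ^ 2 + 2 * (ξ ω * B s ω)) ∂P ≤
      ∫ ω in (fun ω (t : Iic s) => B t ω) ⁻¹' A', B (s + h) ω ^ 2 ∂P := by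
    refine integral_mono (((hint s).add (hci.const_mul 2)).integrableOn) (hint _).integrableOn
      fun ω => ?_
    simp only [ξ]
    nlinarith [sq_nonneg (B (s + h) ω - B s ω)]
  rw [integral_add (hint s).integrableOn (hci.const_mul 2).integrableOn, integral_const_mul, hcross,
    mul_zero, add_zero] at h1
  exact h1

theorem measure_grid_le (hB : IsPreBrownianReal B P) (hm : ∀ t, Measurable (B t)) (T : ℝ≥0)
    (p : ℕ) {lam : ℝ≥0} (hlam : 0 < lam) :
    P {ω | ∃ k ≤ 2 ^ p, (lam : ℝ) ≤ |B ((k : ℕ) * (T / 2 ^ p)) ω|} ≤ T / lam ^ 2 := by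
  have hP := hB.isGaussianProcess.isProbabilityMeasure
  have h := maximal_ineq (submartingale_sq hB hm (T / 2 ^ p)) (fun k ω => sq_nonneg _)
    (ε := lam ^ 2) (2 ^ p)
  have hint : Integrable (fun ω => B T ω ^ 2) P := (memLp_two_of_isPreBrownianReal hB T).integrable_sq
  have hT : ((2 ^ p : ℕ) : ℝ≥0) * (T / 2 ^ p) = T := by push_cast; field_simp
  rw [hT] at h
  have h2 : ENNReal.ofReal (∫ ω in {ω | ((lam ^ 2 : ℝ≥0) : ℝ) ≤
      (Finset.range (2 ^ p + 1)).sup' Finset.nonempty_range_add_one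
        fun k => B ((k : ℕ) * (T / 2 ^ p)) ω ^ 2}, B T ω ^ 2 ∂P) ≤ T := by
    refine (ENNReal.ofReal_le_ofReal
      (setIntegral_le_integral hint (ae_of_all _ fun ω => sq_nonneg _))).trans ?_
    rw [integral_sq_of_isPreBrownianReal hB, ENNReal.ofReal_coe_nnreal]
  have h3 := h.trans h2
  rw [ENNReal.le_div_iff_mul_le (Or.inl (by simp [hlam.ne'])) (Or.inl (by finiteness)), mul_comm]
  refine le_trans ?_ (h3.trans le_rfl)
  rw [ENNReal.coe_pow]
  gcongr
  rintro ⟨k, hk, hle⟩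
  simp only [NNReal.coe_pow]
  refine le_trans ?_ (Finset.le_sup' (fun k => B ((k : ℕ) * (T / 2 ^ p)) ω ^ 2)
    (Finset.mem_range_succ_iff.2 hk))
  rw [← sq_abs (B _ _)]
  gcongr

/-- Kolmogorov's inequality for Brownian motion. -/
theorem measure_sup_le (hB : IsPreBrownianReal B P) (hm : ∀ t, Measurable (B t))
    (hc : ∀ ω, Continuous fun t => B t ω) (T : ℝ≥0) {lam : ℝ≥0} (hlam : 0 < lam) :
    P {ω | ∃ t ≤ T, (lam : ℝ) < |B t ω|} ≤ T / lam ^ 2 := by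
  -- Dyadic grids are nested, so the bound of `measure_grid_le` passes to the union. The strict
  -- inequality in the statement lets a nearby grid point still exceed the level.
  set E : ℕ → Set Ω := fun p => {ω | ∃ k ≤ 2 ^ p, (lam : ℝ) ≤ |B ((k : ℕ) * (T / 2 ^ p)) ω|}
  have hmono : Monotone E := by
    refine monotone_nat_of_le_succ fun p ω => ?_
    rintro ⟨k, hk, hle⟩
    refine ⟨2 * k, by rw [pow_succ]; omega, ?_⟩
    have : ((2 * k : ℕ) : ℝ≥0) * (T / 2 ^ (p + 1)) = k * (T / 2 ^ p) := by
      push_cast; rw [pow_succ]; field_simp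
    rwa [this]
  have hsub : {ω | ∃ t ≤ T, (lam : ℝ) < |B t ω|} ⊆ ⋃ p, E p := by
    rintro ω ⟨t, ht, hlt⟩
    rw [mem_iUnion]
    -- dyadic approximations of `t`
    rcases eq_or_ne T 0 with rfl | hT
    · obtain rfl : t = 0 := le_antisymm ht zero_le
      exact ⟨0, 0, by simp, by simpa using hlt.le⟩
    have hTpos : (0 : ℝ≥0) < T := pos_iff_ne_zero.2 hT
    have hlim : Tendsto (fun p : ℕ => ((⌊((t / T : ℝ≥0) : ℝ) * 2 ^ p⌋₊ : ℕ) : ℝ≥0) * (T / 2 ^ p))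
        atTop (𝓝 t) := by
      have h1 : Tendsto (fun p : ℕ => ((2 : ℝ) ^ p)) atTop atTop :=
        tendsto_pow_atTop_atTop_of_one_lt (by norm_num)
      have h2 := ((tendsto_nat_floor_mul_div_atTop (R := ℝ) (t / T : ℝ≥0).coe_nonneg).comp
        h1).mul_const (T : ℝ)
      rw [← NNReal.coe_mul, div_mul_cancel₀ _ hT] at h2
      rw [← NNReal.tendsto_coe]
      refine h2.congr fun p => ?_
      simp only [Function.comp]
      push_cast
      ring
    have h3 := (((hc ω).tendsto t).comp hlim).abs
    obtain ⟨p, hp⟩ := (h3.eventually (lt_mem_nhds hlt)).exists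
    refine ⟨p, ⌊((t / T : ℝ≥0) : ℝ) * 2 ^ p⌋₊, ?_, hp.le⟩
    refine Nat.floor_le_of_le ?_
    push_cast
    exact mul_le_of_le_one_left (by positivity) (div_le_one_of_le₀ (by exact_mod_cast ht) T.2)
  refine (measure_mono hsub).trans ?_
  rw [hmono.measure_iUnion]
  exact iSup_le fun p => measure_grid_le hB hm T p hlam

end Maximal

variable {P : Measure (WienerSpace m)}

/-- The motion is restarted at `-T`. As the path vanishes at `0`, its value at `t` is a difference
of two increments from `-T`, one ending at `t` and one at `0`; hence the factor `2`. -/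
theorem IsWienerMeasure.measure_sup_path_le (hP : IsWienerMeasure P) (i : Fin m) {T lam : ℝ}
    (hT : 0 < T) (hlam : 0 < lam) :
    P {ω | ∃ t, -T ≤ t ∧ t ≤ 0 ∧ 2 * lam < |ω.path t i|} ≤ ENNReal.ofReal (T / lam ^ 2) := by
  have h := measure_sup_le (hP.isPreBrownianReal_incr i (-T)) (measurable_incr i (-T))
    (continuous_incr i (-T)) T.toNNReal (lam := lam.toNNReal) (by simpa using hlam)
  have h2 : ((T.toNNReal : ℝ≥0) : ℝ≥0∞) / (lam.toNNReal : ℝ≥0∞) ^ 2 = ENNReal.ofReal (T / lam ^ 2) := by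
    rw [ENNReal.ofReal_div_of_pos (by positivity), ENNReal.ofReal_pow hlam.le]
    rfl
  rw [h2] at h
  refine (measure_mono ?_).trans h
  rintro ω ⟨t, ht1, ht2, hlt⟩
  rw [mem_ofPred_eq, Real.coe_toNNReal _ hlam.le]
  by_contra! hcon
  have h0 : ω.path 0 i = 0 := congrFun ω.2 i
  have e1 := hcon (t + T).toNNReal (Real.toNNReal_le_toNNReal (by linarith))
  have e2 := hcon T.toNNReal le_rfl
  rw [incr, Real.coe_toNNReal _ (by linarith), show -T + (t + T) = t by ring] at e1
  rw [incr, Real.coe_toNNReal _ hT.le, neg_add_cancel, h0] at e2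
  have e3 := abs_sub_abs_le_abs_sub (ω.path t i) (ω.path (-T) i)
  rw [zero_sub, abs_neg] at e2
  linarith

/-- Almost all Wiener paths grow slower than linearly. -/
theorem IsWienerMeasure.ae_isSublinear (hP : IsWienerMeasure P) :
    ∀ᵐ ω ∂P, ∀ i, IsSublinear fun t => ω.path t i := by
  -- Borel-Cantelli along dyadic horizons: exceeding a level proportional to `2 ^ n` on `[-2 ^ n,
  -- 0]` has probability of order `2 ^ (-n)`. The level equals `2 ^ n / (2 (q + 1))`, because
  -- passing from `|t|` to the next power of two may double it while the slope has to stay at `1 /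
  -- (q + 1)`.
  have key : ∀ (i : Fin m) (q : ℕ), ∀ᵐ ω ∂P, ∀ᶠ n : ℕ in atTop,
      ω ∉ {ω : WienerSpace m | ∃ t, -(2 : ℝ) ^ n ≤ t ∧ t ≤ 0 ∧
        2 * (2 ^ n / (4 * ((q : ℝ) + 1))) < |ω.path t i|} := by
    intro i q
    refine ae_eventually_notMem ?_
    have h1 : ∀ n : ℕ, P {ω : WienerSpace m | ∃ t, -(2 : ℝ) ^ n ≤ t ∧ t ≤ 0 ∧
        2 * (2 ^ n / (4 * ((q : ℝ) + 1))) < |ω.path t i|} ≤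
        ENNReal.ofReal (16 * ((q : ℝ) + 1) ^ 2 * (1 / 2) ^ n) := by
      intro n
      refine (hP.measure_sup_path_le i (by positivity) (by positivity)).trans ?_
      refine ENNReal.ofReal_le_ofReal (le_of_eq ?_)
      rw [div_pow, one_div_pow]
      field_simp
      norm_num
    refine ((ENNReal.tsum_le_tsum h1).trans_lt ?_).ne
    rw [← ENNReal.ofReal_tsum_of_nonneg (fun n => by positivity)
      ((summable_geometric_of_lt_one (by norm_num) (by norm_num)).mul_left _)]
    exact ENNReal.ofReal_lt_top
  filter_upwards [ae_all_iff.2 fun i => ae_all_iff.2 fun q => key i q] with ω hω i ε hε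
  obtain ⟨q, hq⟩ := exists_nat_one_div_lt hε
  obtain ⟨n₀, hn₀⟩ := eventually_atTop.1 (hω i q)
  refine ⟨2 ^ n₀, fun t ht => ?_⟩
  have habs : |t| = -t := abs_of_nonpos ht
  -- the dyadic block containing `t`
  have hex : ∃ n, n₀ ≤ n ∧ -(2 : ℝ) ^ n ≤ t ∧ (2 : ℝ) ^ n ≤ 2 * |t| + 2 ^ n₀ := by
    by_cases hsmall : |t| ≤ 2 ^ n₀
    · exact ⟨n₀, le_rfl, by linarith, by linarith [abs_nonneg t]⟩
    · push Not at hsmall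
      have hone : (1 : ℝ) ≤ |t| := (one_le_pow₀ (by norm_num)).trans hsmall.le
      obtain ⟨n, hn1, hn2⟩ := exists_nat_pow_near hone (by norm_num : (1 : ℝ) < 2)
      refine ⟨n + 1, ?_, by linarith, ?_⟩
      · by_contra hlt
        have : (2 : ℝ) ^ (n + 1) ≤ 2 ^ n₀ := pow_le_pow_right₀ (by norm_num) (by omega)
        linarith
      · rw [pow_succ]
        have : (0 : ℝ) < 2 ^ n₀ := by positivity
        linarith
  obtain ⟨n, hn1, hn2, hn3⟩ := hex
  have h1 := hn₀ n hn1
  simp only [not_exists, not_and, not_lt] at h1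
  refine (h1 t hn2 ht).trans ?_
  have h2 : 2 * ((2 : ℝ) ^ n / (4 * ((q : ℝ) + 1))) = 2 ^ n * (1 / ((q : ℝ) + 1)) / 2 := by
    field_simp; norm_num
  rw [h2]
  have h3 : (1 : ℝ) / (q + 1) ≤ 1 := by
    rw [div_le_one (by positivity)]; linarith [(Nat.cast_nonneg q : (0 : ℝ) ≤ q)]
  have h4 : (0 : ℝ) < 1 / (q + 1) := by positivity
  have h5 : (0 : ℝ) < 2 ^ n₀ := by positivity
  have h6 : (2 : ℝ) ^ n * (1 / ((q : ℝ) + 1)) ≤ (2 * |t| + 2 ^ n₀) * (1 / ((q : ℝ) + 1)) := by gcongr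
  nlinarith [abs_nonneg t]

/-! ### The law of large numbers for the forcing -/

/-- Localises the forcing to the window `[a, a + 1]`, which is what independence over disjoint
windows requires. Times are clipped to `[0, 1]` in the proof because only those coordinates belong
to the σ-algebra. -/
theorem measurable_comap_meanSq (i : Fin m) (a : ℝ) :
    Measurable[MeasurableSpace.comap (fun ω (t : Iic (1 : ℝ≥0)) => incr i a t ω) inferInstance]
      fun ω : WienerSpace m => forcing (fun t => ω.path t i) a := by
  let : MeasurableSpace (WienerSpace m) :=
    MeasurableSpace.comap (fun ω (t : Iic (1 : ℝ≥0)) => incr i a t ω) inferInstance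
  have h0 : ∀ t : Iic (1 : ℝ≥0), Measurable (incr i a t) := fun t =>
    (measurable_pi_apply t).comp (comap_measurable fun ω (t : Iic (1 : ℝ≥0)) => incr i a t ω)
  have hclip : ∀ r : ℝ, min r.toNNReal 1 ∈ Iic (1 : ℝ≥0) := fun r =>
    mem_Iic.2 (min_le_right _ _)
  have h1 : Measurable fun p : WienerSpace m × ℝ => incr i a (min p.2.toNNReal 1) p.1 := by
    have := measurable_uncurry_of_continuous_of_measurable
      (u := fun (r : ℝ) (ω : WienerSpace m) => incr i a (min r.toNNReal 1) ω)
      (fun ω => (continuous_incr i a ω).comp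
        (continuous_real_toNNReal.min continuous_const))
      (fun r => h0 ⟨_, hclip r⟩)
    exact this.comp measurable_swap
  have h2 : (fun ω : WienerSpace m => meanSq (fun t => ω.path t i) a) =
      fun ω => ∫ r in (0 : ℝ)..1, incr i a (min r.toNNReal 1) ω ^ 2 := by
    funext ω
    rw [meanSq]
    refine intervalIntegral.integral_congr fun r hr => ?_
    rw [uIcc_of_le zero_le_one] at hr
    have : min r.toNNReal 1 = r.toNNReal := min_eq_left (by
      rw [← Real.toNNReal_one]; exact Real.toNNReal_le_toNNReal hr.2)
    simp only [this, incr, Real.coe_toNNReal _ hr.1]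
  have h3 : Measurable fun ω : WienerSpace m => meanSq (fun t => ω.path t i) a := by
    rw [h2]
    exact measurable_intervalIntegral (F := fun (ω : WienerSpace m) r =>
      incr i a (min r.toNNReal 1) ω ^ 2) (h1.pow_const 2) measurable_const measurable_const
  have h4 : Measurable fun ω : WienerSpace m => ω.path (a + 1) i - ω.path a i := by
    exact h0 ⟨1, mem_Iic.2 le_rfl⟩
  exact (h3.const_mul _).add ((h4.pow_const 2).const_mul _)

theorem measurable_forcing (i : Fin m) (a : ℝ) :
    Measurable fun ω : WienerSpace m => forcing (fun t => ω.path t i) a :=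
  (measurable_comap_meanSq i a).mono
    (measurable_pi_lambda _ fun t : Iic (1 : ℝ≥0) => measurable_incr i a t).comap_le le_rfl

theorem forcing_shift (ω : WienerSpace m) (i : Fin m) (s a : ℝ) :
    forcing (fun t => (shift s ω).path t i) a = forcing (fun t => ω.path t i) (a + s) := by
  simp only [forcing, meanSq, shift_path_apply, sub_sub_sub_cancel_right]
  have h1 : ∀ r : ℝ, a + r + s = a + s + r := fun r => by ring
  simp only [h1]

theorem IsWienerMeasure.integrable_forcing (hP : IsWienerMeasure P) (i : Fin m) (a : ℝ) :
    Integrable (fun ω : WienerSpace m => forcing (fun t => ω.path t i) a) P := by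
  have := hP.isProbabilityMeasure
  have hB := hP.isPreBrownianReal_incr i a
  have h1 : Integrable (fun ω : WienerSpace m => 4 * (ω.path (a + 1) i - ω.path a i) ^ 2) P := by
    have := (memLp_two_of_isPreBrownianReal hB 1).integrable_sq.const_mul 4
    simpa [incr] using this
  have hmeas : Measurable fun p : WienerSpace m × ℝ => incr i a p.2.toNNReal p.1 ^ 2 := by
    have := measurable_uncurry_of_continuous_of_measurable
      (u := fun (r : ℝ) (ω : WienerSpace m) => incr i a r.toNNReal ω)
      (fun ω => (continuous_incr i a ω).comp continuous_real_toNNReal)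
      (fun r => measurable_incr i a _)
    exact (this.comp measurable_swap).pow_const 2
  have h2 : Integrable (fun p : WienerSpace m × ℝ => incr i a p.2.toNNReal p.1 ^ 2)
      (P.prod (volume.restrict (Ioc 0 1))) := by
    rw [integrable_prod_iff' hmeas.aestronglyMeasurable]
    have hsq : ∀ r : ℝ, Integrable (fun ω => incr i a r.toNNReal ω ^ 2) P := fun r =>
      (memLp_two_of_isPreBrownianReal hB r.toNNReal).integrable_sq
    refine ⟨ae_of_all _ hsq, ?_⟩
    have h3 : ∀ r : ℝ, ∫ ω, ‖incr i a r.toNNReal ω ^ 2‖ ∂P = r.toNNReal := by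
      intro r
      rw [← integral_sq_of_isPreBrownianReal hB]
      refine integral_congr_ae (ae_of_all _ fun ω => ?_)
      simp
    simp only [h3]
    have h4 : Continuous fun r : ℝ => (r.toNNReal : ℝ) := by fun_prop
    exact h4.integrableOn_Ioc
  have h5 := h2.integral_prod_left
  have h6 : Integrable (fun ω : WienerSpace m => meanSq (fun t => ω.path t i) a) P := by
    refine h5.congr (ae_of_all _ fun ω => ?_)
    simp only [meanSq]
    rw [intervalIntegral.integral_of_le zero_le_one]
    refine setIntegral_congr_fun measurableSet_Ioc fun r hr => ?_
    simp only [incr, Real.coe_toNNReal _ hr.1.le]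
  exact (h6.const_mul _).add h1

/-- Seen from the starting time `-l - 1`, the window belonging to `l` lies within the first `l - k`
units of time and the one belonging to `k` begins exactly afterwards, at `-k - 1`. Independence is
then that of later increments from the past. -/
theorem IsWienerMeasure.indepFun_forcing (hP : IsWienerMeasure P) (i : Fin m) {k l : ℕ}
    (hkl : k < l) :
    IndepFun (fun ω : WienerSpace m => forcing (fun t => ω.path t i) (-(k : ℝ) - 1))
      (fun ω : WienerSpace m => forcing (fun t => ω.path t i) (-(l : ℝ) - 1)) P := by
  have h := (hP.isPreBrownianReal_incr i (-(l : ℝ) - 1)).indepFun_shift ((l - k : ℕ) : ℝ≥0)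
  have hsub : (((l - k : ℕ) : ℝ≥0) : ℝ) = (l : ℝ) - k := by
    rw [NNReal.coe_natCast, Nat.cast_sub hkl.le]
  rw [IndepFun_iff_Indep] at h ⊢
  refine indep_of_indep_of_le_left (indep_of_indep_of_le_right h ?_) ?_
  · refine (measurable_comap_meanSq i (-(l : ℝ) - 1)).comap_le.trans ?_
    have hone : (1 : ℝ≥0) ≤ ((l - k : ℕ) : ℝ≥0) := by
      exact_mod_cast (by omega : 1 ≤ l - k)
    let r : (Iic ((l - k : ℕ) : ℝ≥0) → ℝ) → (Iic (1 : ℝ≥0) → ℝ) := fun x t =>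
      x ⟨t, le_trans t.2 hone⟩
    have hr : Measurable r := measurable_pi_lambda _ fun t => measurable_pi_apply _
    have h1 : (fun ω (t : Iic (1 : ℝ≥0)) => incr i (-(l : ℝ) - 1) t ω) =
      r ∘ fun ω (t : Iic ((l - k : ℕ) : ℝ≥0)) => incr i (-(l : ℝ) - 1) t ω := rfl
    rw [h1, ← MeasurableSpace.comap_comp]
    exact MeasurableSpace.comap_mono hr.comap_le
  · refine (measurable_comap_meanSq i (-(k : ℝ) - 1)).comap_le.trans ?_
    let r : (ℝ≥0 → ℝ) → (Iic (1 : ℝ≥0) → ℝ) := fun x t => x t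
    have hr : Measurable r := measurable_pi_lambda _ fun t => measurable_pi_apply _
    have h1 : (fun ω (t : Iic (1 : ℝ≥0)) => incr i (-(k : ℝ) - 1) t ω) =
      r ∘ fun ω (t : ℝ≥0) => incr i (-(l : ℝ) - 1) (((l - k : ℕ) : ℝ≥0) + t) ω -
        incr i (-(l : ℝ) - 1) ((l - k : ℕ) : ℝ≥0) ω := by
      funext ω t
      simp only [r, Function.comp, incr, NNReal.coe_add, hsub, sub_sub_sub_cancel_right]
      rw [show -(l : ℝ) - 1 + ((l : ℝ) - k + t) = -(k : ℝ) - 1 + t by ring,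
        show -(l : ℝ) - 1 + ((l : ℝ) - k) = -(k : ℝ) - 1 by ring]
    rw [h1, ← MeasurableSpace.comap_comp]
    exact MeasurableSpace.comap_mono hr.comap_le

/-- Strong law of large numbers: the terms are pairwise independent, and identically distributed
because they are shifts of one another. Any `K` above the mean works. -/
theorem IsWienerMeasure.ae_sum_forcing_le (hP : IsWienerMeasure P) (i : Fin m) :
    ∃ K : ℝ, 0 ≤ K ∧ ∀ᵐ ω ∂P, ∀ᶠ n : ℕ in atTop,
      ∑ k ∈ Finset.range n, forcing (fun t => ω.path t i) (-(k : ℝ) - 1) ≤ K * n := by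
  set X : ℕ → WienerSpace m → ℝ := fun k ω => forcing (fun t => ω.path t i) (-(k : ℝ) - 1)
  refine ⟨∫ ω, X 0 ω ∂P + 1,
    add_nonneg (integral_nonneg fun ω => forcing_nonneg _ _) zero_le_one, ?_⟩
  have hident : ∀ k, IdentDistrib (X k) (X 0) P P := by
    intro k
    have h1 : X k = X 0 ∘ shift (-(k : ℝ)) := by
      funext ω
      simp only [X, Function.comp]
      rw [forcing_shift]
      congr 1
      push_cast; ring
    refine ⟨(measurable_forcing i _).aemeasurable, (measurable_forcing i _).aemeasurable, ?_⟩
    rw [h1, ← Measure.map_map (measurable_forcing i _) (measurable_shift _),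
      (hP.measurePreserving_shift _).map_eq]
  have hpair : Pairwise (Function.onFun (fun f g => IndepFun f g P) X) := by
    intro k l hkl
    rcases lt_or_gt_of_ne hkl with h | h
    · exact hP.indepFun_forcing i h
    · exact (hP.indepFun_forcing i h).symm
  filter_upwards [strong_law_ae_real X (hP.integrable_forcing i _) hpair hident] with ω hω
  filter_upwards [hω.eventually (gt_mem_nhds (lt_add_one _)), eventually_gt_atTop 0] with n hn hn0
  have : (0 : ℝ) < n := by exact_mod_cast hn0
  rw [div_lt_iff₀ this] at hn
  exact hn.le

/-! ### The invariant set of good paths -/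

/-- The paths that grow slower than linearly at `-∞` and whose Ornstein-Uhlenbeck processes have
mean squares at most `K` over the past. -/
def goodSet (m : ℕ) (K : ℝ) : Set (WienerSpace m) :=
  {ω | ∀ i, (IsSublinear fun t => ω.path t i) ∧
    ∀ ε > 0, ∀ᶠ n : ℕ in atTop, ∫ r in (-(n : ℝ))..0, ou (fun t => ω.path t i) r ^ 2 ≤ (K + ε) * n}

theorem IsWienerMeasure.exists_goodSet (hP : IsWienerMeasure P) :
    ∃ K : ℝ, 0 ≤ K ∧ P (goodSet m K)ᶜ = 0 := by
  choose K hK0 hK using fun i => hP.ae_sum_forcing_le i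
  have hnn : ∀ i, 0 ≤ 19 * K i + 1 := fun i => by linarith [hK0 i]
  refine ⟨∑ i, (19 * K i + 1), Finset.sum_nonneg fun i _ => hnn i, ?_⟩
  change ∀ᵐ ω ∂P, ω ∈ goodSet m (∑ i, (19 * K i + 1))
  filter_upwards [hP.ae_isSublinear, ae_all_iff.2 hK] with ω h1 h2 i
  refine ⟨h1 i, fun ε hε => ?_⟩
  filter_upwards [(h1 i).eventually_integral_ou_sq_le (continuous_path_apply ω i) (h2 i)] with n hn
  refine hn.trans ?_
  have : 19 * K i + 1 ≤ ∑ i, (19 * K i + 1) :=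
    Finset.single_le_sum (f := fun i => 19 * K i + 1) (fun i _ => hnn i) (Finset.mem_univ i)
  exact mul_le_mul_of_nonneg_right (by linarith) (Nat.cast_nonneg n)

theorem ou_shift (ω : WienerSpace m) (i : Fin m) (s t : ℝ) :
    ou (fun t => (shift s ω).path t i) t = ou (fun t => ω.path t i) (t + s) := by
  simp only [ou, shift_path_apply, sub_sub_sub_cancel_right]
  congr 1
  funext τ
  rw [show t + τ + s = t + s + τ by ring]

theorem isSublinear_shift {ω : WienerSpace m} {i : Fin m}
    (h : IsSublinear fun t => ω.path t i) (s : ℝ) : IsSublinear fun t => (shift s ω).path t i := by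
  intro ε hε
  obtain ⟨C, hC0, hC⟩ := h.exists_bound (continuous_path_apply ω i) hε s
  refine ⟨C + ε * |s| + |ω.path s i|, fun t ht => ?_⟩
  change |(shift s ω).path t i| ≤ _
  rw [shift_path_apply]
  have h1 := hC (t + s) (by linarith)
  have h2 := abs_sub (ω.path (t + s) i) (ω.path s i)
  have h3 := abs_add_le t s
  have h4 : ε * |t + s| ≤ ε * (|t| + |s|) := by gcongr
  linarith

/-- A shift displaces the window of integration by at most `M ≥ |s|`, which changes the bound only
by a constant; the slack `ε` in `goodSet` absorbs it, and this is why the condition is stated with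
`K + ε`. -/
theorem shift_mem_goodSet {K : ℝ} {ω : WienerSpace m} (hω : ω ∈ goodSet m K) (s : ℝ) :
    shift s ω ∈ goodSet m K := by
  intro i
  refine ⟨isSublinear_shift (hω i).1 s, fun ε hε => ?_⟩
  have hc : Continuous fun r => ou (fun t => ω.path t i) r ^ 2 :=
    ((hω i).1.continuous_ou (continuous_path_apply ω i)).pow 2
  obtain ⟨M, hM⟩ := exists_nat_ge |s|
  set C := ∫ r in (0 : ℝ)..M, ou (fun t => ω.path t i) r ^ 2
  have hlin : ∀ᶠ n : ℕ in atTop, (K + ε / 2) * M + C ≤ ε / 2 * n := by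
    have : Tendsto (fun n : ℕ => ε / 2 * (n : ℝ)) atTop atTop :=
      tendsto_natCast_atTop_atTop.const_mul_atTop (by positivity)
    exact this.eventually_ge_atTop _
  filter_upwards [(tendsto_add_atTop_nat M).eventually ((hω i).2 (ε / 2) (by positivity)), hlin]
    with n h1 h2
  simp_rw [ou_shift]
  rw [intervalIntegral.integral_comp_add_right (fun r => ou (fun t => ω.path t i) r ^ 2), zero_add]
  have hs := abs_le.1 hM
  have h3 : ∫ r in (-(n : ℝ) + s)..s, ou (fun t => ω.path t i) r ^ 2 ≤
      ∫ r in (-((n + M : ℕ) : ℝ))..M, ou (fun t => ω.path t i) r ^ 2 := by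
    refine intervalIntegral.integral_mono_interval ?_ ?_ hs.2 (ae_of_all _ fun r => sq_nonneg _)
      (hc.intervalIntegrable _ _)
    · push_cast; linarith [hs.1]
    · linarith [(Nat.cast_nonneg n : (0 : ℝ) ≤ n)]
  have h4 := intervalIntegral.integral_add_adjacent_intervals (μ := volume)
    (hc.intervalIntegrable (-((n + M : ℕ) : ℝ)) 0) (hc.intervalIntegrable 0 M)
  rw [← h4] at h3
  push_cast at h1 h3
  nlinarith

theorem measurable_ou (i : Fin m) :
    Measurable fun p : WienerSpace m × ℝ => ou (fun t => p.1.path t i) p.2 := by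
  have h0 : Measurable fun p : WienerSpace m × ℝ => p.1.path p.2 i := by
    have := measurable_uncurry_of_continuous_of_measurable
      (u := fun (r : ℝ) (ω : WienerSpace m) => ω.path r i)
      (fun ω => continuous_path_apply ω i) (fun r => measurable_path_apply r i)
    exact this.comp measurable_swap
  have h1 : Measurable (Function.uncurry fun (p : WienerSpace m × ℝ) (τ : ℝ) =>
      Real.exp τ * (p.1.path p.2 i - p.1.path (p.2 + τ) i)) := by
    refine (Real.measurable_exp.comp measurable_snd).mul ((h0.comp measurable_fst).sub
      (h0.comp ((measurable_fst.comp measurable_fst).prodMk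
        ((measurable_snd.comp measurable_fst).add measurable_snd))))
  exact h1.stronglyMeasurable.integral_prod_right.measurable

theorem measurableSet_isSublinear (i : Fin m) :
    MeasurableSet {ω : WienerSpace m | IsSublinear fun t => ω.path t i} := by
  have key : {ω : WienerSpace m | IsSublinear fun t => ω.path t i} =
      ⋂ k : ℕ, ⋃ C : ℕ, ⋂ q : ℚ, {ω : WienerSpace m |
        |ω.path (min (q : ℝ) 0) i| ≤ C + 1 / ((k : ℝ) + 1) * |min (q : ℝ) 0|} := by
    ext ω
    simp only [mem_ofPred_eq, mem_iInter, mem_iUnion]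
    constructor
    · intro h k
      obtain ⟨C, hC⟩ := h (1 / ((k : ℝ) + 1)) (by positivity)
      obtain ⟨n, hn⟩ := exists_nat_ge C
      exact ⟨n, fun q => (hC _ (min_le_right _ _)).trans (by gcongr)⟩
    · intro h ε hε
      obtain ⟨k, hk⟩ := exists_nat_one_div_lt hε
      obtain ⟨C, hC⟩ := h k
      refine ⟨C, fun t ht => ?_⟩
      have hcont : Continuous fun t : ℝ => |ω.path (min t 0) i| :=
        ((continuous_path_apply ω i).comp (by fun_prop)).abs
      have hcl : IsClosed {t : ℝ | |ω.path (min t 0) i| ≤ C + 1 / ((k : ℝ) + 1) * |min t 0|} :=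
        isClosed_le hcont (by fun_prop)
      have h1 : ∀ t, t ∈ {t : ℝ | |ω.path (min t 0) i| ≤ C + 1 / ((k : ℝ) + 1) * |min t 0|} :=
        fun t => hcl.closure_subset_iff.2 (range_subset_iff.2 hC)
          (Rat.denseRange_cast (𝕜 := ℝ) t)
      have h2 := h1 t
      rw [mem_ofPred_eq, min_eq_left ht] at h2
      refine h2.trans ?_
      gcongr
  rw [key]
  refine MeasurableSet.iInter fun k => MeasurableSet.iUnion fun C => MeasurableSet.iInter fun q => ?_
  exact measurableSet_le (measurable_path_apply _ i).abs measurable_const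

theorem measurableSet_goodSet (K : ℝ) : MeasurableSet (goodSet m K) := by
  have key : goodSet m K = ⋂ i, ({ω : WienerSpace m | IsSublinear fun t => ω.path t i} ∩
      ⋂ k : ℕ, ⋃ n₀ : ℕ, ⋂ n : ℕ, {ω : WienerSpace m | n₀ ≤ n →
        ∫ r in (-(n : ℝ))..0, ou (fun t => ω.path t i) r ^ 2 ≤ (K + 1 / ((k : ℝ) + 1)) * n}) := by
    ext ω
    simp only [goodSet, mem_ofPred_eq, mem_iInter, mem_inter_iff, mem_iUnion]
    refine forall_congr' fun i => and_congr_right fun _ => ⟨fun h k => ?_, fun h ε hε => ?_⟩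
    · exact eventually_atTop.1 (h _ (by positivity))
    · obtain ⟨k, hk⟩ := exists_nat_one_div_lt hε
      filter_upwards [eventually_atTop.2 (h k)] with n hn
      refine hn.trans ?_
      gcongr
  rw [key]
  refine MeasurableSet.iInter fun i => (measurableSet_isSublinear i).inter
    (MeasurableSet.iInter fun k => MeasurableSet.iUnion fun n₀ => MeasurableSet.iInter fun n => ?_)
  refine (MeasurableSet.const (n₀ ≤ n)).imp (measurableSet_le ?_ measurable_const)
  exact measurable_intervalIntegral (F := fun (ω : WienerSpace m) r =>
    ou (fun t => ω.path t i) r ^ 2) ((measurable_ou i).pow_const 2) measurable_const measurable_const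

end

section

variable {m d N : ℕ}

/-! ### The Ornstein-Uhlenbeck processes on the set of good paths -/

theorem IsSublinear.const_mul {w : ℝ → ℝ} (h : IsSublinear w) (a : ℝ) :
    IsSublinear fun t => a * w t := by
  intro ε hε
  obtain ⟨C, hC⟩ := h (ε / (|a| + 1)) (by positivity)
  refine ⟨|a| * C, fun t ht => ?_⟩
  rw [abs_mul]
  have h1 : |a| * (ε / (|a| + 1)) ≤ ε := by
    rw [mul_div_assoc', div_le_iff₀ (by positivity)]
    nlinarith [abs_nonneg a]
  calc |a| * |w t| ≤ |a| * (C + ε / (|a| + 1) * |t|) := by gcongr; exact hC t ht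
    _ = |a| * C + |a| * (ε / (|a| + 1)) * |t| := by ring
    _ ≤ |a| * C + ε * |t| := by gcongr

theorem IsSublinear.sum {ι : Type*} [Fintype ι] {w : ι → ℝ → ℝ} (h : ∀ i, IsSublinear (w i)) :
    IsSublinear fun t => ∑ i, w i t := by
  intro ε hε
  choose C hC using fun i => h i (ε / (Fintype.card ι + 1)) (by positivity)
  refine ⟨∑ i, C i, fun t ht => (Finset.abs_sum_le_sum_abs _ _).trans ?_⟩
  refine (Finset.sum_le_sum fun i _ => hC i t ht).trans ?_
  rw [Finset.sum_add_distrib, Finset.sum_const, Finset.card_univ, nsmul_eq_mul, ← mul_assoc]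
  gcongr
  rw [mul_div_assoc', div_le_iff₀ (by positivity)]
  nlinarith

/-- The processes `O⁽ʲ⁾` in terms of `ou`. -/
def ouSum (c : Fin N → Fin m → ℝ) (j : Fin N) (ω : WienerSpace m) (t : ℝ) : ℝ :=
  ∑ i, c j i * ou (fun s => ω.path s i) t

variable {c : Fin N → Fin m → ℝ} {K : ℝ} {ω : WienerSpace m}

theorem ouProcess_eq (hω : ω ∈ goodSet m K) (c : Fin N → Fin m → ℝ) (j : Fin N) (t : ℝ) :
    ouProcess c j t ω = ouSum c j ω t := by
  refine Finset.sum_congr rfl fun i _ => ?_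
  rw [(hω i).1.wienerIntegralIic_eq (continuous_path_apply ω i), ← mul_assoc (Real.exp (-t)),
    ← Real.exp_add, neg_add_cancel, Real.exp_zero, one_mul]

theorem continuous_ouSum (hω : ω ∈ goodSet m K) (c : Fin N → Fin m → ℝ) (j : Fin N) :
    Continuous (ouSum c j ω) :=
  continuous_finsetSum _ fun i _ =>
    ((hω i).1.continuous_ou (continuous_path_apply ω i)).const_mul _

theorem ouSum_shift (c : Fin N → Fin m → ℝ) (j : Fin N) (ω : WienerSpace m) (s t : ℝ) :
    ouSum c j (shift s ω) t = ouSum c j ω (t + s) := by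
  simp only [ouSum, ou_shift]

theorem measurable_ouSum (c : Fin N → Fin m → ℝ) (j : Fin N) :
    Measurable fun p : WienerSpace m × ℝ => ouSum c j p.1 p.2 :=
  Finset.measurable_sum _ fun i _ => (measurable_ou i).const_mul _

theorem isSublinear_ouSum (hω : ω ∈ goodSet m K) (c : Fin N → Fin m → ℝ) (j : Fin N) :
    IsSublinear (ouSum c j ω) :=
  IsSublinear.sum fun i => ((hω i).1.ou (continuous_path_apply ω i)).const_mul _

theorem integral_ouSum_le (hω : ω ∈ goodSet m K) (c : Fin N → Fin m → ℝ) (j : Fin N) {ε : ℝ}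
    (hε : 0 < ε) : ∃ C, ∀ s ≤ 0, |∫ r in s..0, ouSum c j ω r| ≤ C + ε * |s| := by
  have h1 : IsSublinear fun s => ∑ i, c j i * ∫ r in s..0, ou (fun s => ω.path s i) r :=
    IsSublinear.sum fun i => IsSublinear.const_mul
      (fun ε hε => (hω i).1.integral_ou (continuous_path_apply ω i) hε) _
  obtain ⟨C, hC⟩ := h1 ε hε
  refine ⟨C, fun s hs => ?_⟩
  convert hC s hs using 2
  simp only [ouSum]
  rw [intervalIntegral.integral_finsetSum fun i _ =>
    (((hω i).1.continuous_ou (continuous_path_apply ω i)).const_mul _).intervalIntegrable _ _]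
  simp only [intervalIntegral.integral_const_mul]

theorem sum_ouSum_sq_le (c : Fin N → Fin m → ℝ) (ω : WienerSpace m) (t : ℝ) :
    ∑ j, ouSum c j ω t ^ 2 ≤
      (∑ j, ∑ i, c j i ^ 2) * ∑ i, ou (fun s => ω.path s i) t ^ 2 := by
  rw [Finset.sum_mul]
  exact Finset.sum_le_sum fun j _ => Finset.sum_mul_sq_le_sq_mul_sq _ _ _

theorem integral_ou_sq_le (hK : 0 ≤ K) (hω : ω ∈ goodSet m K) (i : Fin m) :
    ∃ C, ∀ s ≤ 0, ∫ r in s..0, ou (fun s => ω.path s i) r ^ 2 ≤ C + (K + 1) * |s| := by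
  obtain ⟨n₀, hn₀⟩ := eventually_atTop.1 ((hω i).2 1 one_pos)
  have hc : Continuous fun r => ou (fun t => ω.path t i) r ^ 2 :=
    ((hω i).1.continuous_ou (continuous_path_apply ω i)).pow 2
  refine ⟨(K + 1) * (n₀ + 1), fun s hs => ?_⟩
  have h1 := hn₀ (n₀ + ⌈|s|⌉₊) (Nat.le_add_right _ _)
  have h2 := Nat.le_ceil |s|
  have h3 := Nat.ceil_lt_add_one (abs_nonneg s)
  have h4 : -((n₀ + ⌈|s|⌉₊ : ℕ) : ℝ) ≤ s := by
    push_cast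
    linarith [neg_abs_le s, (Nat.cast_nonneg n₀ : (0 : ℝ) ≤ n₀)]
  refine (intervalIntegral.integral_mono_interval h4 hs le_rfl (ae_of_all _ fun r => sq_nonneg _)
    (hc.intervalIntegrable _ _)).trans (h1.trans ?_)
  push_cast
  nlinarith

theorem integral_sum_ouSum_sq_le (hK : 0 ≤ K) (hω : ω ∈ goodSet m K) (c : Fin N → Fin m → ℝ) :
    ∃ C, ∀ s ≤ 0, ∫ r in s..0, ∑ j, ouSum c j ω r ^ 2 ≤
      C + (∑ j, ∑ i, c j i ^ 2) * (m * (K + 1)) * |s| := by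
  choose C hC using integral_ou_sq_le hK hω
  set Γ := ∑ j, ∑ i, c j i ^ 2
  have hΓ : 0 ≤ Γ := Finset.sum_nonneg fun j _ => Finset.sum_nonneg fun i _ => sq_nonneg _
  have hc : ∀ i, Continuous fun r => ou (fun t => ω.path t i) r ^ 2 := fun i =>
    ((hω i).1.continuous_ou (continuous_path_apply ω i)).pow 2
  refine ⟨Γ * ∑ i, C i, fun s hs => ?_⟩
  calc ∫ r in s..0, ∑ j, ouSum c j ω r ^ 2
      ≤ ∫ r in s..0, Γ * ∑ i, ou (fun s => ω.path s i) r ^ 2 := by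
        refine intervalIntegral.integral_mono_on hs ?_ ?_ fun r _ => sum_ouSum_sq_le c ω r
        · exact (continuous_finsetSum _ fun j _ =>
            (continuous_ouSum hω c j).pow 2).intervalIntegrable _ _
        · exact ((continuous_finsetSum _ fun i _ => hc i).const_mul _).intervalIntegrable _ _
    _ = Γ * ∑ i, ∫ r in s..0, ou (fun s => ω.path s i) r ^ 2 := by
        rw [intervalIntegral.integral_const_mul,
          intervalIntegral.integral_finsetSum fun i _ => (hc i).intervalIntegrable _ _]
    _ ≤ Γ * ∑ i : Fin m, (C i + (K + 1) * |s|) := by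
        gcongr with i
        exact hC i s hs
    _ = Γ * ∑ i, C i + Γ * (m * (K + 1)) * |s| := by
        rw [Finset.sum_add_distrib, Finset.sum_const, Finset.card_univ, Fintype.card_fin,
          nsmul_eq_mul]
        ring

/-! ### Energy estimates for the fields -/

section Energy

variable {f : Fin N → Vec d → Vec d} {L : ℝ}

/-- The scalings by `e^o` inside and `e^{-o}` outside cancel in the dissipativity inequality, so `L`
is unchanged; the linear term contributes `o`. -/
theorem inner_conjugateField_sub_le
    (hdiss : ∀ j x₁ x₂, inner ℝ (x₁ - x₂) (f j x₁ - f j x₂) ≤ -L * ‖x₁ - x₂‖ ^ 2)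
    (j : Fin N) (o : ℝ) (x y : Vec d) :
    inner ℝ (x - y) (conjugateField f j x o - conjugateField f j y o) ≤
      (-L + o) * ‖x - y‖ ^ 2 := by
  have h := hdiss j (Real.exp o • x) (Real.exp o • y)
  rw [← smul_sub, norm_smul, Real.norm_eq_abs, Real.abs_exp, real_inner_smul_left] at h
  have h1 : conjugateField f j x o - conjugateField f j y o =
      Real.exp (-o) • (f j (Real.exp o • x) - f j (Real.exp o • y)) + o • (x - y) := by
    simp only [conjugateField, smul_sub]
    abel
  rw [h1, inner_add_right, real_inner_smul_right, real_inner_smul_right, real_inner_self_eq_norm_sq]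
  have h2 : Real.exp (-o) * Real.exp o = 1 := by rw [← Real.exp_add]; simp
  have h3 := mul_le_mul_of_nonneg_left h (sq_nonneg (Real.exp (-o)))
  have h4 : Real.exp (-o) ^ 2 * (Real.exp o *
      inner ℝ (x - y) (f j (Real.exp o • x) - f j (Real.exp o • y))) =
      (Real.exp (-o) * Real.exp o) *
        (Real.exp (-o) * inner ℝ (x - y) (f j (Real.exp o • x) - f j (Real.exp o • y))) := by ring
  have h5 : Real.exp (-o) ^ 2 * (-L * (Real.exp o * ‖x - y‖) ^ 2) =
      (Real.exp (-o) * Real.exp o) ^ 2 * (-L * ‖x - y‖ ^ 2) := by ring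
  rw [h4, h5, h2] at h3
  linarith

/-- Of the `2 L` gained from dissipativity one `L` is spent, by Young's inequality, on the value of
the field at the origin. This is why `rate` starts with `-L`. -/
theorem inner_conjugateField_le (hL : 0 < L)
    (hdiss : ∀ j x₁ x₂, inner ℝ (x₁ - x₂) (f j x₁ - f j x₂) ≤ -L * ‖x₁ - x₂‖ ^ 2)
    (j : Fin N) (o : ℝ) (x : Vec d) :
    2 * inner ℝ x (conjugateField f j x o) ≤
      (-L + 2 * o) * ‖x‖ ^ 2 + 1 / L * (Real.exp (-o) * ‖f j 0‖) ^ 2 := by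
  have h := inner_conjugateField_sub_le hdiss j o x 0
  have h0 : conjugateField f j 0 o = Real.exp (-o) • f j 0 := by simp [conjugateField]
  rw [sub_zero, inner_sub_right, h0] at h
  have h1 := real_inner_le_norm x (Real.exp (-o) • f j 0)
  rw [norm_smul, Real.norm_eq_abs, Real.abs_exp] at h1
  set b := Real.exp (-o) * ‖f j 0‖
  have h2 : 2 * (‖x‖ * b) ≤ L * ‖x‖ ^ 2 + 1 / L * b ^ 2 := by
    have : 0 ≤ 1 / L * (L * ‖x‖ - b) ^ 2 := by positivity
    have e : 1 / L * (L * ‖x‖ - b) ^ 2 = L * ‖x‖ ^ 2 + 1 / L * b ^ 2 - 2 * (‖x‖ * b) := by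
      field_simp; ring
    linarith
  linarith

/-- The energy rate `-L + 2 Ō + κ ∑ j, (O⁽ʲ⁾)²`. -/
def rate (L : ℝ) (c : Fin N → Fin m → ℝ) (κ : ℝ) (ω : WienerSpace m) (t : ℝ) : ℝ :=
  -L + 2 * (1 / N * ∑ j, ouSum c j ω t) + κ * ∑ j, ouSum c j ω t ^ 2

/-- The inhomogeneous term of the energy estimates. -/
def source (L : ℝ) (f : Fin N → Vec d → Vec d) (c : Fin N → Fin m → ℝ) (ω : WienerSpace m)
    (t : ℝ) : ℝ :=
  ∑ j, 1 / L * (Real.exp (-ouSum c j ω t) * ‖f j 0‖) ^ 2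

/-! ### The coupling term on the cycle -/

section Coupling

variable [NeZero N]

theorem sum_comp_add_one {E : Type*} [AddCommMonoid E] (h : Fin N → E) :
    ∑ j, h (j + 1) = ∑ j, h j := Equiv.sum_comp (Equiv.addRight (1 : Fin N)) h

theorem sum_comp_sub_one {E : Type*} [AddCommMonoid E] (h : Fin N → E) :
    ∑ j, h (j - 1) = ∑ j, h j := Equiv.sum_comp (Equiv.subRight (1 : Fin N)) h

/-- Summation by parts. Only the bijectivity of the cyclic reindexing is used, so the cases `N = 1`
and `N = 2`, where neighbours coincide, are included. -/
theorem sum_inner_laplacian (u : Fin N → Vec d) :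
    ∑ j, inner ℝ (u j) (u (j - 1) - (2 : ℝ) • u j + u (j + 1)) =
      -∑ j, ‖u j - u (j + 1)‖ ^ 2 := by
  have h1 : ∀ j, inner ℝ (u j) (u (j - 1) - (2 : ℝ) • u j + u (j + 1)) =
      inner ℝ (u (j - 1)) (u j) - 2 * ‖u j‖ ^ 2 + inner ℝ (u j) (u (j + 1)) := by
    intro j
    rw [inner_add_right, inner_sub_right, real_inner_smul_right, real_inner_self_eq_norm_sq,
      real_inner_comm]
  have h2 : ∑ j, inner ℝ (u (j - 1)) (u j) = ∑ j, inner ℝ (u j) (u (j + 1)) := by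
    rw [← sum_comp_sub_one fun j => inner ℝ (u j) (u (j + 1))]
    simp
  have h3 : ∑ j, ‖u (j + 1)‖ ^ 2 = ∑ j, ‖u j‖ ^ 2 := sum_comp_add_one fun j => ‖u j‖ ^ 2
  simp only [h1, norm_sub_sq_real, Finset.sum_add_distrib, Finset.sum_sub_distrib, h2, h3,
    ← Finset.mul_sum]
  ring

theorem norm_sub_le_sum (u : Fin N → Vec d) (j k : Fin N) :
    ‖u j - u k‖ ≤ ∑ l, ‖u l - u (l + 1)‖ := by
  have hle : ∀ j k : Fin N, j ≤ k → ‖u j - u k‖ ≤ ∑ l, ‖u l - u (l + 1)‖ := by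
    intro j k hjk
    have h1 := dist_le_Ico_sum_dist (fun n : ℕ => u (Fin.ofNat N n)) (show j.1 ≤ k.1 from hjk)
    simp only [Fin.ofNat_val_eq_self, dist_eq_norm] at h1
    refine h1.trans ?_
    have h2 : ∑ l ∈ Finset.Ico j.1 k.1, ‖u (Fin.ofNat N l) - u (Fin.ofNat N (l + 1))‖ ≤
        ∑ l ∈ Finset.range N, ‖u (Fin.ofNat N l) - u (Fin.ofNat N (l + 1))‖ := by
      refine Finset.sum_le_sum_of_subset_of_nonneg (fun l hl => ?_) fun _ _ _ => norm_nonneg _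
      rw [Finset.mem_Ico] at hl
      exact Finset.mem_range.2 (hl.2.trans k.2)
    refine h2.trans (le_of_eq ?_)
    rw [Finset.sum_range]
    refine Finset.sum_congr rfl fun l _ => ?_
    rw [Fin.ofNat_val_eq_self]
    congr 3
    ext
    simp [Fin.val_add]
  rcases le_total j k with h | h
  · exact hle j k h
  · rw [norm_sub_rev]; exact hle k j h

/-- With `D` the sum of the neighbour distances, `‖u j‖ ^ 2` and `‖u k‖ ^ 2` differ by at most `2 D
√E`. Averaging over `k` gives `∑ O_j ‖u j‖ ^ 2 ≤ Ō E + 2 A D √E` with `A = ∑ |O_j|`. Young's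
inequality with weight `ν / N` splits the last term into `(ν / N) D ^ 2 ≤ ν Q`, paid by the
coupling, and `(N / ν) A ^ 2 E`, which after `A ^ 2 ≤ N ∑ O_j ^ 2` is the quadratic term. For equal
`O_j` the mean already gives the exact value. -/
theorem sum_mul_norm_sq_le (O : Fin N → ℝ) (u : Fin N → Vec d) {ν κ : ℝ} (hν : 0 < ν)
    (hκ : 2 * (N : ℝ) ^ 2 / ν ≤ κ ∨ ((∀ j k, O j = O k) ∧ 0 ≤ κ)) :
    2 * ∑ j, O j * ‖u j‖ ^ 2 - 2 * ν * ∑ j, ‖u j - u (j + 1)‖ ^ 2 ≤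
      (2 * (1 / N * ∑ j, O j) + κ * ∑ j, O j ^ 2) * ∑ j, ‖u j‖ ^ 2 := by
  have hN : (0 : ℝ) < N := by exact_mod_cast Nat.pos_of_ne_zero (NeZero.ne N)
  set Q := ∑ j, ‖u j - u (j + 1)‖ ^ 2
  set E := ∑ j, ‖u j‖ ^ 2
  have hQ : 0 ≤ Q := Finset.sum_nonneg fun _ _ => sq_nonneg _
  have hE : 0 ≤ E := Finset.sum_nonneg fun _ _ => sq_nonneg _
  have hO2 : 0 ≤ ∑ j, O j ^ 2 := Finset.sum_nonneg fun _ _ => sq_nonneg _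
  rcases hκ with hκ | ⟨hO, hκ⟩
  · set D := ∑ l, ‖u l - u (l + 1)‖
    set A := ∑ j, |O j|
    have hD0 : 0 ≤ D := Finset.sum_nonneg fun _ _ => norm_nonneg _
    have hA0 : 0 ≤ A := Finset.sum_nonneg fun _ _ => abs_nonneg _
    have hD : D ^ 2 ≤ N * Q := by
      simpa using sq_sum_le_card_mul_sum_sq (s := Finset.univ) (f := fun l => ‖u l - u (l + 1)‖)
    have hA : A ^ 2 ≤ N * ∑ j, O j ^ 2 := by
      simpa using sq_sum_le_card_mul_sum_sq (s := Finset.univ) (f := fun j => |O j|)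
    have hu : ∀ j, ‖u j‖ ≤ E.sqrt := fun j =>
      Real.le_sqrt_of_sq_le (Finset.single_le_sum (f := fun j => ‖u j‖ ^ 2)
        (fun _ _ => sq_nonneg _) (Finset.mem_univ j))
    have hdiff : ∀ j k, O j * (‖u j‖ ^ 2 - ‖u k‖ ^ 2) ≤ |O j| * (2 * (D * E.sqrt)) := by
      intro j k
      refine (le_abs_self _).trans ?_
      rw [abs_mul]
      gcongr
      have h1 : ‖u j‖ ^ 2 - ‖u k‖ ^ 2 = (‖u j‖ - ‖u k‖) * (‖u j‖ + ‖u k‖) := by ring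
      rw [h1, abs_mul, abs_of_nonneg (add_nonneg (norm_nonneg (u j)) (norm_nonneg _))]
      have h2 : |‖u j‖ - ‖u k‖| ≤ D := (abs_norm_sub_norm_le _ _).trans (norm_sub_le_sum u j k)
      calc _ ≤ D * (E.sqrt + E.sqrt) := by gcongr <;> apply hu
        _ = 2 * (D * E.sqrt) := by ring
    have hsum : ∑ j, ∑ k : Fin N, O j * (‖u j‖ ^ 2 - ‖u k‖ ^ 2) =
        N * ∑ j, O j * ‖u j‖ ^ 2 - (∑ j, O j) * E := by
      simp only [mul_sub, Finset.sum_sub_distrib, Finset.sum_const, Finset.card_univ,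
        Fintype.card_fin, nsmul_eq_mul, ← Finset.mul_sum]
      rw [Finset.sum_mul]
    have hsum2 : ∑ j, ∑ k : Fin N, O j * (‖u j‖ ^ 2 - ‖u k‖ ^ 2) ≤ N * (A * (2 * (D * E.sqrt))) := by
      refine (Finset.sum_le_sum fun j _ => Finset.sum_le_sum fun k _ => hdiff j k).trans (le_of_eq ?_)
      simp only [Finset.sum_const, Finset.card_univ, Fintype.card_fin, nsmul_eq_mul,
        ← Finset.mul_sum]
      rw [← Finset.sum_mul]
    rw [hsum] at hsum2
    have h3 : ∑ j, O j * ‖u j‖ ^ 2 ≤ 1 / N * (∑ j, O j) * E + 2 * (A * D * E.sqrt) := by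
      rw [← mul_le_mul_iff_right₀ hN]
      have : (N : ℝ) * (1 / N * (∑ j, O j) * E + 2 * (A * D * E.sqrt)) =
        (∑ j, O j) * E + N * (A * (2 * (D * E.sqrt))) := by field_simp
      rw [this]; linarith
    have hsq : E.sqrt ^ 2 = E := Real.sq_sqrt hE
    have h4 : 2 * (A * D * E.sqrt) ≤ ν / N * D ^ 2 + N / ν * (A ^ 2 * E) := by
      have h5 : 0 ≤ N / ν * (ν / N * D - A * E.sqrt) ^ 2 := by positivity
      have h6 : N / ν * (ν / N * D - A * E.sqrt) ^ 2 =
          ν / N * D ^ 2 + N / ν * (A ^ 2 * E.sqrt ^ 2) - 2 * (A * D * E.sqrt) := by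
        field_simp; ring
      rw [hsq] at h6
      linarith
    have h5 : ν / N * D ^ 2 ≤ ν * Q := by
      calc ν / N * D ^ 2 ≤ ν / N * (N * Q) := by gcongr
        _ = ν * Q := by field_simp
    have h6 : 2 * (N / ν * (A ^ 2 * E)) ≤ κ * (∑ j, O j ^ 2) * E := by
      calc 2 * (N / ν * (A ^ 2 * E)) ≤ 2 * (N / ν * (N * (∑ j, O j ^ 2) * E)) := by gcongr
        _ = 2 * (N : ℝ) ^ 2 / ν * (∑ j, O j ^ 2) * E := by ring
        _ ≤ _ := by gcongr
    linarith
  · have h1 : ∑ j, O j * ‖u j‖ ^ 2 = 1 / N * (∑ j, O j) * E := by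
      have h2 : ∑ j, O j = N * O 0 := by
        rw [Finset.sum_congr rfl fun j _ => hO j 0]; simp
      rw [Finset.sum_congr rfl fun j _ => by rw [hO j 0], ← Finset.mul_sum, h2]
      field_simp
      rfl
    rw [h1]
    have : 0 ≤ κ * (∑ j, O j ^ 2) * E := by positivity
    nlinarith [mul_nonneg hν.le hQ]

end Coupling

end Energy

end

section

variable {m d N : ℕ}

/-! ### The coupled and the averaged fields are dissipative -/

/-- The identification of the phase space of the coupled system with a Euclidean space. -/
def energyEquiv (N d : ℕ) : (Fin N → Vec d) ≃L[ℝ] PiLp 2 fun _ : Fin N => Vec d :=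
  (PiLp.continuousLinearEquiv 2 ℝ fun _ : Fin N => Vec d).symm

theorem inner_energyEquiv (x y : Fin N → Vec d) :
    inner ℝ (energyEquiv N d x) (energyEquiv N d y) = ∑ j, inner ℝ (x j) (y j) := by
  rw [PiLp.inner_apply]; rfl

theorem norm_energyEquiv_sq (x : Fin N → Vec d) : ‖energyEquiv N d x‖ ^ 2 = ∑ j, ‖x j‖ ^ 2 := by
  rw [PiLp.norm_sq_eq_of_L2]; rfl

variable {c : Fin N → Fin m → ℝ} {K : ℝ} {ω : WienerSpace m}
  {f : Fin N → Vec d → Vec d} {L : ℝ}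

theorem continuous_rate (hω : ω ∈ goodSet m K) (L κ : ℝ) (c : Fin N → Fin m → ℝ) :
    Continuous (rate L c κ ω) := by
  have := continuous_ouSum hω c
  unfold rate
  fun_prop

theorem continuous_source (hω : ω ∈ goodSet m K) (L : ℝ) (f : Fin N → Vec d → Vec d)
    (c : Fin N → Fin m → ℝ) : Continuous (source L f c ω) := by
  have := continuous_ouSum hω c
  unfold source
  fun_prop

theorem rate_shift (L κ : ℝ) (c : Fin N → Fin m → ℝ) (ω : WienerSpace m) (s t : ℝ) :
    rate L c κ (shift s ω) t = rate L c κ ω (t + s) := by simp only [rate, ouSum_shift]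

theorem source_shift (L : ℝ) (f : Fin N → Vec d → Vec d) (c : Fin N → Fin m → ℝ)
    (ω : WienerSpace m) (s t : ℝ) :
    source L f c (shift s ω) t = source L f c ω (t + s) := by simp only [source, ouSum_shift]

theorem source_nonneg (hL : 0 < L) (ω : WienerSpace m) (t : ℝ) : 0 ≤ source L f c ω t :=
  Finset.sum_nonneg fun _ _ => by positivity

theorem exists_one_add_source_le (hL : 0 < L) (f : Fin N → Vec d → Vec d)
    (c : Fin N → Fin m → ℝ) (hω : ω ∈ goodSet m K) {ε : ℝ} (hε : 0 < ε) :
    ∃ C, 0 < C ∧ ∀ t ≤ 0, 1 + source L f c ω t ≤ C * Real.exp (ε * |t|) := by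
  choose C hC using fun j => isSublinear_ouSum hω c j (ε / 2) (by positivity)
  refine ⟨1 + ∑ j, 1 / L * (Real.exp (C j) * ‖f j 0‖) ^ 2,
    add_pos_of_pos_of_nonneg one_pos (Finset.sum_nonneg fun _ _ => by positivity), fun t ht => ?_⟩
  rw [add_mul, one_mul, Finset.sum_mul, source]
  refine add_le_add (Real.one_le_exp (by positivity)) (Finset.sum_le_sum fun j _ => ?_)
  · have h1 : Real.exp (-ouSum c j ω t) ≤ Real.exp (C j) * Real.exp (ε / 2 * |t|) := by
      rw [← Real.exp_add, Real.exp_le_exp]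
      exact (neg_le_abs _).trans (hC j t ht)
    have h2 : Real.exp (ε * |t|) = Real.exp (ε / 2 * |t|) ^ 2 := by
      rw [← Real.exp_nat_mul]; congr 1; push_cast; ring
    calc 1 / L * (Real.exp (-ouSum c j ω t) * ‖f j 0‖) ^ 2
        ≤ 1 / L * ((Real.exp (C j) * Real.exp (ε / 2 * |t|)) * ‖f j 0‖) ^ 2 := by gcongr
      _ = _ := by rw [h2]; ring

/-- The budget for the rate `L`: the linear noise term takes `2 * L / 16`, the quadratic one at most
`L / 2` by the smallness of `κ`, and the subexponential source `L / 8`. The rate `L / 4` is left. -/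
theorem exists_decay (hL : 0 < L) (hK : 0 ≤ K) (f : Fin N → Vec d → Vec d)
    (c : Fin N → Fin m → ℝ) {κ : ℝ} (hκ0 : 0 ≤ κ)
    (hκ : κ * ((∑ j, ∑ i, c j i ^ 2) * (m * (K + 1))) ≤ L / 2) (hω : ω ∈ goodSet m K) :
    ∃ C lam : ℝ, 0 < C ∧ 0 < lam ∧ ∀ r ≤ 0,
      Real.exp (∫ s in r..0, rate L c κ ω s) * (1 + source L f c ω r) ≤ C * Real.exp (lam * r) := by
  obtain ⟨C₁, hC₁0, hC₁⟩ := exists_one_add_source_le hL f c hω (ε := L / 8) (by positivity)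
  obtain ⟨C₂, hC₂⟩ := integral_sum_ouSum_sq_le hK hω c
  choose C₃ hC₃ using fun j => integral_ouSum_le hω c j (ε := L / 16) (by positivity)
  have hO := continuous_ouSum hω c
  refine ⟨C₁ * Real.exp (2 * (1 / N * ∑ j, C₃ j) + κ * C₂), L / 4, by positivity, by positivity,
    fun r hr => ?_⟩
  have habs : |r| = -r := abs_of_nonpos hr
  have h1 : ∫ s in r..0, rate L c κ ω s =
      L * r + 2 * (1 / N * ∑ j, ∫ s in r..0, ouSum c j ω s) +
        κ * ∫ s in r..0, ∑ j, ouSum c j ω s ^ 2 := by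
    unfold rate
    rw [intervalIntegral.integral_add ((by fun_prop : Continuous _).intervalIntegrable _ _)
      ((by fun_prop : Continuous _).intervalIntegrable _ _), intervalIntegral.integral_add
      ((by fun_prop : Continuous _).intervalIntegrable _ _)
      ((by fun_prop : Continuous _).intervalIntegrable _ _)]
    simp only [intervalIntegral.integral_const_mul, intervalIntegral.integral_const]
    rw [intervalIntegral.integral_finsetSum fun j _ => (hO j).intervalIntegrable _ _]
    simp only [smul_eq_mul]
    ring
  have h2 : 1 / (N : ℝ) * ∑ j, ∫ s in r..0, ouSum c j ω s ≤
      1 / N * ∑ j, C₃ j + L / 16 * |r| := by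
    calc 1 / (N : ℝ) * ∑ j, ∫ s in r..0, ouSum c j ω s
        ≤ 1 / N * ∑ j : Fin N, (C₃ j + L / 16 * |r|) := by
          gcongr with j
          exact (le_abs_self _).trans (hC₃ j r hr)
      _ = 1 / N * ∑ j, C₃ j + (N / N : ℝ) * (L / 16 * |r|) := by
          rw [Finset.sum_add_distrib, Finset.sum_const, Finset.card_univ, Fintype.card_fin,
            nsmul_eq_mul]
          ring
      _ ≤ _ := by
          have : (N / N : ℝ) * (L / 16 * |r|) ≤ L / 16 * |r| :=
            mul_le_of_le_one_left (by positivity) (div_self_le_one _)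
          linarith
  have h3 : κ * ∫ s in r..0, ∑ j, ouSum c j ω s ^ 2 ≤ κ * C₂ + L / 2 * |r| := by
    refine (mul_le_mul_of_nonneg_left (hC₂ r hr) hκ0).trans ?_
    nlinarith [abs_nonneg r]
  calc _ ≤ Real.exp (2 * (1 / N * ∑ j, C₃ j) + κ * C₂ + 3 * L / 8 * r) *
        (C₁ * Real.exp (L / 8 * |r|)) := by
        refine mul_le_mul (Real.exp_le_exp.2 ?_) (hC₁ r hr)
          (by linarith [source_nonneg (f := f) (c := c) hL ω r]) (Real.exp_pos _).le
        rw [h1]; rw [habs] at h2 h3; linarith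
    _ = C₁ * Real.exp (2 * (1 / N * ∑ j, C₃ j) + κ * C₂) * Real.exp (L / 4 * r) := by
        rw [mul_comm, mul_assoc, mul_assoc, ← Real.exp_add, ← Real.exp_add, habs]
        congr 2
        ring

theorem continuous_conjugateField (hf : ∀ j, Continuous (f j)) (j : Fin N) {X : Type*}
    [TopologicalSpace X] {x : X → Vec d} {o : X → ℝ} (hx : Continuous x) (ho : Continuous o) :
    Continuous fun p => conjugateField f j (x p) (o p) := by
  have := hf j
  unfold conjugateField
  fun_prop

theorem measurable_conjugateField (hf : ∀ j, Continuous (f j)) (j : Fin N) {X : Type*}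
    [MeasurableSpace X] {x : X → Vec d} {o : X → ℝ} (hx : Measurable x) (ho : Measurable o) :
    Measurable fun p => conjugateField f j (x p) (o p) :=
  (continuous_conjugateField hf j continuous_fst continuous_snd).measurable.comp (hx.prodMk ho)

theorem measurable_ouSum_comp (c : Fin N → Fin m → ℝ) (j : Fin N) {X : Type*} [MeasurableSpace X]
    {a : X → WienerSpace m} {b : X → ℝ} (ha : Measurable a) (hb : Measurable b) :
    Measurable fun x => ouSum c j (a x) (b x) :=
  Measurable.comp (g := fun p : WienerSpace m × ℝ => ouSum c j p.1 p.2)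
    (f := fun x => (a x, b x)) (measurable_ouSum c j) (ha.prodMk hb)

theorem averagedField_eq (hω : ω ∈ goodSet m K) (f : Fin N → Vec d → Vec d)
    (c : Fin N → Fin m → ℝ) (t : ℝ) (z : Vec d) :
    averagedField f c ω t z = (1 / (N : ℝ)) • ∑ j, conjugateField f j z (ouSum c j ω t) := by
  simp only [averagedField, ouProcess_eq hω]

theorem isRandomField_averaged [NeZero N] (hf : ∀ j, Continuous (f j)) (hL : 0 < L)
    (hdiss : ∀ j x₁ x₂, inner ℝ (x₁ - x₂) (f j x₁ - f j x₂) ≤ -L * ‖x₁ - x₂‖ ^ 2)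
    (c : Fin N → Fin m → ℝ) (K : ℝ) :
    IsRandomField (goodSet m K) (ContinuousLinearEquiv.refl ℝ (Vec d)) (averagedField f c)
      (rate L c 0) where
  measurable_shift := measurable_shift
  shift_mem s _ hω := shift_mem_goodSet hω s
  covariant ω hω s t := by
    funext x
    rw [averagedField_eq (shift_mem_goodSet hω s), averagedField_eq hω]
    simp only [ouSum_shift]
  rate_covariant ω _ s t := rate_shift L 0 c ω s t
  lipschitz ω hω := by
    refine ⟨?_, continuous_rate hω L 0 c, fun t x y => ?_⟩
    · have h1 := continuous_ouSum hω c
      have h2 : Continuous fun p : ℝ × Vec d =>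
          (1 / (N : ℝ)) • ∑ j, conjugateField f j p.2 (ouSum c j ω p.1) := by
        refine Continuous.const_smul (continuous_finsetSum _ fun j _ => ?_) (1 / (N : ℝ))
        exact continuous_conjugateField hf j continuous_snd ((h1 j).comp continuous_fst)
      exact h2.congr fun p => (averagedField_eq hω f c p.1 p.2).symm
    · have hN : (0 : ℝ) < N := by exact_mod_cast Nat.pos_of_ne_zero (NeZero.ne N)
      simp only [ContinuousLinearEquiv.refl_apply]
      rw [averagedField_eq hω, averagedField_eq hω, ← smul_sub, ← Finset.sum_sub_distrib,
        real_inner_smul_right, inner_sum]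
      have h1 : ∑ j, inner ℝ (x - y) (conjugateField f j x (ouSum c j ω t) -
          conjugateField f j y (ouSum c j ω t)) ≤ ∑ j, (-L + ouSum c j ω t) * ‖x - y‖ ^ 2 :=
        Finset.sum_le_sum fun j _ => inner_conjugateField_sub_le hdiss j _ x y
      rw [← Finset.sum_mul, Finset.sum_add_distrib, Finset.sum_const, Finset.card_univ,
        Fintype.card_fin, nsmul_eq_mul] at h1
      have h2 := mul_le_mul_of_nonneg_left h1 (by positivity : (0 : ℝ) ≤ 1 / N)
      have h3 : 1 / (N : ℝ) * ((N * -L + ∑ j, ouSum c j ω t) * ‖x - y‖ ^ 2) =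
          (-L + 1 / N * ∑ j, ouSum c j ω t) * ‖x - y‖ ^ 2 := by field_simp
      rw [h3] at h2
      have h4 : 0 ≤ L * ‖x - y‖ ^ 2 := by positivity
      unfold rate
      linarith
  measurable := by
    have h1 : Measurable fun p : goodSet m K × ℝ × Vec d =>
        (1 / (N : ℝ)) • ∑ j, conjugateField f j p.2.2 (ouSum c j p.1.1 p.2.1) := by
      have h4 : Measurable fun p : goodSet m K × ℝ × Vec d => p.2.2 :=
        measurable_snd.comp measurable_snd
      have h5 : ∀ j, Measurable fun p : goodSet m K × ℝ × Vec d => ouSum c j p.1.1 p.2.1 :=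
        fun j => measurable_ouSum_comp c j (measurable_subtype_coe.comp measurable_fst)
          (measurable_fst.comp measurable_snd)
      have h2 : Measurable fun p : goodSet m K × ℝ × Vec d =>
          ∑ j, conjugateField f j p.2.2 (ouSum c j p.1.1 p.2.1) :=
        Finset.measurable_sum _ fun j _ => measurable_conjugateField hf j h4 (h5 j)
      exact h2.const_smul (1 / (N : ℝ))
    simpa only [← averagedField_eq (Subtype.coe_prop _)] using h1

theorem isDissipative_averaged [NeZero N] (hf : ∀ j, Continuous (f j)) (hL : 0 < L)
    (hdiss : ∀ j x₁ x₂, inner ℝ (x₁ - x₂) (f j x₁ - f j x₂) ≤ -L * ‖x₁ - x₂‖ ^ 2)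
    (c : Fin N → Fin m → ℝ) (hK : 0 ≤ K) :
    IsDissipative (goodSet m K) (ContinuousLinearEquiv.refl ℝ (Vec d)) (averagedField f c)
      (rate L c 0) (source L f c) where
  toIsRandomField := isRandomField_averaged hf hL hdiss c K
  source_continuous ω hω := continuous_source hω L f c
  source_nonneg ω _ t := source_nonneg hL ω t
  source_covariant ω _ s t := source_shift L f c ω s t
  bound ω hω t x := by
    have hN : (1 : ℝ) ≤ N := by exact_mod_cast Nat.one_le_iff_ne_zero.2 (NeZero.ne N)
    simp only [ContinuousLinearEquiv.refl_apply]
    rw [averagedField_eq hω, real_inner_smul_right, inner_sum]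
    have h1 : ∑ j, 2 * inner ℝ x (conjugateField f j x (ouSum c j ω t)) ≤ _ :=
      Finset.sum_le_sum fun j _ => inner_conjugateField_le hL hdiss j (ouSum c j ω t) x
    rw [← Finset.mul_sum, Finset.sum_add_distrib, ← Finset.sum_mul, Finset.sum_add_distrib,
      Finset.sum_const, Finset.card_univ, Fintype.card_fin, nsmul_eq_mul, ← Finset.mul_sum] at h1
    have h2 := mul_le_mul_of_nonneg_left h1 (by positivity : (0 : ℝ) ≤ 1 / N)
    have h3 : 1 / (N : ℝ) * source L f c ω t ≤ source L f c ω t :=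
      mul_le_of_le_one_left (source_nonneg hL ω t) (by rw [div_le_one (by linarith)]; exact hN)
    have h4 : 1 / (N : ℝ) * ((N * -L + 2 * ∑ j, ouSum c j ω t) * ‖x‖ ^ 2) =
      (-L + 2 * (1 / N * ∑ j, ouSum c j ω t)) * ‖x‖ ^ 2 := by field_simp
    rw [mul_add, h4] at h2
    rw [source] at h3 ⊢
    unfold rate
    linarith
  decay ω hω := exists_decay hL hK f c le_rfl (by rw [zero_mul]; positivity) hω

variable [NeZero N]

theorem coupledField_eq (hω : ω ∈ goodSet m K) (f : Fin N → Vec d → Vec d)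
    (c : Fin N → Fin m → ℝ) (ν t : ℝ) (x : Fin N → Vec d) (j : Fin N) :
    coupledField f c ν ω t x j = conjugateField f j (x j) (ouSum c j ω t) +
      ν • (x (j - 1) - (2 : ℝ) • x j + x (j + 1)) := by
  simp only [coupledField, ouProcess_eq hω]

theorem continuous_coupledField (hf : ∀ j, Continuous (f j)) (c : Fin N → Fin m → ℝ) (ν : ℝ)
    (hω : ω ∈ goodSet m K) :
    Continuous fun p : ℝ × (Fin N → Vec d) => coupledField f c ν ω p.1 p.2 := by
  refine continuous_pi fun j => ?_
  have h1 := continuous_ouSum hω c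
  have h2 : Continuous fun p : ℝ × (Fin N → Vec d) =>
      conjugateField f j (p.2 j) (ouSum c j ω p.1) +
        ν • (p.2 (j - 1) - (2 : ℝ) • p.2 j + p.2 (j + 1)) := by
    refine Continuous.add ?_ (by fun_prop)
    exact continuous_conjugateField hf j (by fun_prop) ((h1 j).comp continuous_fst)
  exact h2.congr fun p => (coupledField_eq hω f c ν p.1 p.2 j).symm

/-- The coupling constants `ν` for which `κ` is admissible in the energy rate. -/
def IsAdmissible (c : Fin N → Fin m → ℝ) (ν κ : ℝ) : Prop :=
  2 * (N : ℝ) ^ 2 / ν ≤ κ ∨ (SameNoise c ∧ 0 ≤ κ)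

theorem IsAdmissible.sum_le {ν κ : ℝ} (h : IsAdmissible c ν κ) (hν : 0 < ν) (ω : WienerSpace m)
    (t : ℝ) (u : Fin N → Vec d) :
    2 * ∑ j, ouSum c j ω t * ‖u j‖ ^ 2 - 2 * ν * ∑ j, ‖u j - u (j + 1)‖ ^ 2 ≤
      (2 * (1 / N * ∑ j, ouSum c j ω t) + κ * ∑ j, ouSum c j ω t ^ 2) * ∑ j, ‖u j‖ ^ 2 :=
  sum_mul_norm_sq_le _ u hν (h.imp_right fun h => ⟨fun j k => by simp only [ouSum, h.1 j k], h.2⟩)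

/-- Every `ν > 0` is admissible with `κ = 2 N ^ 2 / ν`, so the flow exists without a lower bound on
`ν`; smallness of `κ` matters only for decay. -/
theorem isRandomField_coupled (hf : ∀ j, Continuous (f j)) (hL : 0 < L)
    (hdiss : ∀ j x₁ x₂, inner ℝ (x₁ - x₂) (f j x₁ - f j x₂) ≤ -L * ‖x₁ - x₂‖ ^ 2)
    {ν κ : ℝ} (hν : 0 < ν) (hκ : IsAdmissible c ν κ) (K : ℝ) :
    IsRandomField (goodSet m K) (energyEquiv N d) (coupledField f c ν) (rate L c κ) where
  measurable_shift := measurable_shift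
  shift_mem s _ hω := shift_mem_goodSet hω s
  covariant ω hω s t := by
    funext x j
    rw [coupledField_eq (shift_mem_goodSet hω s), coupledField_eq hω, ouSum_shift]
  rate_covariant ω _ s t := rate_shift L κ c ω s t
  lipschitz ω hω := by
    refine ⟨continuous_coupledField hf c ν hω, continuous_rate hω L κ c, fun t x y => ?_⟩
    rw [inner_energyEquiv, norm_energyEquiv_sq]
    set u := x - y
    have h1 : ∀ j, inner ℝ (u j) ((coupledField f c ν ω t x - coupledField f c ν ω t y) j) ≤
        (-L + ouSum c j ω t) * ‖u j‖ ^ 2 +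
          ν * inner ℝ (u j) (u (j - 1) - (2 : ℝ) • u j + u (j + 1)) := by
      intro j
      have e : (coupledField f c ν ω t x - coupledField f c ν ω t y) j =
          (conjugateField f j (x j) (ouSum c j ω t) - conjugateField f j (y j) (ouSum c j ω t)) +
            ν • (u (j - 1) - (2 : ℝ) • u j + u (j + 1)) := by
        simp only [Pi.sub_apply, coupledField_eq hω, u]
        module
      rw [e, inner_add_right, real_inner_smul_right]
      gcongr
      exact inner_conjugateField_sub_le hdiss j _ _ _
    have h2 := Finset.sum_le_sum fun j (_ : j ∈ Finset.univ) => h1 j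
    simp only [Finset.sum_add_distrib, ← Finset.mul_sum, sum_inner_laplacian, add_mul] at h2
    have h3 := hκ.sum_le hν ω t u
    have h4 : 0 ≤ L * ∑ j, ‖u j‖ ^ 2 := by positivity
    unfold rate
    linarith
  measurable := by
    refine measurable_pi_lambda _ fun j => ?_
    have h1 : Measurable fun p : goodSet m K × ℝ × (Fin N → Vec d) =>
        conjugateField f j (p.2.2 j) (ouSum c j p.1.1 p.2.1) +
          ν • (p.2.2 (j - 1) - (2 : ℝ) • p.2.2 j + p.2.2 (j + 1)) := by
      have h2 : Continuous fun x : Fin N → Vec d => ν • (x (j - 1) - (2 : ℝ) • x j + x (j + 1)) := by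
        fun_prop
      have h4 : Measurable fun p : goodSet m K × ℝ × (Fin N → Vec d) => p.2.2 j := by fun_prop
      exact (measurable_conjugateField hf j h4 (measurable_ouSum_comp c j
        (measurable_subtype_coe.comp measurable_fst) (measurable_fst.comp measurable_snd))).add
        (h2.measurable.comp (measurable_snd.comp measurable_snd))
    simpa only [← coupledField_eq (Subtype.coe_prop _)] using h1

theorem isDissipative_coupled (hf : ∀ j, Continuous (f j)) (hL : 0 < L)
    (hdiss : ∀ j x₁ x₂, inner ℝ (x₁ - x₂) (f j x₁ - f j x₂) ≤ -L * ‖x₁ - x₂‖ ^ 2)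
    {ν κ : ℝ} (hν : 0 < ν) (hκ : IsAdmissible c ν κ) (hK : 0 ≤ K) (hκ0 : 0 ≤ κ)
    (hκL : κ * ((∑ j, ∑ i, c j i ^ 2) * (m * (K + 1))) ≤ L / 2) :
    IsDissipative (goodSet m K) (energyEquiv N d) (coupledField f c ν) (rate L c κ)
      (source L f c) where
  toIsRandomField := isRandomField_coupled hf hL hdiss hν hκ K
  source_continuous ω hω := continuous_source hω L f c
  source_nonneg ω _ t := source_nonneg hL ω t
  source_covariant ω _ s t := source_shift L f c ω s t
  bound ω hω t x := by
    rw [inner_energyEquiv, norm_energyEquiv_sq]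
    have h1 : ∀ j, 2 * inner ℝ (x j) (coupledField f c ν ω t x j) ≤
        (-L + 2 * ouSum c j ω t) * ‖x j‖ ^ 2 +
          1 / L * (Real.exp (-ouSum c j ω t) * ‖f j 0‖) ^ 2 +
          2 * ν * inner ℝ (x j) (x (j - 1) - (2 : ℝ) • x j + x (j + 1)) := by
      intro j
      rw [coupledField_eq hω, inner_add_right, real_inner_smul_right]
      linarith [inner_conjugateField_le hL hdiss j (ouSum c j ω t) (x j)]
    have h2 := Finset.sum_le_sum fun j (_ : j ∈ Finset.univ) => h1 j
    simp only [Finset.sum_add_distrib, ← Finset.mul_sum, sum_inner_laplacian, add_mul,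
      mul_assoc] at h2
    have h3 := hκ.sum_le hν ω t x
    unfold rate source
    simp only [← Finset.mul_sum]
    linarith
  decay ω hω := exists_decay hL hK f c hκ0 hκL hω

end

section

variable {m d N : ℕ}

/-! ### The limit of strong coupling -/

/-- The mean of the components. -/
def mean (N d : ℕ) : (Fin N → Vec d) →L[ℝ] Vec d :=
  (1 / (N : ℝ)) • ∑ j, ContinuousLinearMap.proj j

theorem mean_apply (x : Fin N → Vec d) : mean N d x = (1 / (N : ℝ)) • ∑ j, x j := by
  simp [mean]

/-- The deviations of the components from their mean. -/
def deviation (N d : ℕ) : (Fin N → Vec d) →L[ℝ] (Fin N → Vec d) :=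
  ContinuousLinearMap.pi fun j => ContinuousLinearMap.proj j - mean N d

theorem deviation_apply (x : Fin N → Vec d) (j : Fin N) :
    deviation N d x j = x j - mean N d x := rfl

variable {c : Fin N → Fin m → ℝ} {K : ℝ} {ω : WienerSpace m}
  {f : Fin N → Vec d → Vec d} {L : ℝ}

theorem exists_field_bound (hf : ∀ j, Continuous (f j)) (hω : ω ∈ goodSet m K)
    (c : Fin N → Fin m → ℝ) (R : ℝ) :
    ∃ M, 0 ≤ M ∧ ∀ j t x, |t| ≤ R → ‖x‖ ≤ R → ‖conjugateField f j x (ouSum c j ω t)‖ ≤ M := by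
  have hc : Continuous fun p : ℝ × Vec d => fun j => conjugateField f j p.2 (ouSum c j ω p.1) :=
    continuous_pi fun j => continuous_conjugateField hf j continuous_snd
      ((continuous_ouSum hω c j).comp continuous_fst)
  obtain ⟨M, hM⟩ := ((isCompact_closedBall (0 : ℝ) R).prod
    (isCompact_closedBall (0 : Vec d) R)).exists_bound_of_continuousOn hc.continuousOn
  refine ⟨max M 0, le_max_right _ _, fun j t x ht hx => le_trans ?_ (le_max_left _ _)⟩
  exact (norm_le_pi_norm _ j).trans (hM (t, x) ⟨by simpa using ht, by simpa using hx⟩)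

theorem exists_field_modulus (hf : ∀ j, Continuous (f j)) (hω : ω ∈ goodSet m K)
    (c : Fin N → Fin m → ℝ) (R : ℝ) {ε : ℝ} (hε : 0 < ε) :
    ∃ δ > 0, ∀ j t x y, |t| ≤ R → ‖x‖ ≤ R → ‖y‖ ≤ R → ‖x - y‖ < δ →
      ‖conjugateField f j x (ouSum c j ω t) - conjugateField f j y (ouSum c j ω t)‖ ≤ ε := by
  have hc : Continuous fun p : ℝ × Vec d => fun j => conjugateField f j p.2 (ouSum c j ω p.1) :=
    continuous_pi fun j => continuous_conjugateField hf j continuous_snd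
      ((continuous_ouSum hω c j).comp continuous_fst)
  have hu := ((isCompact_closedBall (0 : ℝ) R).prod
    (isCompact_closedBall (0 : Vec d) R)).uniformContinuousOn_of_continuous hc.continuousOn
  obtain ⟨δ, hδ, h⟩ := Metric.uniformContinuousOn_iff.1 hu ε hε
  refine ⟨δ, hδ, fun j t x y ht hx hy hxy => ?_⟩
  have h1 := h (t, x) ⟨by simpa using ht, by simpa using hx⟩ (t, y)
    ⟨by simpa using ht, by simpa using hy⟩ (by
      rw [Prod.dist_eq, dist_self, dist_eq_norm]; exact max_lt hδ hxy)
  rw [dist_eq_norm] at h1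
  exact (norm_le_pi_norm _ j).trans h1.le

variable [NeZero N]

theorem sum_deviation (x : Fin N → Vec d) : ∑ j, deviation N d x j = 0 := by
  have hN : (N : ℝ) ≠ 0 := by exact_mod_cast NeZero.ne N
  simp only [deviation_apply, Finset.sum_sub_distrib, Finset.sum_const, Finset.card_univ,
    Fintype.card_fin, mean_apply]
  rw [← Nat.cast_smul_eq_nsmul ℝ, smul_smul, mul_one_div_cancel hN, one_smul, sub_self]

theorem norm_mean_sq_le (x : Fin N → Vec d) : ‖mean N d x‖ ^ 2 ≤ ‖energyEquiv N d x‖ ^ 2 := by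
  have hN : (1 : ℝ) ≤ N := by exact_mod_cast Nat.one_le_iff_ne_zero.2 (NeZero.ne N)
  have h0 : (0 : ℝ) < N := by linarith
  rw [norm_energyEquiv_sq, mean_apply, norm_smul, Real.norm_of_nonneg (by positivity), mul_pow]
  have h1 : ‖∑ j, x j‖ ^ 2 ≤ N * ∑ j, ‖x j‖ ^ 2 := by
    calc ‖∑ j, x j‖ ^ 2 ≤ (∑ j, ‖x j‖) ^ 2 := by gcongr; exact norm_sum_le _ _
      _ ≤ _ := by
        simpa using sq_sum_le_card_mul_sum_sq (s := Finset.univ) (f := fun j => ‖x j‖)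
  have h2 : 0 ≤ ∑ j, ‖x j‖ ^ 2 := by positivity
  calc (1 / (N : ℝ)) ^ 2 * ‖∑ j, x j‖ ^ 2 ≤ (1 / (N : ℝ)) ^ 2 * (N * ∑ j, ‖x j‖ ^ 2) := by gcongr
    _ = 1 / N * ∑ j, ‖x j‖ ^ 2 := by field_simp
    _ ≤ _ := mul_le_of_le_one_left h2 (by rw [div_le_one h0]; exact hN)

/-- The discrete Poincaré inequality on the cycle. -/
theorem sum_norm_sq_le_of_sum_eq_zero (w : Fin N → Vec d) (hw : ∑ j, w j = 0) :
    ∑ j, ‖w j‖ ^ 2 ≤ (N : ℝ) ^ 2 * ∑ j, ‖w j - w (j + 1)‖ ^ 2 := by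
  have hN : (0 : ℝ) < N := by exact_mod_cast Nat.pos_of_ne_zero (NeZero.ne N)
  set D := ∑ l, ‖w l - w (l + 1)‖
  have hD : D ^ 2 ≤ N * ∑ j, ‖w j - w (j + 1)‖ ^ 2 := by
    simpa using sq_sum_le_card_mul_sum_sq (s := Finset.univ) (f := fun l => ‖w l - w (l + 1)‖)
  have h1 : ∀ j, ‖w j‖ ≤ D := by
    intro j
    have e : (N : ℝ) • w j = ∑ k, (w j - w k) := by
      rw [Finset.sum_sub_distrib, hw, sub_zero, Finset.sum_const, Finset.card_univ,
        Fintype.card_fin, Nat.cast_smul_eq_nsmul]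
    have h2 : N * ‖w j‖ ≤ N * D := by
      calc N * ‖w j‖ = ‖∑ k, (w j - w k)‖ := by
            rw [← e, norm_smul, Real.norm_of_nonneg hN.le]
        _ ≤ ∑ k : Fin N, D := norm_sum_le_of_le _ fun k _ => norm_sub_le_sum w j k
        _ = N * D := by simp
    exact le_of_mul_le_mul_left h2 hN
  calc ∑ j, ‖w j‖ ^ 2 ≤ ∑ j : Fin N, D ^ 2 := by gcongr with j; exact h1 j
    _ = N * D ^ 2 := by simp
    _ ≤ N * (N * ∑ j, ‖w j - w (j + 1)‖ ^ 2) := by gcongr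
    _ = _ := by ring

/-- The mean of the field drops out because deviations sum to zero, and the coupling acts on the
deviations as it does on the state. The Poincaré inequality turns it into damping at rate `2 ν / N ^
2`, of which Young's inequality for the bounded uncoupled part takes `1`. -/
theorem two_inner_deviation_le (hω : ω ∈ goodSet m K) {ν M t : ℝ} (hν : 0 < ν) (x : Fin N → Vec d)
    (hM : ∀ j, ‖conjugateField f j (x j) (ouSum c j ω t)‖ ≤ M) :
    2 * inner ℝ (energyEquiv N d (deviation N d x))
        (energyEquiv N d (deviation N d (coupledField f c ν ω t x))) ≤
      -(2 * ν / (N : ℝ) ^ 2 - 1) * ‖energyEquiv N d (deviation N d x)‖ ^ 2 + N * M ^ 2 := by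
  have hN : (0 : ℝ) < N := by exact_mod_cast Nat.pos_of_ne_zero (NeZero.ne N)
  rw [inner_energyEquiv, norm_energyEquiv_sq]
  set w := deviation N d x
  have hw : ∑ j, w j = 0 := sum_deviation x
  have h1 : ∀ j, 2 * inner ℝ (w j) (deviation N d (coupledField f c ν ω t x) j) ≤
      ‖w j‖ ^ 2 + M ^ 2 + 2 * ν * inner ℝ (w j) (w (j - 1) - (2 : ℝ) • w j + w (j + 1)) -
        2 * inner ℝ (w j) (mean N d (coupledField f c ν ω t x)) := by
    intro j
    have e : deviation N d (coupledField f c ν ω t x) j =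
        conjugateField f j (x j) (ouSum c j ω t) + ν • (w (j - 1) - (2 : ℝ) • w j + w (j + 1)) -
          mean N d (coupledField f c ν ω t x) := by
      rw [deviation_apply, coupledField_eq hω]
      simp only [w, deviation_apply]
      module
    rw [e, inner_sub_right, inner_add_right, real_inner_smul_right]
    have h2 := two_mul_le_of_le (hM j) (norm_nonneg (w j))
    have h3 := real_inner_le_norm (w j) (conjugateField f j (x j) (ouSum c j ω t))
    linarith
  have h2 := Finset.sum_le_sum fun j (_ : j ∈ Finset.univ) => h1 j
  simp only [Finset.sum_sub_distrib, Finset.sum_add_distrib, ← Finset.mul_sum, sum_inner_laplacian,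
    ← sum_inner, hw, inner_zero_left, Finset.sum_const, Finset.card_univ, Fintype.card_fin,
    nsmul_eq_mul] at h2
  have h3 : 2 * ν / (N : ℝ) ^ 2 * ∑ j, ‖w j‖ ^ 2 ≤ 2 * ν * ∑ j, ‖w j - w (j + 1)‖ ^ 2 := by
    calc _ ≤ 2 * ν / (N : ℝ) ^ 2 * ((N : ℝ) ^ 2 * ∑ j, ‖w j - w (j + 1)‖ ^ 2) := by
          gcongr; exact sum_norm_sq_le_of_sum_eq_zero w hw
      _ = _ := by field_simp
  linarith

theorem integral_exp_neg_mul_le {k β a b : ℝ} (hk : 0 < k) (hβ : 0 ≤ β) :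
    ∫ r in a..b, Real.exp (-k * b - -k * r) * β ≤ β / k := by
  have h1 : ∀ r ∈ uIcc a b, HasDerivAt (fun r => β / k * Real.exp (-k * b - -k * r))
      (Real.exp (-k * b - -k * r) * β) r := by
    intro r _
    have h2 := ((((hasDerivAt_id r).const_mul (-k)).const_sub (-k * b)).exp).const_mul (β / k)
    refine h2.congr_deriv ?_
    simp only [id]
    field_simp
  rw [intervalIntegral.integral_eq_sub_of_hasDerivAt h1
    ((by fun_prop : Continuous _).intervalIntegrable _ _), sub_self, Real.exp_zero, mul_one]
  have : 0 ≤ β / k * Real.exp (-k * b - -k * a) := by positivity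
  linarith

/-- The components of bounded solutions of the coupled systems synchronize for `ν → ∞`. -/
theorem exists_deviation_le (hf : ∀ j, Continuous (f j)) (hω : ω ∈ goodSet m K) {ν₀ R a b : ℝ}
    (hν₀ : 0 < ν₀) {x : ℝ → ℝ → Fin N → Vec d}
    (hx : ∀ ν ≥ ν₀, ∀ t, HasDerivAt (x ν) (coupledField f c ν ω t (x ν t)) t)
    (hR : ∀ ν ≥ ν₀, ∀ t ∈ Icc (a - 1) b, ∀ j, ‖x ν t j‖ ≤ R) {ε : ℝ} (hε : 0 < ε) :
    ∃ ν₁ ≥ ν₀, ∀ ν ≥ ν₁, ∀ t ∈ Icc a b, ∀ j, ‖deviation N d (x ν t) j‖ ≤ ε := by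
  have hN : (0 : ℝ) < N := by exact_mod_cast Nat.pos_of_ne_zero (NeZero.ne N)
  obtain ⟨M, hM0, hM⟩ := exists_field_bound hf hω c (max R (max |a - 1| |b|))
  have hMt : ∀ ν ≥ ν₀, ∀ t ∈ Icc (a - 1) b, ∀ j,
      ‖conjugateField f j (x ν t j) (ouSum c j ω t)‖ ≤ M := fun ν hν t ht j =>
    hM j t _ ((abs_le_max_abs_abs ht.1 ht.2).trans (le_max_right _ _))
      ((hR ν hν t ht j).trans (le_max_left _ _))
  set T : (Fin N → Vec d) →L[ℝ] PiLp 2 fun _ : Fin N => Vec d :=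
    (energyEquiv N d : (Fin N → Vec d) →L[ℝ] _) ∘L deviation N d
  set B := (‖T‖ * |R|) ^ 2
  have hB : 0 ≤ B := by positivity
  have hlim : Tendsto (fun ν : ℝ => Real.exp (-(2 * ν / (N : ℝ) ^ 2 - 1)) * B +
      N * M ^ 2 / (2 * ν / (N : ℝ) ^ 2 - 1)) atTop (𝓝 0) := by
    have h1 : Tendsto (fun ν : ℝ => 2 * ν / (N : ℝ) ^ 2 - 1) atTop atTop := by
      refine tendsto_atTop_add_const_right _ _ ?_
      refine Tendsto.atTop_div_const (by positivity) ?_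
      exact tendsto_id.const_mul_atTop two_pos
    have h2 := (Real.tendsto_exp_neg_atTop_nhds_zero.comp h1).mul_const B
    have h3 := h1.const_div_atTop (N * M ^ 2)
    simpa using h2.add h3
  have hev := (hlim.eventually (gt_mem_nhds (by positivity : (0 : ℝ) < ε ^ 2))).and
    ((eventually_gt_atTop ((N : ℝ) ^ 2)).and (eventually_ge_atTop ν₀))
  obtain ⟨ν₁, h₁⟩ := eventually_atTop.1 hev
  refine ⟨max ν₁ ν₀, le_max_right _ _, fun ν hν t ht j => ?_⟩
  obtain ⟨h2, h3, h4⟩ := h₁ ν ((le_max_left _ _).trans hν)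
  have hν0 : 0 < ν := hν₀.trans_le h4
  set k := 2 * ν / (N : ℝ) ^ 2 - 1
  have hk : 1 < k := by
    have : (2 : ℝ) < 2 * ν / (N : ℝ) ^ 2 := by rw [lt_div_iff₀ (by positivity)]; linarith
    simp only [k]; linarith
  -- Starting one time unit before `a` gives the initial deviation, known only to be bounded, the
  -- time to shrink by the factor `e^{-k}`, where `k` grows linearly in `ν`.
  have hen := energy_le T (x := x ν) (k := fun _ => -k) (β := fun _ => N * M ^ 2)
    (A := fun t => -k * t) (a := a - 1) (b := t) (by linarith [ht.1])
    (fun s _ => (hx ν h4 s).continuousAt.continuousWithinAt)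
    (fun s _ => (hx ν h4 s).hasDerivWithinAt)
    (fun s hs => two_inner_deviation_le hω hν0 _
      (hMt ν h4 s ⟨hs.1, hs.2.le.trans ht.2⟩))
    (fun s => by simpa using (hasDerivAt_id s).const_mul (-k)) continuous_const
  have h5 := integral_exp_neg_mul_le (a := a - 1) (b := t) (k := k) (β := N * M ^ 2)
    (by linarith) (by positivity)
  have h6 : ‖T (x ν (a - 1))‖ ^ 2 ≤ B := by
    have hxn : ‖x ν (a - 1)‖ ≤ |R| := (pi_norm_le_iff_of_nonneg (abs_nonneg R)).2 fun j =>
      (hR ν h4 _ ⟨le_rfl, by linarith [ht.1, ht.2]⟩ j).trans (le_abs_self R)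
    simp only [B]
    gcongr
    exact (T.le_opNorm _).trans (by gcongr)
  have h7 : Real.exp (-k * t - -k * (a - 1)) ≤ Real.exp (-k) := by
    rw [Real.exp_le_exp]
    nlinarith [ht.1]
  have h8 : ‖T (x ν t)‖ ^ 2 ≤ ε ^ 2 := by
    calc ‖T (x ν t)‖ ^ 2 ≤ _ := hen
      _ ≤ Real.exp (-k) * B + N * M ^ 2 / k := by gcongr
      _ ≤ ε ^ 2 := h2.le
  have h9 : ‖deviation N d (x ν t) j‖ ^ 2 ≤ ‖T (x ν t)‖ ^ 2 := by
    change _ ≤ ‖energyEquiv N d (deviation N d (x ν t))‖ ^ 2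
    rw [norm_energyEquiv_sq]
    exact Finset.single_le_sum (f := fun j => ‖deviation N d (x ν t) j‖ ^ 2)
      (fun _ _ => sq_nonneg _) (Finset.mem_univ j)
  exact (sq_le_sq₀ (norm_nonneg _) hε.le).1 (h9.trans h8)

theorem mean_coupledField (hω : ω ∈ goodSet m K) (ν t : ℝ) (x : Fin N → Vec d) :
    mean N d (coupledField f c ν ω t x) =
      (1 / (N : ℝ)) • ∑ j, conjugateField f j (x j) (ouSum c j ω t) := by
  rw [mean_apply]
  congr 1
  simp only [coupledField_eq hω, Finset.sum_add_distrib, ← Finset.smul_sum, Finset.sum_sub_distrib]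
  rw [sum_comp_add_one, sum_comp_sub_one]
  module

/-- The coupling cancels in the mean, so the mean solves the averaged equation up to the field error
`δ`. The `L` that `rate` leaves unused absorbs this error. -/
theorem two_inner_mean_sub_le (hL : 0 < L)
    (hdiss : ∀ j x₁ x₂, inner ℝ (x₁ - x₂) (f j x₁ - f j x₂) ≤ -L * ‖x₁ - x₂‖ ^ 2)
    (hω : ω ∈ goodSet m K) {ν t δ : ℝ} (x : Fin N → Vec d) (z : Vec d)
    (hδ : ∀ j, ‖conjugateField f j (x j) (ouSum c j ω t) -
      conjugateField f j (mean N d x) (ouSum c j ω t)‖ ≤ δ) :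
    2 * inner ℝ (mean N d x - z) (mean N d (coupledField f c ν ω t x) - averagedField f c ω t z) ≤
      rate L c 0 ω t * ‖mean N d x - z‖ ^ 2 + δ ^ 2 / L := by
  have hN : (0 : ℝ) < N := by exact_mod_cast Nat.pos_of_ne_zero (NeZero.ne N)
  set v := mean N d x
  have hδ0 : 0 ≤ δ := (norm_nonneg _).trans (hδ 0)
  rw [mean_coupledField hω, averagedField_eq hω, ← smul_sub, ← Finset.sum_sub_distrib,
    real_inner_smul_right, inner_sum]
  have h1 : ∀ j, inner ℝ (v - z) (conjugateField f j (x j) (ouSum c j ω t) -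
      conjugateField f j z (ouSum c j ω t)) ≤
      ‖v - z‖ * δ + (-L + ouSum c j ω t) * ‖v - z‖ ^ 2 := by
    intro j
    rw [← sub_add_sub_cancel (conjugateField f j (x j) _) (conjugateField f j v (ouSum c j ω t)),
      inner_add_right]
    refine add_le_add ((real_inner_le_norm _ _).trans ?_) (inner_conjugateField_sub_le hdiss j _ _ _)
    gcongr
    exact hδ j
  have h2 := Finset.sum_le_sum fun j (_ : j ∈ Finset.univ) => h1 j
  rw [Finset.sum_add_distrib, ← Finset.sum_mul Finset.univ fun j => -L + ouSum c j ω t,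
    Finset.sum_add_distrib, Finset.sum_const, Finset.sum_const, Finset.card_univ, Fintype.card_fin, nsmul_eq_mul, nsmul_eq_mul] at h2
  have h3 := mul_le_mul_of_nonneg_left h2 (by positivity : (0 : ℝ) ≤ 1 / N)
  have h4 : 1 / (N : ℝ) * (N * (‖v - z‖ * δ) + (N * -L + ∑ j, ouSum c j ω t) * ‖v - z‖ ^ 2) =
      ‖v - z‖ * δ + (-L + 1 / N * ∑ j, ouSum c j ω t) * ‖v - z‖ ^ 2 := by field_simp
  rw [h4] at h3
  have h5 : 2 * (‖v - z‖ * δ) ≤ L * ‖v - z‖ ^ 2 + δ ^ 2 / L := by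
    have h6 : 0 ≤ 1 / L * (L * ‖v - z‖ - δ) ^ 2 := by positivity
    have e : 1 / L * (L * ‖v - z‖ - δ) ^ 2 = L * ‖v - z‖ ^ 2 + δ ^ 2 / L - 2 * (‖v - z‖ * δ) := by
      field_simp; ring
    linarith
  unfold rate
  linarith

/-- Bounded solutions of the coupled systems converge to those of the averaged equation if they
come close to them at an early time. -/
theorem exists_mean_sub_le (hf : ∀ j, Continuous (f j)) (hL : 0 < L)
    (hdiss : ∀ j x₁ x₂, inner ℝ (x₁ - x₂) (f j x₁ - f j x₂) ≤ -L * ‖x₁ - x₂‖ ^ 2)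
    (hω : ω ∈ goodSet m K) {ν₀ R a b : ℝ}
    (hν₀ : 0 < ν₀) {x : ℝ → ℝ → Fin N → Vec d} {z : ℝ → Vec d}
    (hx : ∀ ν ≥ ν₀, ∀ t, HasDerivAt (x ν) (coupledField f c ν ω t (x ν t)) t)
    (hz : ∀ t, HasDerivAt z (averagedField f c ω t (z t)) t)
    (hR : ∀ ν ≥ ν₀, ∀ t ∈ Icc (a - 1) b, ∀ j, ‖x ν t j‖ ≤ R) {ε : ℝ} (hε : 0 < ε) :
    ∃ ν₁ ≥ ν₀, ∀ ν ≥ ν₁, ∀ t ∈ Icc a b, ‖mean N d (x ν t) - z t‖ ^ 2 ≤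
      Real.exp (∫ r in a..t, rate L c 0 ω r) * ‖mean N d (x ν a) - z a‖ ^ 2 + ε := by
  have hγ := continuous_rate hω L 0 c
  obtain ⟨Γ, hΓ0, hΓ⟩ := exists_abs_le hγ (max |a| |b|)
  set E := Real.exp (Γ * |b - a|) * (|b - a| + 1)
  have hE : 0 < E := by positivity
  -- the tolerance for the fields
  set δ := (ε * L / E).sqrt
  have hδ : 0 < δ := Real.sqrt_pos.2 (by positivity)
  have hδ2 : δ ^ 2 / L * E = ε := by
    rw [Real.sq_sqrt (by positivity)]; field_simp
  obtain ⟨η, hη, hmod⟩ := exists_field_modulus hf hω c (max (‖mean N d‖ * |R|) (max |R| (max |a| |b|))) hδ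
  obtain ⟨ν₁, hν₁, h₁⟩ := exists_deviation_le hf hω hν₀ hx hR (ε := η / 2) (by positivity)
  refine ⟨ν₁, hν₁, fun ν hν t ht => ?_⟩
  have hνν := hν₁.trans hν
  have hA : ∀ s, HasDerivAt (fun s => ∫ r in a..s, rate L c 0 ω r) (rate L c 0 ω s) s := fun s =>
    (hγ.integral_hasStrictDerivAt a s).hasDerivAt
  have hRt : ∀ s ∈ Icc a b, ∀ j, ‖x ν s j‖ ≤ R := fun s hs =>
    hR ν hνν s ⟨by linarith [hs.1], hs.2⟩
  have hen := energy_le (ContinuousLinearMap.id ℝ (Vec d)) (x := fun s => mean N d (x ν s) - z s)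
    (x' := fun s => mean N d (coupledField f c ν ω s (x ν s)) - averagedField f c ω s (z s))
    (k := rate L c 0 ω) (β := fun _ => δ ^ 2 / L) (a := a) (b := t) ht.1
    (fun s _ => ((((mean N d).continuous.continuousAt.comp (hx ν hνν s).continuousAt)).sub
      (hz s).continuousAt).continuousWithinAt)
    (fun s _ => (((mean N d).hasFDerivAt.comp_hasDerivAt s (hx ν hνν s)).sub
      (hz s)).hasDerivWithinAt)
    (fun s hs => by
      refine two_inner_mean_sub_le hL hdiss hω _ _ fun j => ?_
      have hs' : s ∈ Icc a b := ⟨hs.1, hs.2.le.trans ht.2⟩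
      refine hmod j s _ _ ?_ ?_ ?_ ?_
      · exact (abs_le_max_abs_abs hs'.1 hs'.2).trans ((le_max_right _ _).trans (le_max_right _ _))
      · exact (hRt s hs' j).trans ((le_abs_self R).trans ((le_max_left _ _).trans (le_max_right _ _)))
      · refine le_trans ?_ (le_max_left _ _)
        refine ((mean N d).le_opNorm _).trans ?_
        gcongr
        exact (pi_norm_le_iff_of_nonneg (abs_nonneg R)).2 fun j =>
          (hRt s hs' j).trans (le_abs_self R)
      · exact (h₁ ν hν s hs' j).trans_lt (by linarith))
    hA continuous_const
  simp only [intervalIntegral.integral_same, sub_zero, ContinuousLinearMap.id_apply] at hen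
  refine hen.trans ?_
  gcongr
  have h2 : ∀ r ∈ Icc a t, Real.exp ((∫ r in a..t, rate L c 0 ω r) - ∫ r' in a..r, rate L c 0 ω r') *
      (δ ^ 2 / L) ≤ Real.exp (Γ * |b - a|) * (δ ^ 2 / L) := by
    intro r hr
    gcongr
    rw [intervalIntegral.integral_interval_sub_left (hγ.intervalIntegrable _ _)
      (hγ.intervalIntegrable _ _)]
    refine (le_abs_self _).trans ?_
    have h3 := intervalIntegral.norm_integral_le_of_norm_le_const (a := r) (b := t) (C := Γ)
      (f := rate L c 0 ω) (fun s hs => by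
        rw [uIoc_of_le hr.2] at hs
        exact hΓ s (abs_le_max_abs_abs (hr.1.trans hs.1.le) (hs.2.trans ht.2)))
    refine h3.trans (mul_le_mul_of_nonneg_left ?_ hΓ0)
    rw [abs_of_nonneg (by linarith [hr.2]), abs_of_nonneg (by linarith [ht.1, ht.2])]
    linarith [hr.1, ht.2]
  have hAc : Continuous fun s => ∫ r in a..s, rate L c 0 ω r :=
    continuous_iff_continuousAt.2 fun s => (hA s).continuousAt
  calc _ ≤ ∫ r in a..t, Real.exp (Γ * |b - a|) * (δ ^ 2 / L) :=
        intervalIntegral.integral_mono_on ht.1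
          ((by fun_prop : Continuous _).intervalIntegrable _ _)
          (continuous_const.intervalIntegrable _ _) h2
    _ = (t - a) * (Real.exp (Γ * |b - a|) * (δ ^ 2 / L)) := by
        rw [intervalIntegral.integral_const, smul_eq_mul]
    _ ≤ (|b - a| + 1) * (Real.exp (Γ * |b - a|) * (δ ^ 2 / L)) := by
        gcongr
        linarith [le_abs_self (b - a), ht.2]
    _ = δ ^ 2 / L * E := by simp only [E]; ring
    _ = ε := hδ2

/-- The solutions through the pullback limits are bounded on bounded intervals, uniformly in the
coupling constant. -/
theorem exists_pullbackLimit_bound (hf : ∀ j, Continuous (f j)) (hL : 0 < L)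
    (hdiss : ∀ j x₁ x₂, inner ℝ (x₁ - x₂) (f j x₁ - f j x₂) ≤ -L * ‖x₁ - x₂‖ ^ 2)
    (hK : 0 ≤ K) (hω : ω ∈ goodSet m K) {ν₀ κ : ℝ} (hν₀ : 0 < ν₀) (hκ0 : 0 ≤ κ)
    (hκL : κ * ((∑ j, ∑ i, c j i ^ 2) * (m * (K + 1))) ≤ L / 2)
    (hκ : ∀ ν ≥ ν₀, IsAdmissible c ν κ) :
    ∃ C lam : ℝ, 0 < C ∧ 0 < lam ∧ ∀ ν ≥ ν₀, ∀ s ≤ 0,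
      Real.exp (∫ r in s..0, rate L c κ ω r) *
        ‖energyEquiv N d (pullbackLimit (coupledField f c ν) (shift s ω))‖ ^ 2 ≤
      C / lam * Real.exp (lam * s) := by
  obtain ⟨C, lam, hC, hlam, hdec⟩ := exists_decay hL hK f c hκ0 hκL hω
  refine ⟨C, lam, hC, hlam, fun ν hν s hs => ?_⟩
  exact (isDissipative_coupled hf hL hdiss (hν₀.trans_le hν) (hκ ν hν) hK hκ0 hκL).pullbackLimit_bound
    hω hC hlam hdec hs

/-- The order of choices matters. An early time `a` is fixed independently of `ν`, such that the
squared distance at `a` times the contraction factor up to `0` is small; the weighted bounds for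
both trajectories allow this, since `rate` with `κ = 0` does not exceed the one with `κ`. Only
afterwards is `ν` taken large, depending on the bounded window that ends at `0`. -/
theorem exists_pullbackLimit_sub_le (hf : ∀ j, Continuous (f j)) (hL : 0 < L)
    (hdiss : ∀ j x₁ x₂, inner ℝ (x₁ - x₂) (f j x₁ - f j x₂) ≤ -L * ‖x₁ - x₂‖ ^ 2)
    (hK : 0 ≤ K) (hω : ω ∈ goodSet m K) {ν₀ κ : ℝ} (hν₀ : 0 < ν₀) (hκ0 : 0 ≤ κ)
    (hκL : κ * ((∑ j, ∑ i, c j i ^ 2) * (m * (K + 1))) ≤ L / 2)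
    (hκ : ∀ ν ≥ ν₀, IsAdmissible c ν κ) (T : ℝ) {ε : ℝ} (hε : 0 < ε) :
    ∃ ν₁ ≥ ν₀, ∀ ν ≥ ν₁, ∀ t ∈ Icc (-T) 0, ∀ j,
      ‖pullbackLimit (coupledField f c ν) (shift t ω) j -
        pullbackLimit (averagedField f c) (shift t ω)‖ ≤ ε := by
  obtain ⟨C, lam, hC, hlam, hx⟩ := exists_pullbackLimit_bound hf hL hdiss hK hω hν₀ hκ0 hκL hκ
  have hav := isDissipative_averaged hf hL hdiss c hK
  obtain ⟨C', lam', hC', hlam', hdec'⟩ := hav.decay ω hω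
  have hz := fun s (hs : s ≤ 0) => hav.pullbackLimit_bound hω hC' hlam' hdec' hs
  simp only [ContinuousLinearEquiv.refl_apply] at hz
  set x : ℝ → ℝ → Fin N → Vec d := fun ν t => pullbackLimit (coupledField f c ν) (shift t ω)
  set z : ℝ → Vec d := fun t => pullbackLimit (averagedField f c) (shift t ω)
  have hγ := continuous_rate hω L 0 c
  have hγκ := continuous_rate hω L κ c
  obtain ⟨Γ, hΓ0, hΓ⟩ := exists_abs_le hγ |T|
  set E := Real.exp (Γ * |T|)
  have hE : 0 < E := Real.exp_pos _
  -- an early time at which both solutions are small compared with the contraction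
  have hlim : Tendsto (fun s : ℝ => E * (2 * (C / lam * Real.exp (lam * s)) +
      2 * (C' / lam' * Real.exp (lam' * s)))) atBot (𝓝 0) := by
    have h1 : ∀ {l : ℝ}, 0 < l → Tendsto (fun s : ℝ => Real.exp (l * s)) atBot (𝓝 0) := fun hl =>
      Real.tendsto_exp_atBot.comp (tendsto_id.const_mul_atBot hl)
    have h2 := ((((h1 hlam).const_mul (C / lam)).const_mul 2).add
      (((h1 hlam').const_mul (C' / lam')).const_mul 2)).const_mul E
    simpa using h2
  have hev := (hlim.eventually (gt_mem_nhds (by positivity : (0 : ℝ) < ε ^ 2 / 8))).and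
    ((eventually_le_atBot (-T)).and (eventually_le_atBot 0))
  obtain ⟨a, ha1, haT, ha0⟩ := hev.exists
  obtain ⟨Γ', hΓ'0, hΓ'⟩ := exists_abs_le hγκ |a - 1|
  set R := (Real.exp (Γ' * |a - 1|) * (C / lam)).sqrt
  have hR : ∀ ν ≥ ν₀, ∀ t ∈ Icc (a - 1) 0, ∀ j, ‖x ν t j‖ ≤ R := by
    intro ν hν t ht j
    refine Real.le_sqrt_of_sq_le ?_
    have h1 := hx ν hν t ht.2
    have h2 : ‖x ν t j‖ ^ 2 ≤ ‖energyEquiv N d (x ν t)‖ ^ 2 := by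
      rw [norm_energyEquiv_sq]
      exact Finset.single_le_sum (f := fun j => ‖x ν t j‖ ^ 2)
        (fun _ _ => sq_nonneg _) (Finset.mem_univ j)
    have h3 : C / lam * Real.exp (lam * t) ≤ C / lam := by
      refine mul_le_of_le_one_right (by positivity) (Real.exp_le_one_iff.2 ?_)
      exact mul_nonpos_of_nonneg_of_nonpos hlam.le ht.2
    have h4 : -(Γ' * |a - 1|) ≤ ∫ r in t..0, rate L c κ ω r := by
      have h5 := intervalIntegral.norm_integral_le_of_norm_le_const (a := t) (b := 0) (C := Γ')
        (f := rate L c κ ω) (fun s hs => by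
          rw [uIoc_of_le ht.2] at hs
          refine hΓ' s ?_
          rw [abs_of_nonpos hs.2, abs_of_neg (by linarith)]
          linarith [hs.1, ht.1])
      have h6 : Γ' * |0 - t| ≤ Γ' * |a - 1| := by
        refine mul_le_mul_of_nonneg_left ?_ hΓ'0
        rw [abs_of_nonneg (by linarith [ht.2]), abs_of_neg (by linarith)]
        linarith [ht.1]
      have h7 := neg_abs_le (∫ r in t..0, rate L c κ ω r)
      rw [Real.norm_eq_abs] at h5
      linarith
    have h5 := mul_le_mul_of_nonneg_right (Real.exp_le_exp.2 h4)
      (sq_nonneg ‖energyEquiv N d (x ν t)‖)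
    have h6 := mul_le_mul_of_nonneg_left ((h5.trans h1).trans h3) (Real.exp_pos (Γ' * |a - 1|)).le
    rw [← mul_assoc, ← Real.exp_add, add_neg_cancel, Real.exp_zero, one_mul] at h6
    exact h2.trans h6
  have hxd : ∀ ν ≥ ν₀, ∀ t, HasDerivAt (x ν) (coupledField f c ν ω t (x ν t)) t := fun ν hν t =>
    (isDissipative_coupled hf hL hdiss (hν₀.trans_le hν) (hκ ν hν) hK hκ0 hκL).hasDerivAt_pullbackLimit
      hω t
  obtain ⟨ν₁, hν₁, h₁⟩ := exists_mean_sub_le hf hL hdiss hω hν₀ hxd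
    (fun t => hav.hasDerivAt_pullbackLimit hω t) hR (by positivity : (0 : ℝ) < ε ^ 2 / 8)
  obtain ⟨ν₂, hν₂, h₂⟩ := exists_deviation_le hf hω hν₀ hxd hR (by positivity : (0 : ℝ) < ε / 2)
  refine ⟨max ν₁ ν₂, hν₁.trans (le_max_left _ _), fun ν hν t ht j => ?_⟩
  have hta : t ∈ Icc a 0 := ⟨haT.trans ht.1, ht.2⟩
  have hνν : ν₀ ≤ ν := hν₁.trans ((le_max_left _ _).trans hν)
  have h3 := h₁ ν ((le_max_left _ _).trans hν) t hta
  have h4 := h₂ ν ((le_max_right _ _).trans hν) t hta j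
  have h5 : Real.exp (∫ r in a..t, rate L c 0 ω r) ≤ E * Real.exp (∫ r in a..0, rate L c 0 ω r) := by
    rw [← Real.exp_add, Real.exp_le_exp, ← intervalIntegral.integral_add_adjacent_intervals
      (hγ.intervalIntegrable a t) (hγ.intervalIntegrable t 0)]
    have h6 := intervalIntegral.norm_integral_le_of_norm_le_const (a := t) (b := 0) (C := Γ)
      (f := rate L c 0 ω) (fun s hs => by
        rw [uIoc_of_le ht.2] at hs
        refine hΓ s ?_
        rw [abs_of_nonpos hs.2]
        exact le_trans (by linarith [hs.1, ht.1]) (le_abs_self T))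
    have h7 : Γ * |0 - t| ≤ Γ * |T| := by
      refine mul_le_mul_of_nonneg_left ?_ hΓ0
      rw [abs_of_nonneg (by linarith [ht.2])]
      exact le_trans (by linarith [ht.1]) (le_abs_self T)
    have h8 := neg_abs_le (∫ r in t..0, rate L c 0 ω r)
    rw [Real.norm_eq_abs] at h6
    linarith
  have h6 : Real.exp (∫ r in a..0, rate L c 0 ω r) * ‖mean N d (x ν a) - z a‖ ^ 2 ≤
      2 * (C / lam * Real.exp (lam * a)) + 2 * (C' / lam' * Real.exp (lam' * a)) := by
    have h7 : ‖mean N d (x ν a) - z a‖ ^ 2 ≤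
        2 * ‖energyEquiv N d (x ν a)‖ ^ 2 + 2 * ‖z a‖ ^ 2 := by
      have h8 := norm_mean_sq_le (x ν a)
      have h9 := norm_sub_le (mean N d (x ν a)) (z a)
      have h10 : ‖mean N d (x ν a) - z a‖ ^ 2 ≤ (‖mean N d (x ν a)‖ + ‖z a‖) ^ 2 := by gcongr
      nlinarith [sq_nonneg (‖mean N d (x ν a)‖ - ‖z a‖)]
    have h8 : Real.exp (∫ r in a..0, rate L c 0 ω r) ≤ Real.exp (∫ r in a..0, rate L c κ ω r) := by
      rw [Real.exp_le_exp]
      refine intervalIntegral.integral_mono_on ha0 (hγ.intervalIntegrable _ _)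
        (hγκ.intervalIntegrable _ _) fun r _ => ?_
      have : 0 ≤ κ * ∑ j, ouSum c j ω r ^ 2 := by positivity
      unfold rate
      linarith
    have h9 := hx ν hνν a ha0
    have h10 := hz a ha0
    have h11 := mul_le_mul_of_nonneg_right h8 (sq_nonneg ‖energyEquiv N d (x ν a)‖)
    have h12 := mul_le_mul_of_nonneg_left h7 (Real.exp_pos (∫ r in a..0, rate L c 0 ω r)).le
    linarith
  have h7 : Real.exp (∫ r in a..t, rate L c 0 ω r) * ‖mean N d (x ν a) - z a‖ ^ 2 ≤ ε ^ 2 / 8 := by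
    calc _ ≤ (E * Real.exp (∫ r in a..0, rate L c 0 ω r)) * ‖mean N d (x ν a) - z a‖ ^ 2 := by gcongr
      _ = E * (Real.exp (∫ r in a..0, rate L c 0 ω r) * ‖mean N d (x ν a) - z a‖ ^ 2) := by ring
      _ ≤ _ := mul_le_mul_of_nonneg_left h6 hE.le
      _ ≤ _ := ha1.le
  have h8 : ‖mean N d (x ν t) - z t‖ ≤ ε / 2 := by
    refine (sq_le_sq₀ (norm_nonneg _) (by positivity)).1 ?_
    linarith
  calc ‖x ν t j - z t‖ = ‖deviation N d (x ν t) j + (mean N d (x ν t) - z t)‖ := by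
        rw [deviation_apply, sub_add_sub_cancel]
    _ ≤ ε / 2 + ε / 2 := norm_add_le_of_le h4 h8
    _ = ε := add_halves ε

/-- The attractors of the coupled systems converge to that of the averaged equation. -/
theorem tendstoUniformlyOn_pullbackLimit (hf : ∀ j, Continuous (f j)) (hL : 0 < L)
    (hdiss : ∀ j x₁ x₂, inner ℝ (x₁ - x₂) (f j x₁ - f j x₂) ≤ -L * ‖x₁ - x₂‖ ^ 2)
    (hK : 0 ≤ K) (hω : ω ∈ goodSet m K) {ν₀ κ : ℝ} (hν₀ : 0 < ν₀) (hκ0 : 0 ≤ κ)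
    (hκL : κ * ((∑ j, ∑ i, c j i ^ 2) * (m * (K + 1))) ≤ L / 2)
    (hκ : ∀ ν ≥ ν₀, IsAdmissible c ν κ) (T₁ T₂ : ℝ) :
    TendstoUniformlyOn
      (fun (ν : ℝ) (t : ℝ) => pullbackLimit (coupledField f c ν) (shift t ω))
      (fun t (_ : Fin N) => pullbackLimit (averagedField f c) (shift t ω)) atTop (Icc T₁ T₂) := by
  rw [Metric.tendstoUniformlyOn_iff]
  intro ε hε
  -- Replacing `ω` by its shift by `T₂` moves the interval to one that ends at `0`.
  obtain ⟨ν₁, -, h₁⟩ := exists_pullbackLimit_sub_le hf hL hdiss hK (shift_mem_goodSet hω T₂) hν₀ hκ0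
    hκL hκ (T₂ - T₁) (half_pos hε)
  filter_upwards [eventually_ge_atTop ν₁] with ν hν t ht
  refine lt_of_le_of_lt ?_ (half_lt_self hε)
  rw [dist_comm, dist_eq_norm, pi_norm_le_iff_of_nonneg (by positivity)]
  intro j
  have h2 := h₁ ν hν (t - T₂) ⟨by linarith [ht.1], by linarith [ht.2]⟩ j
  rw [shift_shift, sub_add_cancel] at h2
  exact h2

end

section

variable {m d N : ℕ}

/-! ### Stratonovich sums along a path -/

/-- The trapezoidal rule is exact to second order; this is the reason why Stratonovich sums obey the
ordinary chain rule. -/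
theorem abs_exp_trapezoid_le {x : ℝ} (hx : |x| ≤ 1) :
    |Real.exp x - 1 - x * (1 / 2 * (1 + Real.exp x))| ≤ |x| ^ 3 := by
  have h1 := Real.abs_exp_sub_one_sub_id_le hx
  have h2 := Real.exp_bound hx (n := 3) (by norm_num)
  norm_num [Finset.sum_range_succ, Nat.factorial] at h2
  have e : Real.exp x - 1 - x * (1 / 2 * (1 + Real.exp x)) =
      (Real.exp x - (1 + x + x ^ 2 / 2)) - x / 2 * (Real.exp x - 1 - x) := by ring
  rw [e]
  refine (abs_sub _ _).trans ?_
  rw [abs_mul, abs_div, abs_two]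
  have h3 : |x| / 2 * |Real.exp x - 1 - x| ≤ |x| / 2 * |x| ^ 2 := by
    gcongr
    rwa [sq_abs]
  have h4 : 0 ≤ |x| ^ 3 := by positivity
  nlinarith

/-- The local error of the Stratonovich sums of `e^B y` for a `C¹` function `y`. -/
theorem exists_stratonovich_error_le {B : ℝ → ℝ} {y y' : ℝ → Vec d} (hB : Continuous B)
    (hy : ∀ r, HasDerivAt y (y' r) r) (hy' : Continuous y') (s t : ℝ) {η : ℝ} (hη : 0 < η) :
    ∃ δ > 0, ∀ u v, s ≤ u → u ≤ v → v ≤ t → v - u < δ →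
      ‖(B v - B u) • ((1 / 2 : ℝ) • (Real.exp (B u) • y u + Real.exp (B v) • y v)) -
        (Real.exp (B v) • y v - Real.exp (B u) • y u - ∫ r in u..v, Real.exp (B r) • y' r)‖ ≤
      η * ((B v - B u) ^ 2 + (v - u)) := by
  have hyc : Continuous y := continuous_iff_continuousAt.2 fun r => (hy r).continuousAt
  obtain ⟨M₁, hM₁⟩ := (isCompact_Icc (a := s) (b := t)).exists_bound_of_continuousOn
    (hB.rexp).continuousOn
  obtain ⟨M₂, hM₂⟩ := (isCompact_Icc (a := s) (b := t)).exists_bound_of_continuousOn hyc.continuousOn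
  obtain ⟨M₃, hM₃⟩ := (isCompact_Icc (a := s) (b := t)).exists_bound_of_continuousOn hy'.continuousOn
  set M := max 1 (max M₁ (max M₂ M₃))
  have hM : 1 ≤ M := le_max_left _ _
  have b₁ : ∀ r, s ≤ r → r ≤ t → Real.exp (B r) ≤ M := fun r h1 h2 => by
    have := hM₁ r ⟨h1, h2⟩
    rw [Real.norm_eq_abs, Real.abs_exp] at this
    exact this.trans ((le_max_left _ _).trans (le_max_right _ _))
  have b₂ : ∀ r, s ≤ r → r ≤ t → ‖y r‖ ≤ M := fun r h1 h2 =>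
    (hM₂ r ⟨h1, h2⟩).trans ((le_max_left _ _).trans ((le_max_right _ _).trans (le_max_right _ _)))
  have b₃ : ∀ r, s ≤ r → r ≤ t → ‖y' r‖ ≤ M := fun r h1 h2 =>
    (hM₃ r ⟨h1, h2⟩).trans ((le_max_right _ _).trans ((le_max_right _ _).trans (le_max_right _ _)))
  set τ := min 1 (η / (2 * M ^ 2))
  have hτ : 0 < τ := lt_min one_pos (by positivity)
  have hτ1 : τ ≤ 1 := min_le_left _ _
  have hτM : τ * M ^ 2 ≤ η / 2 := by
    calc τ * M ^ 2 ≤ η / (2 * M ^ 2) * M ^ 2 := by gcongr; exact min_le_right _ _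
      _ = η / 2 := by field_simp
  have hu := (isCompact_Icc (a := s) (b := t)).uniformContinuousOn_of_continuous
    (f := fun r => (B r, Real.exp (B r))) (hB.prodMk hB.rexp).continuousOn
  obtain ⟨δ, hδ, h⟩ := Metric.uniformContinuousOn_iff.1 hu τ hτ
  refine ⟨δ, hδ, fun u v hsu huv hvt hlt => ?_⟩
  have hmod : ∀ r, u ≤ r → r ≤ v → |B v - B r| < τ ∧ |Real.exp (B v) - Real.exp (B r)| < τ := by
    intro r h1 h2
    have h3 := h v ⟨hsu.trans huv, hvt⟩ r ⟨hsu.trans h1, h2.trans hvt⟩ (by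
      rw [Real.dist_eq, abs_of_nonneg (by linarith)]; linarith)
    rw [Prod.dist_eq, max_lt_iff, Real.dist_eq, Real.dist_eq] at h3
    exact h3
  set Δ := B v - B u
  have hΔ : |Δ| < τ := (hmod u le_rfl huv).1
  have hyv : y v = y u + ∫ r in u..v, y' r := by
    rw [intervalIntegral.integral_eq_sub_of_hasDerivAt (fun r _ => hy r)
      (hy'.intervalIntegrable _ _)]
    abel
  have hexp : Real.exp (B v) = Real.exp (B u) * Real.exp Δ := by
    rw [← Real.exp_add]; congr 1; simp only [Δ]; ring
  -- the three contributions to the error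
  set T₁ := (Real.exp (B u) * (Real.exp Δ - 1 - Δ * (1 / 2 * (1 + Real.exp Δ)))) • y u
  set T₂ := ∫ r in u..v, (Real.exp (B v) - Real.exp (B r)) • y' r
  set T₃ := (Δ / 2 * Real.exp (B v)) • ∫ r in u..v, y' r
  have hint : (∫ r in u..v, (Real.exp (B v) - Real.exp (B r)) • y' r) =
      Real.exp (B v) • (∫ r in u..v, y' r) - ∫ r in u..v, Real.exp (B r) • y' r := by
    simp_rw [sub_smul]
    rw [intervalIntegral.integral_sub ((by fun_prop : Continuous _).intervalIntegrable _ _)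
      ((by fun_prop : Continuous _).intervalIntegrable _ _), intervalIntegral.integral_smul]
  -- `T₁` is the trapezoidal remainder with `y` frozen at `u`, `T₂` comes from replacing `e^{B r}`
  -- by its value at `v`, and `T₃` is the change of `y` multiplied by the noise increment.
  have hdec : Δ • ((1 / 2 : ℝ) • (Real.exp (B u) • y u + Real.exp (B v) • y v)) -
      (Real.exp (B v) • y v - Real.exp (B u) • y u - ∫ r in u..v, Real.exp (B r) • y' r) =
      T₃ - T₂ - T₁ := by
    simp only [T₁, T₂, T₃]
    rw [hint, hyv, hexp]
    module
  rw [hdec]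
  have h1 : ‖T₁‖ ≤ τ * M ^ 2 * Δ ^ 2 := by
    simp only [T₁]
    rw [norm_smul, Real.norm_eq_abs, abs_mul, Real.abs_exp]
    calc Real.exp (B u) * |Real.exp Δ - 1 - Δ * (1 / 2 * (1 + Real.exp Δ))| * ‖y u‖
        ≤ M * |Δ| ^ 3 * M := by
          gcongr
          · exact b₁ u hsu (huv.trans hvt)
          · exact abs_exp_trapezoid_le (hΔ.le.trans hτ1)
          · exact b₂ u hsu (huv.trans hvt)
      _ = |Δ| * M ^ 2 * Δ ^ 2 := by rw [← sq_abs Δ]; ring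
      _ ≤ _ := by gcongr
  have h2 : ‖T₂‖ ≤ τ * M * (v - u) := by
    have := intervalIntegral.norm_integral_le_of_norm_le_const (a := u) (b := v) (C := τ * M)
      (f := fun r => (Real.exp (B v) - Real.exp (B r)) • y' r) (fun r hr => by
        rw [uIoc_of_le huv] at hr
        rw [norm_smul, Real.norm_eq_abs]
        exact mul_le_mul (hmod r hr.1.le hr.2).2.le (b₃ r (hsu.trans hr.1.le) (hr.2.trans hvt))
          (norm_nonneg _) hτ.le)
    rwa [abs_of_nonneg (by linarith)] at this
  have h3 : ‖T₃‖ ≤ τ / 2 * M * (M * (v - u)) := by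
    simp only [T₃]
    rw [norm_smul, Real.norm_eq_abs, abs_mul, Real.abs_exp, abs_div, abs_two]
    have := intervalIntegral.norm_integral_le_of_norm_le_const (a := u) (b := v) (C := M)
      (f := y') (fun r hr => by
        rw [uIoc_of_le huv] at hr
        exact b₃ r (hsu.trans hr.1.le) (hr.2.trans hvt))
    rw [abs_of_nonneg (sub_nonneg.2 huv)] at this
    gcongr
    exact b₁ v (hsu.trans huv) hvt
  have h4 : τ * M * (v - u) ≤ τ * M ^ 2 * (v - u) := by
    have : M ≤ M ^ 2 := by nlinarith
    have h5 : 0 ≤ v - u := by linarith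
    gcongr
  have h5 : τ * M ^ 2 * Δ ^ 2 ≤ η / 2 * Δ ^ 2 := by gcongr
  have h6 : τ * M ^ 2 * (v - u) ≤ η / 2 * (v - u) :=
    mul_le_mul_of_nonneg_right hτM (by linarith)
  have h7 : ‖T₃ - T₂ - T₁‖ ≤ ‖T₃‖ + ‖T₂‖ + ‖T₁‖ :=
    (norm_sub_le _ _).trans (add_le_add_left (norm_sub_le _ _) _)
  have h8 : 0 ≤ η * Δ ^ 2 := by positivity
  have h9 : 0 ≤ η * (v - u) := mul_nonneg hη.le (by linarith)
  linarith

/-- The error of the Stratonovich sums of `e^B y` for a `C¹` function `y` along a partition. -/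
theorem exists_stratonovich_sum_error_le {B : ℝ → ℝ} {y y' : ℝ → Vec d} (hB : Continuous B)
    (hy : ∀ r, HasDerivAt y (y' r) r) (hy' : Continuous y') (s t : ℝ) {η : ℝ} (hη : 0 < η) :
    ∃ δ > 0, ∀ (n : ℕ) (p : ℕ → ℝ), Monotone p → p 0 = s → p n = t →
      (∀ l < n, p (l + 1) - p l < δ) →
      ‖∑ l ∈ Finset.range n, (B (p (l + 1)) - B (p l)) •
          ((1 / 2 : ℝ) • (Real.exp (B (p l)) • y (p l) + Real.exp (B (p (l + 1))) • y (p (l + 1)))) -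
        (Real.exp (B t) • y t - Real.exp (B s) • y s - ∫ r in s..t, Real.exp (B r) • y' r)‖ ≤
      η * (∑ l ∈ Finset.range n, (B (p (l + 1)) - B (p l)) ^ 2 + (t - s)) := by
  obtain ⟨δ, hδ, h⟩ := exists_stratonovich_error_le hB hy hy' s t hη
  refine ⟨δ, hδ, fun n p hp h0 hn hmesh => ?_⟩
  have hyc : Continuous y := continuous_iff_continuousAt.2 fun r => (hy r).continuousAt
  have e1 : Real.exp (B t) • y t - Real.exp (B s) • y s =
      ∑ l ∈ Finset.range n, (Real.exp (B (p (l + 1))) • y (p (l + 1)) -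
        Real.exp (B (p l)) • y (p l)) := by
    rw [Finset.sum_range_sub fun l => Real.exp (B (p l)) • y (p l), h0, hn]
  have e2 : ∫ r in s..t, Real.exp (B r) • y' r =
      ∑ l ∈ Finset.range n, ∫ r in p l..p (l + 1), Real.exp (B r) • y' r := by
    rw [intervalIntegral.sum_integral_adjacent_intervals fun l _ =>
      (by fun_prop : Continuous fun r => Real.exp (B r) • y' r).intervalIntegrable _ _, h0, hn]
  have e3 : t - s = ∑ l ∈ Finset.range n, (p (l + 1) - p l) := by
    rw [Finset.sum_range_sub, h0, hn]
  rw [e1, e2, e3, ← Finset.sum_sub_distrib, ← Finset.sum_sub_distrib, ← Finset.sum_add_distrib,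
    Finset.mul_sum]
  refine norm_sum_le_of_le _ fun l hl => ?_
  rw [Finset.mem_range] at hl
  exact h _ _ (h0 ▸ hp (Nat.zero_le l)) (hp (Nat.le_succ l)) (hn ▸ hp hl) (hmesh l hl)

/-- Convergence in probability from convergence relative to a sequence bounded in `L¹`. -/
theorem tendstoInMeasure_of_ae_tendsto_div {Ω E : Type*} [MeasurableSpace Ω] {P : Measure Ω}
    [IsProbabilityMeasure P] [NormedAddCommGroup E] {F : ℕ → Ω → E} {I : Ω → E} {Z : ℕ → Ω → ℝ}
    {C : ℝ} (hZ0 : ∀ k ω, 0 ≤ Z k ω) (hZ : ∀ k, Integrable (Z k) P) (hC : ∀ k, ∫ ω, Z k ω ∂P ≤ C)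
    (hm : ∀ k, AEStronglyMeasurable (fun ω => ‖F k ω - I ω‖ / (1 + Z k ω)) P)
    (hlim : ∀ᵐ ω ∂P, Tendsto (fun k => ‖F k ω - I ω‖ / (1 + Z k ω)) atTop (𝓝 0)) :
    TendstoInMeasure P F atTop I := by
  rw [tendstoInMeasure_iff_measureReal_norm]
  intro ε hε
  have h1 := tendstoInMeasure_iff_measureReal_norm.1 (tendstoInMeasure_of_tendsto_ae hm hlim)
  have hC0 : 0 ≤ C := (integral_nonneg (hZ0 0)).trans (hC 0)
  rw [Metric.tendsto_atTop]
  intro η hη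
  set Λ := 2 * (C + 1) / η
  have hΛ : 0 < Λ := by positivity
  obtain ⟨n, hn⟩ := Metric.tendsto_atTop.1 (h1 (ε / (1 + Λ)) (by positivity)) (η / 2) (by positivity)
  refine ⟨n, fun k hk => ?_⟩
  have h2 := hn k hk
  rw [Real.dist_eq, sub_zero, abs_of_nonneg measureReal_nonneg] at h2 ⊢
  have h3 : P.real {ω | Λ ≤ Z k ω} < η / 2 := by
    have h4 := (mul_meas_ge_le_integral_of_nonneg (ae_of_all _ (hZ0 k)) (hZ k) Λ).trans (hC k)
    have h5 : P.real {ω | Λ ≤ Z k ω} ≤ C / Λ := by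
      rw [le_div_iff₀ hΛ, mul_comm]; exact h4
    refine h5.trans_lt ?_
    simp only [Λ]
    rw [div_div_eq_mul_div, div_lt_div_iff₀ (by positivity) two_pos]
    nlinarith
  have hsub : {ω | ε ≤ ‖F k ω - I ω‖} ⊆
      {ω | ε / (1 + Λ) ≤ ‖‖F k ω - I ω‖ / (1 + Z k ω) - 0‖} ∪ {ω | Λ ≤ Z k ω} := by
    intro ω hω
    by_cases hz : Λ ≤ Z k ω
    · exact Or.inr hz
    · left
      push Not at hz
      have h5 : 0 < 1 + Z k ω := by linarith [hZ0 k ω]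
      change ε / (1 + Λ) ≤ ‖‖F k ω - I ω‖ / (1 + Z k ω) - 0‖
      rw [sub_zero, Real.norm_of_nonneg (by positivity)]
      exact div_le_div₀ (norm_nonneg _) hω h5 (by linarith)
  calc P.real {ω | ε ≤ ‖F k ω - I ω‖} ≤ _ := measureReal_mono hsub
    _ ≤ _ := measureReal_union_le _ _
    _ < η / 2 + η / 2 := add_lt_add h2 h3
    _ = η := add_halves η

/-! ### The increments of the driving noise -/

variable {P : Measure (WienerSpace m)}

/-- The noise of the `j`-th equation. -/
def drivingNoise (c : Fin N → Fin m → ℝ) (j : Fin N) (ω : WienerSpace m) (r : ℝ) : ℝ :=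
  ∑ i, c j i * ω.path r i

theorem continuous_drivingNoise (c : Fin N → Fin m → ℝ) (j : Fin N) (ω : WienerSpace m) :
    Continuous (drivingNoise c j ω) :=
  continuous_finsetSum _ fun i _ => (continuous_path_apply ω i).const_mul _

theorem measurable_drivingNoise (c : Fin N → Fin m → ℝ) (j : Fin N) (r : ℝ) :
    Measurable fun ω : WienerSpace m => drivingNoise c j ω r :=
  Finset.measurable_sum _ fun i _ => (measurable_path_apply r i).const_mul _

theorem IsWienerMeasure.memLp_increment (hP : IsWienerMeasure P) (i : Fin m) {u v : ℝ}
    (huv : u ≤ v) : MemLp (fun ω : WienerSpace m => ω.path v i - ω.path u i) 2 P := by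
  have h := memLp_two_of_isPreBrownianReal (hP.isPreBrownianReal_incr i u) (v - u).toNNReal
  have e : incr (m := m) i u (v - u).toNNReal = fun ω => ω.path v i - ω.path u i := by
    funext ω
    rw [incr, Real.coe_toNNReal _ (sub_nonneg.2 huv), add_sub_cancel]
  rwa [e] at h

theorem IsWienerMeasure.integral_increment_sq (hP : IsWienerMeasure P) (i : Fin m) {u v : ℝ}
    (huv : u ≤ v) : ∫ ω, (ω.path v i - ω.path u i) ^ 2 ∂P = v - u := by
  have h := integral_sq_of_isPreBrownianReal (hP.isPreBrownianReal_incr i u) (v - u).toNNReal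
  simpa only [incr, Real.coe_toNNReal _ (sub_nonneg.2 huv), add_sub_cancel] using h

theorem IsWienerMeasure.integrable_drivingNoise_sq (hP : IsWienerMeasure P)
    (c : Fin N → Fin m → ℝ) (j : Fin N) {u v : ℝ} (huv : u ≤ v) :
    Integrable (fun ω => (drivingNoise c j ω v - drivingNoise c j ω u) ^ 2) P := by
  have e : ∀ ω, drivingNoise c j ω v - drivingNoise c j ω u =
      ∑ i, c j i * (ω.path v i - ω.path u i) := fun ω => by
    simp only [drivingNoise, ← Finset.sum_sub_distrib, mul_sub]
  simp_rw [e]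
  exact (memLp_finsetSum _ fun i _ => (hP.memLp_increment i huv).const_mul (c j i)).integrable_sq

theorem IsWienerMeasure.integral_drivingNoise_sq_le (hP : IsWienerMeasure P)
    (c : Fin N → Fin m → ℝ) (j : Fin N) {u v : ℝ} (huv : u ≤ v) :
    ∫ ω, (drivingNoise c j ω v - drivingNoise c j ω u) ^ 2 ∂P ≤
      (∑ i, c j i ^ 2) * m * (v - u) := by
  have hint : ∀ i, Integrable (fun ω : WienerSpace m => (ω.path v i - ω.path u i) ^ 2) P := fun i =>
    (hP.memLp_increment i huv).integrable_sq
  calc ∫ ω, (drivingNoise c j ω v - drivingNoise c j ω u) ^ 2 ∂P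
      ≤ ∫ ω, (∑ i, c j i ^ 2) * ∑ i, (ω.path v i - ω.path u i) ^ 2 ∂P := by
        refine integral_mono (hP.integrable_drivingNoise_sq c j huv)
          ((integrable_finsetSum _ fun i _ => hint i).const_mul _) fun ω => ?_
        simp only [drivingNoise, ← Finset.sum_sub_distrib, ← mul_sub]
        exact Finset.sum_mul_sq_le_sq_mul_sq _ _ _
    _ = _ := by
        rw [integral_const_mul, integral_finsetSum _ fun i _ => hint i]
        simp only [hP.integral_increment_sq _ huv, Finset.sum_const, Finset.card_univ,
          Fintype.card_fin, nsmul_eq_mul]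
        ring

end

section

variable {m d N : ℕ}

/-! ### Stopped paths -/

/-- The path stopped at time `0`. -/
def freeze (ω : WienerSpace m) : WienerSpace m :=
  ⟨⟨fun t => ω.path (min t 0), ω.continuous_path.comp (by fun_prop)⟩, by
    change ω.path (min 0 0) = 0
    rw [min_self]
    exact ω.2⟩

theorem freeze_path (ω : WienerSpace m) (t : ℝ) : (freeze ω).path t = ω.path (min t 0) := rfl

theorem ou_freeze (ω : WienerSpace m) (i : Fin m) {t : ℝ} (ht : t ≤ 0) :
    ou (fun s => (freeze ω).path s i) t = ou (fun s => ω.path s i) t := by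
  refine setIntegral_congr_fun measurableSet_Iic fun τ hτ => ?_
  rw [mem_Iic] at hτ
  simp only [freeze_path]
  rw [min_eq_left ht, min_eq_left (by linarith)]

theorem ouSum_freeze (c : Fin N → Fin m → ℝ) (j : Fin N) (ω : WienerSpace m) {t : ℝ} (ht : t ≤ 0) :
    ouSum c j (freeze ω) t = ouSum c j ω t := by
  simp only [ouSum, ou_freeze ω _ ht]

theorem freeze_mem_goodSet_iff {K : ℝ} {ω : WienerSpace m} :
    freeze ω ∈ goodSet m K ↔ ω ∈ goodSet m K := by
  refine forall_congr' fun i => and_congr ?_ ?_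
  · refine forall₂_congr fun ε _ => exists_congr fun C => forall₂_congr fun t ht => ?_
    simp only [freeze_path, min_eq_left ht]
  · refine forall₂_congr fun ε _ => eventually_congr (Eventually.of_forall fun n => ?_)
    rw [intervalIntegral.integral_congr fun r hr => ?_]
    rw [uIcc_of_le (by simp)] at hr
    simp only [ou_freeze ω i hr.2]

/-- The frozen shifted path reads only increments up to time `t`. Whatever factors through it is
nonanticipating, and adaptedness of the stationary solution is proved in this way. -/
theorem measurable_freeze_shift (t : ℝ) :
    Measurable[past m t] fun ω : WienerSpace m => freeze (shift t ω) := by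
  refine @measurable_of_path m (WienerSpace m) (past m t) _ fun r => ?_
  have h1 : (fun ω : WienerSpace m => (freeze (shift t ω)).path r) =
      (fun x : Iic t → Fin m → ℝ => x ⟨min r 0 + t, mem_Iic.2 (by linarith [min_le_right r 0])⟩) ∘
        fun (ω : WienerSpace m) (u : Iic t) => ω.path u - ω.path t := by
    funext ω
    rw [freeze_path, shift_path]
    rfl
  rw [h1]
  exact (measurable_pi_apply _).comp (comap_measurable _)

theorem measurable_shift_uncurry :
    Measurable fun p : WienerSpace m × ℝ => shift p.2 p.1 := by
  have h0 : Measurable fun p : WienerSpace m × ℝ => p.1.path p.2 := by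
    have := measurable_uncurry_of_continuous_of_measurable
      (u := fun (r : ℝ) (ω : WienerSpace m) => ω.path r)
      (fun ω => ω.continuous_path) (fun r => measurable_path r)
    exact this.comp measurable_swap
  refine measurable_of_path fun t => ?_
  simp only [shift_path]
  exact (h0.comp (measurable_fst.prodMk (measurable_snd.const_add t))).sub h0

/-! ### The stationary solution -/

variable [NeZero N] {c : Fin N → Fin m → ℝ} {K ν κ : ℝ} {ω : WienerSpace m}
  {f : Fin N → Vec d → Vec d} {L : ℝ}

/-- The pullback trajectories run over `[-T, 0]`, where the field depends only on the path up to
time `0`; by uniqueness freezing does not change them. -/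
theorem pullbackLimit_freeze
    (h : IsDissipative (goodSet m K) (energyEquiv N d) (coupledField f c ν) (rate L c κ)
      (source L f c)) (hω : ω ∈ goodSet m K) :
    pullbackLimit (coupledField f c ν) (freeze ω) = pullbackLimit (coupledField f c ν) ω := by
  have hω' : freeze ω ∈ goodSet m K := freeze_mem_goodSet_iff.2 hω
  refine tendsto_nhds_unique (h.tendsto_pullback hω') ((h.tendsto_pullback hω).congr' ?_)
  filter_upwards [eventually_ge_atTop 0] with T hT
  have hs := h.shift_mem (-T) ω hω
  have hs' := h.shift_mem (-T) _ hω'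
  have h1 := (h.isForwardSolution hs 0).isSolutionOn (b := T) le_rfl
  have h2 := (h.isForwardSolution hs' 0).isSolutionOn (b := T) le_rfl
  have hfield : ∀ t ≤ T, ∀ x, coupledField f c ν (shift (-T) (freeze ω)) t x =
      coupledField f c ν (shift (-T) ω) t x := by
    intro t ht x
    funext j
    rw [coupledField_eq hs', coupledField_eq hs, ouSum_shift, ouSum_shift,
      ouSum_freeze _ _ _ (by linarith)]
  refine (h.lipschitz _ hs).eqOn h1 ⟨h2.cont, fun t ht => ?_⟩ ?_ (right_mem_Icc.2 hT)
  · rw [← hfield t ht.2.le]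
    exact h2.deriv t ht
  · rw [(h.isForwardSolution hs 0).init, (h.isForwardSolution hs' 0).init]

/-- The pullback limit of the coupled equations, extended by `0` to all paths. -/
def attractorPoint (f : Fin N → Vec d → Vec d) (c : Fin N → Fin m → ℝ) (K ν : ℝ) :
    WienerSpace m → Fin N → Vec d :=
  (goodSet m K).indicator (pullbackLimit (coupledField f c ν))

theorem attractorPoint_eq (hω : ω ∈ goodSet m K) :
    attractorPoint f c K ν ω = pullbackLimit (coupledField f c ν) ω := indicator_of_mem hω _

theorem measurable_attractorPoint
    (h : IsDissipative (goodSet m K) (energyEquiv N d) (coupledField f c ν) (rate L c κ)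
      (source L f c)) : Measurable (attractorPoint f c K ν) := by
  refine measurable_of_restrict_of_restrict_compl (measurableSet_goodSet K) ?_ ?_
  · have : (goodSet m K).domRestrict (attractorPoint f c K ν) =
        fun ω => pullbackLimit (coupledField f c ν) ω.1 := by
      funext ω; exact attractorPoint_eq ω.2
    rw [this]
    exact measurable_pullbackLimit h
  · have : (goodSet m K)ᶜ.domRestrict (attractorPoint f c K ν) = fun _ => 0 := by
      funext ω; exact indicator_of_notMem ω.2 _
    rw [this]
    exact measurable_const

theorem attractorPoint_freeze
    (h : IsDissipative (goodSet m K) (energyEquiv N d) (coupledField f c ν) (rate L c κ)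
      (source L f c)) (ω : WienerSpace m) :
    attractorPoint f c K ν (freeze ω) = attractorPoint f c K ν ω := by
  by_cases hω : ω ∈ goodSet m K
  · rw [attractorPoint_eq hω, attractorPoint_eq (freeze_mem_goodSet_iff.2 hω), pullbackLimit_freeze h hω]
  · rw [attractorPoint, indicator_of_notMem hω, indicator_of_notMem (mt freeze_mem_goodSet_iff.1 hω)]

/-- A version of the stationary solution of the coupled Stratonovich equations. -/
def stationarySolution (f : Fin N → Vec d → Vec d) (c : Fin N → Fin m → ℝ) (K ν t : ℝ)
    (ω : WienerSpace m) : Fin N → Vec d :=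
  fun j => Real.exp (ouSum c j ω t) • attractorPoint f c K ν (shift t ω) j

theorem stationarySolution_eq (hω : ω ∈ goodSet m K) (t : ℝ) (j : Fin N) :
    stationarySolution f c K ν t ω j =
      Real.exp (ouSum c j ω t) • pullbackLimit (coupledField f c ν) (shift t ω) j := by
  rw [stationarySolution, attractorPoint_eq (shift_mem_goodSet hω t)]

theorem stationarySolution_add (t h : ℝ) (ω : WienerSpace m) :
    stationarySolution f c K ν (t + h) ω = stationarySolution f c K ν t (shift h ω) := by
  funext j
  simp only [stationarySolution, ouSum_shift, shift_shift]

theorem backTransform_eq {a : WienerSpace m → Fin N → Vec d}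
    (ha : ∀ ω ∈ goodSet m K, a ω = pullbackLimit (coupledField f c ν) ω) (hω : ω ∈ goodSet m K)
    (t : ℝ) : backTransform c a t ω = stationarySolution f c K ν t ω := by
  funext j
  rw [backTransform, stationarySolution_eq hω, ouProcess_eq hω, ha _ (shift_mem_goodSet hω t)]

theorem measurable_stationarySolution_uncurry
    (h : IsDissipative (goodSet m K) (energyEquiv N d) (coupledField f c ν) (rate L c κ)
      (source L f c)) :
    Measurable fun p : WienerSpace m × ℝ => stationarySolution f c K ν p.2 p.1 := by
  refine measurable_pi_lambda _ fun j => ?_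
  have h1 : Measurable fun p : WienerSpace m × ℝ => attractorPoint f c K ν (shift p.2 p.1) j :=
    (measurable_pi_apply j).comp ((measurable_attractorPoint h).comp measurable_shift_uncurry)
  exact (measurable_ouSum c j).exp.smul h1

theorem measurable_stationarySolution
    (h : IsDissipative (goodSet m K) (energyEquiv N d) (coupledField f c ν) (rate L c κ)
      (source L f c)) (t : ℝ) : Measurable (stationarySolution f c K ν t) :=
  Measurable.comp (g := fun p : WienerSpace m × ℝ => stationarySolution f c K ν p.2 p.1)
    (f := fun ω => (ω, t)) (measurable_stationarySolution_uncurry h)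
    (measurable_id.prodMk measurable_const)

theorem stationarySolution_freeze
    (h : IsDissipative (goodSet m K) (energyEquiv N d) (coupledField f c ν) (rate L c κ)
      (source L f c)) (t : ℝ) (ω : WienerSpace m) :
    stationarySolution f c K ν t ω = stationarySolution f c K ν 0 (freeze (shift t ω)) := by
  funext j
  have h0 : ∀ ω : WienerSpace m, shift 0 ω = ω := shift_zero
  simp only [stationarySolution, h0, attractorPoint_freeze h, ouSum_freeze c j _ le_rfl, ouSum_shift,
    zero_add]

theorem measurable_past_stationarySolution
    (h : IsDissipative (goodSet m K) (energyEquiv N d) (coupledField f c ν) (rate L c κ)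
      (source L f c)) (t : ℝ) : Measurable[past m t] (stationarySolution f c K ν t) := by
  have h1 : stationarySolution f c K ν t =
      stationarySolution f c K ν 0 ∘ fun ω => freeze (shift t ω) :=
    funext fun ω => stationarySolution_freeze h t ω
  rw [h1]
  exact (measurable_stationarySolution h 0).comp (measurable_freeze_shift t)

theorem continuous_stationarySolution
    (h : IsDissipative (goodSet m K) (energyEquiv N d) (coupledField f c ν) (rate L c κ)
      (source L f c)) (hω : ω ∈ goodSet m K) :
    Continuous fun t => stationarySolution f c K ν t ω := by
  refine continuous_pi fun j => ?_
  have h1 : Continuous fun t => pullbackLimit (coupledField f c ν) (shift t ω) :=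
    continuous_iff_continuousAt.2 fun t => (h.hasDerivAt_pullbackLimit hω t).continuousAt
  have h2 := (continuous_ouSum hω c j).rexp.smul ((continuous_apply j).comp h1)
  exact h2.congr fun t => (stationarySolution_eq hω t j).symm

theorem continuous_coupledDrift (hf : ∀ j, Continuous (f j)) (ν : ℝ) :
    Continuous (coupledDrift f ν) := by
  unfold coupledDrift
  fun_prop

/-- The transformation that removes the noise from the Stratonovich equation. -/
theorem hasDerivAt_transform (hc : SameNoise c)
    (h : IsDissipative (goodSet m K) (energyEquiv N d) (coupledField f c ν) (rate L c κ)
      (source L f c)) (hω : ω ∈ goodSet m K) (j : Fin N) (t : ℝ) :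
    HasDerivAt (fun t => Real.exp (-drivingNoise c j ω t) • stationarySolution f c K ν t ω j)
      (Real.exp (-drivingNoise c j ω t) •
        coupledDrift f ν (stationarySolution f c K ν t ω) j) t := by
  set x : ℝ → Fin N → Vec d := fun t => pullbackLimit (coupledField f c ν) (shift t ω)
  have hx : HasDerivAt (fun t => x t j) (coupledField f c ν ω t (x t) j) t :=
    hasDerivAt_pi.1 (h.hasDerivAt_pullbackLimit hω t) j
  -- The derivative `-O` cancels the term `O x` in the conjugated field, so that only the drift
  -- remains.
  have hO : HasDerivAt (fun t => ouSum c j ω t - drivingNoise c j ω t) (-ouSum c j ω t) t := by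
    have h1 := HasDerivAt.fun_sum (u := Finset.univ) fun i _ =>
      ((hω i).1.hasDerivAt_ou_sub (continuous_path_apply ω i) t).const_mul (c j i)
    simp only [mul_sub, Finset.sum_sub_distrib, mul_neg, Finset.sum_neg_distrib] at h1
    exact h1
  have h2 := hO.exp.smul hx
  have hO' : ∀ k, ouSum c k ω t = ouSum c j ω t := fun k => by simp only [ouSum, hc k j]
  refine (h2.congr_deriv ?_).congr_of_eventuallyEq (Eventually.of_forall fun r => ?_)
  · have e1 : Real.exp (ouSum c j ω t - drivingNoise c j ω t) =
        Real.exp (-drivingNoise c j ω t) * Real.exp (ouSum c j ω t) := by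
      rw [← Real.exp_add]; congr 1; ring
    have e2 : Real.exp (ouSum c j ω t) * Real.exp (-ouSum c j ω t) = 1 := by
      rw [← Real.exp_add, add_neg_cancel, Real.exp_zero]
    rw [coupledField_eq hω, coupledDrift, e1]
    simp only [stationarySolution_eq hω, hO', conjugateField]
    change _ = Real.exp (-drivingNoise c j ω t) • (f j (Real.exp (ouSum c j ω t) • x t j) +
      ν • (Real.exp (ouSum c j ω t) • x t (j - 1) - (2 : ℝ) • Real.exp (ouSum c j ω t) • x t j +
        Real.exp (ouSum c j ω t) • x t (j + 1)))
    conv_rhs => rw [← one_smul ℝ (f j (Real.exp (ouSum c j ω t) • x t j)), ← e2]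
    module
  · change Real.exp (-drivingNoise c j ω r) • stationarySolution f c K ν r ω j =
      Real.exp (ouSum c j ω r - drivingNoise c j ω r) • x r j
    rw [stationarySolution_eq hω, smul_smul, ← Real.exp_add, sub_eq_neg_add]

variable {P : Measure (WienerSpace m)}

/-- The solution is `e^B y` with `y` of class `C¹`, so the error along a partition is at most `η (Z
+ t - s)`, where `Z` is the sum of squared noise increments. Along a fixed path `Z` need not stay
bounded under refinement, but its expectations do. Hence the error divided by `1 + Z` tends to zero
almost surely and the error itself in probability. -/
theorem isStratonovichIntegral_stationarySolution (hP : IsWienerMeasure P)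
    (hK : P (goodSet m K)ᶜ = 0) (hf : ∀ j, Continuous (f j)) (hc : SameNoise c)
    (h : IsDissipative (goodSet m K) (energyEquiv N d) (coupledField f c ν) (rate L c κ)
      (source L f c)) {s t : ℝ} (hst : s ≤ t) (j : Fin N) :
    IsStratonovichIntegral P (fun r ω => stationarySolution f c K ν r ω j)
      (fun r ω => ∑ i, c j i * ω.path r i) s t
      fun ω => stationarySolution f c K ν t ω j - stationarySolution f c K ν s ω j -
        ∫ r in s..t, coupledDrift f ν (stationarySolution f c K ν r ω) j := by
  intro n π hmono h0 hn hmesh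
  have := hP.isProbabilityMeasure
  have hp0 : ∀ k l, π k l ≤ π k (l + 1) := fun k l => hmono k (Nat.le_succ l)
  set X := stationarySolution f c K ν
  have hX : ∀ r, Measurable fun ω => X r ω j := fun r =>
    (measurable_pi_apply j).comp (measurable_stationarySolution h r)
  have hb := continuous_coupledDrift (N := N) (d := d) hf ν
  set Z : ℕ → WienerSpace m → ℝ := fun k ω =>
    ∑ l ∈ Finset.range (n k), (drivingNoise c j ω (π k (l + 1)) - drivingNoise c j ω (π k l)) ^ 2
  have hZm : ∀ k, Measurable (Z k) := fun k => Finset.measurable_sum _ fun l _ =>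
    ((measurable_drivingNoise c j _).sub (measurable_drivingNoise c j _)).pow_const 2
  have hZ0 : ∀ k ω, 0 ≤ Z k ω := fun k ω => Finset.sum_nonneg fun _ _ => sq_nonneg _
  refine tendstoInMeasure_of_ae_tendsto_div (Z := Z) (C := (∑ i, c j i ^ 2) * m * (t - s)) hZ0
    (fun k => integrable_finsetSum _ fun l _ => hP.integrable_drivingNoise_sq c j (hp0 k l))
    (fun k => ?_) (fun k => ?_) ?_
  · simp only [Z]
    rw [integral_finsetSum _ fun l _ => hP.integrable_drivingNoise_sq c j (hp0 k l)]
    refine (Finset.sum_le_sum fun l _ => hP.integral_drivingNoise_sq_le c j (hp0 k l)).trans ?_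
    rw [← Finset.mul_sum, Finset.sum_range_sub, h0, hn]
  · have hI : Measurable fun ω => ∫ r in s..t, coupledDrift f ν (X r ω) j :=
      measurable_intervalIntegral (F := fun ω r => coupledDrift f ν (X r ω) j)
        ((measurable_pi_apply j).comp
          (hb.measurable.comp (measurable_stationarySolution_uncurry h)))
        measurable_const measurable_const
    have hF : Measurable fun ω => ∑ l ∈ Finset.range (n k),
        (drivingNoise c j ω (π k (l + 1)) - drivingNoise c j ω (π k l)) •
          ((1 / 2 : ℝ) • (X (π k l) ω j + X (π k (l + 1)) ω j)) :=
      Finset.measurable_sum _ fun l _ =>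
        ((measurable_drivingNoise c j _).sub (measurable_drivingNoise c j _)).smul
          (((hX _).add (hX _)).const_smul (1 / 2 : ℝ))
    exact ((hF.sub (((hX t).sub (hX s)).sub hI)).norm.div ((hZm k).const_add 1)).aestronglyMeasurable
  · filter_upwards [show ∀ᵐ ω ∂P, ω ∈ goodSet m K from hK] with ω hω
    have hB := continuous_drivingNoise c j ω
    have hXc := continuous_stationarySolution h hω
    have hy' : Continuous fun r => Real.exp (-drivingNoise c j ω r) • coupledDrift f ν (X r ω) j :=
      hB.neg.rexp.smul ((continuous_apply j).comp (hb.comp hXc))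
    have hcancel : ∀ r (v : Vec d), Real.exp (drivingNoise c j ω r) •
        Real.exp (-drivingNoise c j ω r) • v = v := fun r v => by
      rw [smul_smul, ← Real.exp_add, add_neg_cancel, Real.exp_zero, one_smul]
    rw [Metric.tendsto_atTop]
    intro ε hε
    have hts : 0 ≤ t - s := sub_nonneg.2 hst
    obtain ⟨δ, hδ, hsum⟩ := exists_stratonovich_sum_error_le hB (hasDerivAt_transform hc h hω j) hy'
      s t (η := ε / (2 * (1 + (t - s)))) (by positivity)
    simp only [hcancel] at hsum
    obtain ⟨k₀, hk₀⟩ := eventually_atTop.1 (hmesh δ hδ)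
    refine ⟨k₀, fun k hk => ?_⟩
    have h1 := hsum (n k) (π k) (hmono k) (h0 k) (hn k) (hk₀ k hk)
    have hZk := hZ0 k ω
    rw [Real.dist_eq, sub_zero, abs_of_nonneg (by positivity), div_lt_iff₀ (by positivity)]
    refine h1.trans_lt ?_
    change ε / (2 * (1 + (t - s))) * (Z k ω + (t - s)) < ε * (1 + Z k ω)
    have h2 : Z k ω + (t - s) ≤ (1 + (t - s)) * (1 + Z k ω) := by nlinarith
    calc ε / (2 * (1 + (t - s))) * (Z k ω + (t - s))
        ≤ ε / (2 * (1 + (t - s))) * ((1 + (t - s)) * (1 + Z k ω)) := by gcongr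
      _ = ε / 2 * (1 + Z k ω) := by field_simp
      _ < ε * (1 + Z k ω) := by gcongr; linarith

theorem isStratonovichSolution_backTransform (hP : IsWienerMeasure P)
    (hK : P (goodSet m K)ᶜ = 0) (hf : ∀ j, Continuous (f j)) (hc : SameNoise c)
    (h : IsDissipative (goodSet m K) (energyEquiv N d) (coupledField f c ν) (rate L c κ)
      (source L f c)) {a : WienerSpace m → Fin N → Vec d}
    (ha : ∀ ω ∈ goodSet m K, a ω = pullbackLimit (coupledField f c ν) ω) :
    IsStratonovichSolution P (coupledDrift f ν) c (backTransform c a) := by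
  have hgood : ∀ᵐ ω ∂P, ω ∈ goodSet m K := hK
  refine ⟨fun t => ?_, ?_, fun s t hst j n π hmono h0 hn hmesh => ?_⟩
  · refine ⟨stationarySolution f c K ν t,
      (measurable_past_stationarySolution h t).stronglyMeasurable, ?_⟩
    · filter_upwards [hgood] with ω hω using backTransform_eq ha hω t
  · filter_upwards [hgood] with ω hω
    exact (continuous_stationarySolution h hω).congr fun t => (backTransform_eq ha hω t).symm
  · refine TendstoInMeasure.congr (fun k => ?_) ?_
      (isStratonovichIntegral_stationarySolution hP hK hf hc h hst j n π hmono h0 hn hmesh)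
    · filter_upwards [hgood] with ω hω
      simp only [backTransform_eq ha hω]
    · filter_upwards [hgood] with ω hω
      simp only [backTransform_eq ha hω]

/-- Up to null sets, shifting time by `s` is the same as evaluating the process at `shift s ω`, and
the shift preserves `P`. -/
theorem isStationary_backTransform (hP : IsWienerMeasure P) (hK : P (goodSet m K)ᶜ = 0)
    (h : IsDissipative (goodSet m K) (energyEquiv N d) (coupledField f c ν) (rate L c κ)
      (source L f c)) {a : WienerSpace m → Fin N → Vec d}
    (ha : ∀ ω ∈ goodSet m K, a ω = pullbackLimit (coupledField f c ν) ω) :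
    IsStationary P (backTransform c a) := by
  have hgood : ∀ᵐ ω ∂P, ω ∈ goodSet m K := hK
  intro s
  have hm : Measurable fun (ω : WienerSpace m) t => stationarySolution f c K ν t ω :=
    measurable_pi_lambda _ fun t => measurable_stationarySolution h t
  have hae : ∀ s, (fun ω t => stationarySolution f c K ν (t + s) ω) =ᵐ[P]
      fun ω t => backTransform c a (t + s) ω := fun s => by
    filter_upwards [hgood] with ω hω
    funext t
    exact (backTransform_eq ha hω _).symm
  have h1 : (fun (ω : WienerSpace m) t => stationarySolution f c K ν (t + s) ω) =
      (fun ω t => stationarySolution f c K ν t ω) ∘ shift s := by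
    funext ω t
    exact stationarySolution_add t s ω
  have h2 : IdentDistrib (fun ω t => stationarySolution f c K ν (t + s) ω)
      (fun ω t => stationarySolution f c K ν t ω) P P := by
    rw [h1]
    refine ⟨(hm.comp (measurable_shift s)).aemeasurable, hm.aemeasurable, ?_⟩
    rw [← Measure.map_map hm (measurable_shift s), (hP.measurePreserving_shift s).map_eq]
  have h3 := hae 0
  simp only [add_zero] at h3
  exact ((IdentDistrib.of_ae_eq h2.aemeasurable_fst (hae s)).symm.trans h2).trans
    (IdentDistrib.of_ae_eq h2.aemeasurable_snd h3)

/-- Back transformation preserves the synchronization of the attractors. -/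
theorem tendstoUniformlyOn_backTransform (hc : SameNoise c) (hω : ω ∈ goodSet m K)
    {a : ℝ → WienerSpace m → Fin N → Vec d} {z : WienerSpace m → Vec d} {T₁ T₂ : ℝ}
    (h : TendstoUniformlyOn (fun ν t => a ν (shift t ω)) (fun t _ => z (shift t ω)) atTop
      (Icc T₁ T₂)) :
    TendstoUniformlyOn (fun ν t => backTransform c (a ν) t ω)
      (fun t _ => Real.exp (ouProcess c 0 t ω) • z (shift t ω)) atTop (Icc T₁ T₂) := by
  obtain ⟨M, hM⟩ := (isCompact_Icc (a := T₁) (b := T₂)).exists_bound_of_continuousOn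
    (continuous_ouSum hω c 0).rexp.continuousOn
  rw [Metric.tendstoUniformlyOn_iff] at h ⊢
  intro ε hε
  have hM0 : 0 < |M| + 1 := by positivity
  filter_upwards [h (ε / (|M| + 1)) (by positivity)] with ν hν t ht
  have h1 := hν t ht
  rw [dist_comm, dist_eq_norm] at h1 ⊢
  have hO : ∀ j, ouProcess c j t ω = ouSum c 0 ω t := fun j => by
    rw [ouProcess_eq hω]; simp only [ouSum, hc j 0]
  have h2 : (backTransform c (a ν) t ω - fun _ => Real.exp (ouProcess c 0 t ω) • z (shift t ω)) =
      Real.exp (ouSum c 0 ω t) • (a ν (shift t ω) - fun _ => z (shift t ω)) := by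
    funext j
    simp only [Pi.sub_apply, Pi.smul_apply, backTransform, hO, smul_sub]
  rw [h2, norm_smul]
  calc ‖Real.exp (ouSum c 0 ω t)‖ * ‖a ν (shift t ω) - fun _ => z (shift t ω)‖
      ≤ (|M| + 1) * ‖a ν (shift t ω) - fun _ => z (shift t ω)‖ := by
        gcongr
        linarith [hM t ht, le_abs_self M]
    _ < (|M| + 1) * (ε / (|M| + 1)) := by gcongr
    _ = ε := by field_simp

end

end StochSync

end

/-! ### The main theorem -/

open StochSync in
theorem mainTheorem5 {N m d : ℕ} [NeZero N]
    (f : Fin N → Vec d → Vec d) (hf : ∀ j, Continuous (f j))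
    (L : ℝ) (hL : 0 < L)
    (hdiss : ∀ j x₁ x₂, inner ℝ (x₁ - x₂) (f j x₁ - f j x₂) ≤ -L * ‖x₁ - x₂‖ ^ 2)
    (c : Fin N → Fin m → ℝ)
    (P : Measure (WienerSpace m)) (hP : IsWienerMeasure P) :
    ∃ Ω' : Set (WienerSpace m), MeasurableSet Ω' ∧ P Ω'ᶜ = 0 ∧
      (∀ t, ∀ ω ∈ Ω', shift t ω ∈ Ω') ∧
      -- the coupled and the averaged equations generate random dynamical systems
      (∀ ν : ℝ, 0 < ν → GeneratesRDS Ω' (coupledField f c ν)) ∧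
      GeneratesRDS Ω' (averagedField f c) ∧
      ∃ ν₀ : ℝ, 0 < ν₀ ∧
        -- the singleton attractors exist
        (∀ ν : ℝ, 0 < ν → (ν₀ ≤ ν ∨ SameNoise c) →
          ∃ a, IsSingletonAttractor Ω' (coupledField f c ν) a) ∧
        (∃ z, IsSingletonAttractor Ω' (averagedField f c) z) ∧
        ∀ (xbar : ℝ → WienerSpace m → Fin N → Vec d) (zbar : WienerSpace m → Vec d),
          (∀ ν : ℝ, ν₀ ≤ ν → IsSingletonAttractor Ω' (coupledField f c ν) (xbar ν)) →
          IsSingletonAttractor Ω' (averagedField f c) zbar →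
          -- convergence of the attractor trajectories
          (∀ ω ∈ Ω', ∀ T₁ T₂ : ℝ,
            TendstoUniformlyOn (fun (ν : ℝ) (t : ℝ) => xbar ν (shift t ω))
              (fun t _ => zbar (shift t ω)) atTop (Icc T₁ T₂)) ∧
          -- exact synchronization of the stochastic equations when the noise is the same
          (SameNoise c →
            (∀ ν : ℝ, ν₀ ≤ ν →
              IsStratonovichSolution P (coupledDrift f ν) c (backTransform c (xbar ν)) ∧
              IsStationary P (backTransform c (xbar ν))) ∧
            ∀ ω ∈ Ω', ∀ T₁ T₂ : ℝ,
              TendstoUniformlyOn (fun (ν : ℝ) (t : ℝ) => backTransform c (xbar ν) t ω)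
                (fun t _ => Real.exp (ouProcess c 0 t ω) • zbar (shift t ω))
                atTop (Icc T₁ T₂)) := by
  have hN : (0 : ℝ) < N := by exact_mod_cast Nat.pos_of_ne_zero (NeZero.ne N)
  obtain ⟨K, hK0, hK⟩ := hP.exists_goodSet
  set G := (∑ j, ∑ i, c j i ^ 2) * (m * (K + 1))
  have hG : 0 ≤ G := by positivity
  -- the admissible strength of the quadratic term in the energy rate
  set κ := L / (2 * (G + 1))
  have hκ0 : 0 < κ := by positivity
  have hκL : κ * G ≤ L / 2 := by
    have : κ * (G + 1) = L / 2 := by simp only [κ]; field_simp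
    nlinarith
  -- The threshold is chosen so that `2 N ^ 2 / ν ≤ κ` for `ν ≥ ν₀`. It is non-random, because the
  -- bound `K` on the mean squares is.
  set ν₀ := 2 * (N : ℝ) ^ 2 / κ
  have hν₀ : 0 < ν₀ := by positivity
  have hadm : ∀ ν ≥ ν₀, IsAdmissible c ν κ := fun ν hν => Or.inl (by
    rw [div_le_iff₀ (hν₀.trans_le hν), ← div_le_iff₀' hκ0]; exact hν)
  have hdis : ∀ ν ≥ ν₀, IsDissipative (goodSet m K) (energyEquiv N d) (coupledField f c ν)
      (rate L c κ) (source L f c) := fun ν hν =>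
    isDissipative_coupled hf hL hdiss (hν₀.trans_le hν) (hadm ν hν) hK0 hκ0.le hκL
  have hav := isDissipative_averaged hf hL hdiss c hK0
  refine ⟨goodSet m K, measurableSet_goodSet K, hK, fun t ω hω => shift_mem_goodSet hω t,
    fun ν hν => (isRandomField_coupled hf hL hdiss hν (Or.inl le_rfl) K).generatesRDS,
    hav.generatesRDS, ν₀, hν₀, fun ν hν h => ?_, ⟨_, hav.isSingletonAttractor⟩,
    fun xbar zbar hx hz => ?_⟩
  · rcases h with h | h
    · exact ⟨_, (hdis ν h).isSingletonAttractor⟩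
    -- For identical noise `κ = 0` is admissible, which makes the smallness condition trivial for
    -- every `ν > 0`.
    · exact ⟨_, (isDissipative_coupled hf hL hdiss hν (Or.inr ⟨h, le_rfl⟩) hK0 le_rfl
        (by rw [zero_mul]; positivity)).isSingletonAttractor⟩
  have hxeq : ∀ ν ≥ ν₀, ∀ ω ∈ goodSet m K, xbar ν ω = pullbackLimit (coupledField f c ν) ω :=
    fun ν hν ω hω => (hdis ν hν).eq_pullbackLimit (hx ν hν) hω
  have hconv : ∀ ω ∈ goodSet m K, ∀ T₁ T₂ : ℝ,
      TendstoUniformlyOn (fun (ν : ℝ) (t : ℝ) => xbar ν (shift t ω))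
        (fun t (_ : Fin N) => zbar (shift t ω)) atTop (Icc T₁ T₂) := by
    intro ω hω T₁ T₂
    refine ((tendstoUniformlyOn_pullbackLimit hf hL hdiss hK0 hω hν₀ hκ0.le hκL hadm
      T₁ T₂).congr ?_).congr_right fun t _ => ?_
    · filter_upwards [eventually_ge_atTop ν₀] with ν hν t _
      exact (hxeq ν hν _ (shift_mem_goodSet hω t)).symm
    · funext j
      exact (hav.eq_pullbackLimit hz (shift_mem_goodSet hω t)).symm
  refine ⟨hconv, fun hc => ⟨fun ν hν => ⟨?_, ?_⟩, fun ω hω T₁ T₂ => ?_⟩⟩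
  · exact isStratonovichSolution_backTransform hP hK hf hc (hdis ν hν) (hxeq ν hν)
  · exact isStationary_backTransform hP hK (hdis ν hν) (hxeq ν hν)
  · exact tendstoUniformlyOn_backTransform hc hω (hconv ω hω T₁ T₂)
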